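/- Let $G$ be a group, $\Bbbk$ a commutative ring, and write monoidal categories as if they were strict. **Conventions.** A category is *pivotal* if each object $X$ has an object $X^*$ with morphisms $\mathrm{ev}_X\colon X^*\otimes X\to 1$, $\mathrm{coev}_X\colon 1\to X\otimes X^*$ making it a left dual and $\widetilde{\mathrm{ev}}_X\colon X\otimes X^*\to 1$, $\widetilde{\mathrm{coev}}_X\colon 1\to X^*\otimes X$ making it a right dual, such that the left and right dual functors coincide as monoidal functors; $\dim_l(X)=\mathrm{ev}_X\widetilde{\mathrm{coev}}_X\in\mathrm{End}(1)$. A strong monoidal functor $F$ between pivotal categories is *pivotal* if the isomorphisms $F(X^*)\to F(X)^*$ obtained from left and from right duality coincide. A *$G$-graded category* is a $\Bbbk$-additive monoidal category $\mathcal C$ (with $\Bbbk$-bilinear $\otimes$) with pairwise disjoint full $\Bbbk$-additive subcategories $\mathcal C_\alpha$ ($\alpha\in G$) such that every object is a finite direct sum of objects $X_\alpha\in\mathcal C_\alpha$, $\mathcal C_\alpha\otimes\mathcal C_\beta\subset\mathcal C_{\alpha\beta}$, $\mathrm{Hom}(\mathcal C_\alpha,\mathcal C_\beta)=0$ for $\alpha\ne\beta$,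 and $1\in\mathcal C_1$; write $|X|=\alpha$ if $X\in\mathcal C_\alpha$. If $\mathcal C$ is pivotal, duals are chosen with $X^*\in\mathcal C_{\alpha^{-1}}$ for $X\in\mathcal C_\alpha$. A pivotal $G$-graded category is *non-singular* if it is pure ($f\otimes\mathrm{id}_X=\mathrm{id}_X\otimes f$ for $f\in\mathrm{End}(1)$), all its idempotents split, and for every $\alpha$ the class $\mathcal E_\alpha$ of objects $V\in\mathcal C_\alpha$ with $d_V=\dim_l(V)$ invertible is non-empty. A *crossing* in a $G$-graded category $\mathcal D$ is a family of $\Bbbk$-linear strong monoidal auto-equivalences $\varphi_\alpha$ of $\mathcal D$ with $\varphi_\alpha(\mathcal D_\beta)\subset\mathcal D_{\alpha^{-1}\beta\alpha}$ and monoidal natural isomorphisms $\varphi_2(\alpha,\beta)\colon\varphi_\alpha\varphi_\beta\to\varphi_{\beta\alpha}$ and $\varphi_0\colon 1_{\mathcal D}\to\varphi_1$ satisfying the associativity and unit axioms of a monoidal functor; it is *pivotal* if all $\varphi_\alpha$ are. A *$G$-braiding* is a natural family of isomorphisms $\tau_{X,Y}\colon X\otimes Y\to Y\otimes\varphi_{|Y|}(X)$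 ($Y$ homogeneous) with $\tau_{X,Y\otimes Z}=(\mathrm{id}\otimes\varphi_2(|Z|,|Y|)_X)(\mathrm{id}_Y\otimes\tau_{\varphi_{|Y|}(X),Z})(\tau_{X,Y}\otimes\mathrm{id}_Z)$, $\tau_{X\otimes Y,Z}=(\mathrm{id}_Z\otimes(\varphi_{|Z|})_2(X,Y))(\tau_{X,Z}\otimes\mathrm{id})(\mathrm{id}_X\otimes\tau_{Y,Z})$, and $\varphi_\alpha(\tau_{X,Y})(\varphi_\alpha)_2(X,Y)=(\varphi_\alpha)_2(Y,\varphi_{|Y|}(X))\bigl(\mathrm{id}\otimes\varphi_2(\alpha,|Y|)_X^{-1}\varphi_2(\alpha^{-1}|Y|\alpha,\alpha)_X\bigr)\tau_{\varphi_\alpha(X),\varphi_\alpha(Y)}$. The *$G$-center* $\mathcal Z_G(\mathcal C)=\mathcal Z(\mathcal C;\mathcal C_1)$ has as objects the pairs $(A,\sigma)$, $A\in\mathcal C$, $\sigma=\{\sigma_X\colon A\otimes X\to X\otimes A\}_{X\in\mathcal C_1}$ a natural family of isomorphisms with $\sigma_{X\otimes Y}=(\mathrm{id}_X\otimes\sigma_Y)(\sigma_X\otimes\mathrm{id}_Y)$,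 and as morphisms the morphisms of $\mathcal C$ commuting with these; $(A,\sigma)\otimes(B,\rho)=(A\otimes B,(\sigma\otimes\mathrm{id}_B)(\mathrm{id}_A\otimes\rho))$ and $|(A,\sigma)|=|A|$. For $A=(A,\sigma)$, an object $Y$, and $W$ with $|Y|=|W|$, let $c^W_{A,Y}=(\sigma_{Y\otimes W^*}\otimes\mathrm{id}_W)(\mathrm{id}_{A\otimes Y}\otimes\widetilde{\mathrm{coev}}_W)\colon A\otimes Y\to Y\otimes W^*\otimes A\otimes W$. For $V\in\mathcal E_\alpha$ put $\pi^V_A=d_V^{-1}(\mathrm{ev}_V\otimes\mathrm{id})(\mathrm{id}_{V^*}\otimes c^V_{A,V})\in\mathrm{End}(V^*\otimes A\otimes V)$. **Theorem.** Let $\mathcal C$ be a non-singular pivotal $G$-graded category over $\Bbbk$. Then $\mathcal Z_G(\mathcal C)$ is a pivotal $G$-graded category, with $(A,\sigma)^*=(A^*,\sigma^\dagger)$, $\sigma^\dagger_X=(\mathrm{ev}_A\otimes\mathrm{id})(\mathrm{id}\otimes\sigma_X^{-1}\otimes\mathrm{id})(\mathrm{id}\otimes\mathrm{coev}_A)$ and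 the (co)evaluations of $\mathcal C$, and it has a canonical structure of a $G$-braided category with pivotal crossing, as follows. 1. For $V\in\mathcal E_\alpha$ the $\pi^V_A$ are idempotents, and they have splittings $\pi^V_A=q^V_Ap^V_A$, $p^V_Aq^V_A=\mathrm{id}_{E^V_A}$ with $E^V_A\in\mathcal C_{\alpha^{-1}\beta\alpha}$ if $A\in\mathcal C_\beta$. For each choice of these there is a strong monoidal endofunctor $\varphi_V$ of $\mathcal Z_G(\mathcal C)$ with $\varphi_V(A,\sigma)=(E^V_A,\gamma^V_A)$, $\gamma^V_{A,X}=d_V^{-1}(\mathrm{id}_X\otimes p^V_A)(\mathrm{ev}_V\otimes\mathrm{id})(\mathrm{id}_{V^*}\otimes c^V_{A,V\otimes X})(q^V_A\otimes\mathrm{id}_X)$, $\varphi_V(f)=p^V_B(\mathrm{id}\otimes f\otimes\mathrm{id})q^V_A$ for $f\colon A\to B$, $(\varphi_V)_2(A,B)=p^V_{A\otimes B}(\mathrm{id}\otimes\widetilde{\mathrm{ev}}_V\otimes\mathrm{id})(q^V_A\otimes q^V_B)$, and $(\varphi_V)_0=p^V_{1}\widetilde{\mathrm{coev}}_V$. 2.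 For every such choice (for all $\alpha$ and $V$) there are a pivotal crossing $\varphi$ and a $G$-braiding $\tau$ in $\mathcal Z_G(\mathcal C)$ and monoidal natural isomorphisms $\iota^\alpha_V\colon\varphi_\alpha\to\varphi_V$ ($V\in\mathcal E_\alpha$) exhibiting $\varphi_\alpha$ as the projective limit of the $\varphi_V$, $V\in\mathcal E_\alpha$, along the morphisms $\delta^{U,V}_A=d_V^{-1}p^U_A(\mathrm{ev}_V\otimes\mathrm{id})(\mathrm{id}_{V^*}\otimes c^U_{A,V})q^V_A\colon\varphi_V(A)\to\varphi_U(A)$, such that $\iota^{\beta\alpha}_W\varphi_2(\alpha,\beta)=\zeta^{U,V,W}\varphi_U(\iota^\beta_V)(\iota^\alpha_U)_{\varphi_\beta}$, $\iota^1_U\varphi_0=\eta^U$ and $(\mathrm{id}_B\otimes\iota^{|B|}_V)\tau_{A,B}=\Gamma^V_{A,B}$, where $\zeta^{U,V,W}_A=d_U^{-1}d_V^{-1}p^W_A(\mathrm{ev}_U\otimes\mathrm{id})(\mathrm{id}_{U^*}\otimes\mathrm{ev}_V\otimes\mathrm{id})(\mathrm{id}_{U^*\otimes V^*}\otimes c^W_{A,V\otimes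 U})(\mathrm{id}_{U^*}\otimes q^V_A\otimes\mathrm{id}_U)q^U_{\varphi_V(A)}$, $\eta^U_A=p^U_A(\sigma_{U^*}\otimes\mathrm{id}_U)(\mathrm{id}_A\otimes\widetilde{\mathrm{coev}}_U)$ and $\Gamma^V_{A,X}=(\mathrm{id}_X\otimes p^V_A)c^V_{A,X}$. 3. If $(\varphi,\tau,\iota)$ and $(\varphi',\tau',\iota')$ are two structures as in 2, obtained from possibly different choices of splittings $(p,q)$ and $(p',q')$, there is a unique family of natural isomorphisms $\theta_\alpha\colon\varphi_\alpha\to\varphi'_\alpha$ with $q'^V_A\,(\iota'^\alpha_V)_A\,(\theta_\alpha)_A=q^V_A\,(\iota^\alpha_V)_A$ for all $\alpha$, $V\in\mathcal E_\alpha$, $A$; each $\theta_\alpha$ is monoidal, and $\theta$ carries $\varphi_2,\varphi_0,\tau$ to $\varphi_2',\varphi_0',\tau'$. -/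

import Mathlib

open CategoryTheory MonoidalCategory Limits

universe v u w

/-- Pivotal structure on a monoidal category: every object `X` has one dual `X*` which is at the same
time a left dual (`ev : X* ⊗ X ⟶ 𝟙`, `coev : 𝟙 ⟶ X ⊗ X*`) and a right dual
(`ev' : X ⊗ X* ⟶ 𝟙`, `coev' : 𝟙 ⟶ X* ⊗ X`), and the resulting left and right dual functors agree as
monoidal functors, i.e. on morphisms and on the two monoidal constraints. -/
structure PivotalStructure (C : Type u) [Category.{v} C] [MonoidalCategory C] where
  dual : C → C
  left (X : C) : ExactPairing X (dual X)
  right (X : C) : ExactPairing (dual X) X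
  dual_map {X Y : C} (f : X ⟶ Y) :
    (ρ_ (dual Y)).inv ≫ dual Y ◁ (left X).coevaluation' ≫ dual Y ◁ (f ▷ dual X) ≫
        (α_ _ _ _).inv ≫ (left Y).evaluation' ▷ dual X ≫ (λ_ (dual X)).hom =
      (λ_ (dual Y)).inv ≫ (right X).coevaluation' ▷ dual Y ≫ (dual X ◁ f) ▷ dual Y ≫
        (α_ _ _ _).hom ≫ dual X ◁ (right Y).evaluation' ≫ (ρ_ (dual X)).hom
  dual_unit :
    (left (𝟙_ C)).coevaluation' ≫ (λ_ (dual (𝟙_ C))).hom =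
      (right (𝟙_ C)).coevaluation' ≫ (ρ_ (dual (𝟙_ C))).hom
  dual_tensor (X Y : C) :
    𝟙 (dual X ⊗ dual Y) ⊗≫ (dual X ⊗ dual Y) ◁ (left (Y ⊗ X)).coevaluation' ⊗≫
        dual X ◁ ((left Y).evaluation' ▷ (X ⊗ dual (Y ⊗ X))) ⊗≫
        (left X).evaluation' ▷ dual (Y ⊗ X) ⊗≫ 𝟙 (dual (Y ⊗ X)) =
      𝟙 (dual X ⊗ dual Y) ⊗≫ (right (Y ⊗ X)).coevaluation' ▷ (dual X ⊗ dual Y) ⊗≫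
        ((dual (Y ⊗ X) ⊗ Y) ◁ (right X).evaluation') ▷ dual Y ⊗≫
        dual (Y ⊗ X) ◁ (right Y).evaluation' ⊗≫ 𝟙 (dual (Y ⊗ X))

namespace PivotalStructure

variable {C : Type u} [Category.{v} C] [MonoidalCategory C] (P : PivotalStructure C)

def ev (X : C) : P.dual X ⊗ X ⟶ 𝟙_ C := (P.left X).evaluation'

def coev (X : C) : 𝟙_ C ⟶ X ⊗ P.dual X := (P.left X).coevaluation'

def ev' (X : C) : X ⊗ P.dual X ⟶ 𝟙_ C := (P.right X).evaluation'

def coev' (X : C) : 𝟙_ C ⟶ P.dual X ⊗ X := (P.right X).coevaluation'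

/-- The left dimension, the left trace of the identity. -/
def dimLeft (X : C) : 𝟙_ C ⟶ 𝟙_ C := P.coev' X ≫ P.ev X

end PivotalStructure

section PivotalFunctor

variable {C : Type u} [Category.{v} C] [MonoidalCategory C] (P : PivotalStructure C)
  (F : C ⥤ C) [F.Monoidal]

open Functor.LaxMonoidal Functor.OplaxMonoidal

/-- The comparison `F(X*) ⟶ F(X)*` built from left duality; `η F` is the inverse of `ε F`. -/
def dualCompLeft (X : C) : F.obj (P.dual X) ⟶ P.dual (F.obj X) :=
  (ρ_ _).inv ≫ F.obj (P.dual X) ◁ P.coev (F.obj X) ≫ (α_ _ _ _).inv ≫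
    (μ F (P.dual X) X ≫ F.map (P.ev X) ≫ η F) ▷ P.dual (F.obj X) ≫ (λ_ _).hom

/-- The comparison `F(X*) ⟶ F(X)*` built from right duality. -/
def dualCompRight (X : C) : F.obj (P.dual X) ⟶ P.dual (F.obj X) :=
  (λ_ _).inv ≫ P.coev' (F.obj X) ▷ F.obj (P.dual X) ≫ (α_ _ _ _).hom ≫
    P.dual (F.obj X) ◁ (μ F X (P.dual X) ≫ F.map (P.ev' X) ≫ η F) ≫ (ρ_ _).hom

/-- A strong monoidal endofunctor of a pivotal category is pivotal if both comparisons agree. -/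
def IsPivotalFunctor : Prop := ∀ X : C, dualCompLeft P F X = dualCompRight P F X

end PivotalFunctor

section Graded

variable {G : Type*} [Group G] {C : Type u} [Category.{v} C] [Preadditive C] [MonoidalCategory C]

/-- The full subcategories of `C` on the classes of objects `𝒞 α`, `α ∈ G`, make `C` a `G`-graded
category (the `k`-linear structure of `C` and the bilinearity of its tensor product are expressed by
`Linear k C`, `MonoidalPreadditive C`, `MonoidalLinear k C`). The subcategories are disjoint, hence
not closed under isomorphism: each of them has its own zero objects. -/
structure IsGGraded (𝒞 : G → ObjectProperty C) : Prop where
  hasFiniteBiproducts : HasFiniteBiproducts C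
  additive (α : G) {n : ℕ} (f : Fin n → C) : (∀ i, 𝒞 α (f i)) →
    ∃ b : Bicone f, 𝒞 α b.pt ∧ Nonempty b.IsBilimit
  disjoint {α β : G} {X : C} : 𝒞 α X → 𝒞 β X → α = β
  decomposition (X : C) : ∃ (s : Finset G) (f : s → C) (b : Bicone f),
    (∀ a : s, 𝒞 a (f a)) ∧ Nonempty b.IsBilimit ∧ Nonempty (b.pt ≅ X)
  tensor_mem {α β : G} {X Y : C} : 𝒞 α X → 𝒞 β Y → 𝒞 (α * β) (X ⊗ Y)
  hom_eq_zero {α β : G} {X Y : C} : 𝒞 α X → 𝒞 β Y → α ≠ β → ∀ f : X ⟶ Y, f = 0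
  unit_mem : 𝒞 1 (𝟙_ C)

/-- A pivotal `G`-graded category, where the dual of an object of degree `α` is always taken in
degree `α⁻¹`. -/
structure IsPivotalGGraded (P : PivotalStructure C) (𝒞 : G → ObjectProperty C) : Prop
    extends IsGGraded 𝒞 where
  dual_mem {α : G} {X : C} : 𝒞 α X → 𝒞 α⁻¹ (P.dual X)

/-- Multiplication by an endomorphism of the unit object. -/
def unitScalar {C : Type u} [Category.{v} C] [MonoidalCategory C]
    (f : 𝟙_ C ⟶ 𝟙_ C) (X : C) : X ⟶ X :=
  (λ_ X).inv ≫ f ▷ X ≫ (λ_ X).hom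

/-- Left and right multiplication by endomorphisms of the unit object agree. -/
def IsPure (C : Type u) [Category.{v} C] [MonoidalCategory C] : Prop :=
  ∀ (f : 𝟙_ C ⟶ 𝟙_ C) (X : C), unitScalar f X = (ρ_ X).inv ≫ X ◁ f ≫ (ρ_ X).hom

/-- `InvObj P 𝒞 α` is the class of objects of `𝒞 α` of invertible left dimension. -/
structure InvObj {C : Type u} [Category.{v} C] [MonoidalCategory C] (P : PivotalStructure C)
    {G : Type*} (𝒞 : G → ObjectProperty C) (α : G) where
  obj : C
  mem : 𝒞 α obj
  isIso_dim : IsIso (P.dimLeft obj)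

/-- Non-singularity of a pivotal `G`-graded category. -/
structure IsNonsingular {C : Type u} [Category.{v} C] [MonoidalCategory C]
    (P : PivotalStructure C) {G : Type*} (𝒞 : G → ObjectProperty C) : Prop where
  pure : IsPure C
  splitIdempotents : IsIdempotentComplete C
  nonempty_invObj (α : G) : Nonempty (InvObj P 𝒞 α)

end Graded

section Crossed

variable (k : Type*) [CommRing k] {G : Type*} [Group G]
  {C : Type u} [Category.{v} C] [Preadditive C] [Linear k C] [MonoidalCategory C]

/-- A crossing in a `G`-graded category: a strong monoidal functor `α ↦ φ α` from `G` (with opposite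
multiplication) to the `k`-linear strong monoidal auto-equivalences of `C`, mapping degree `β` to
degree `α⁻¹ β α`. The transports along `eqToHom` only identify `φ` at equal elements of `G`. -/
structure Crossing (𝒞 : G → ObjectProperty C) where
  φ : G → C ⥤ C
  monoidal (α : G) : (φ α).Monoidal
  additive (α : G) : (φ α).Additive
  linear (α : G) : (φ α).Linear k
  isEquivalence (α : G) : (φ α).IsEquivalence
  /-- `φ₂(α, β) : φ_α φ_β ≅ φ_{βα}` -/
  φ₂ (α β : G) : φ β ⋙ φ α ≅ φ (β * α)
  φ₀ : 𝟭 C ≅ φ 1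
  φ₂_monoidal (α β : G) : NatTrans.IsMonoidal (φ₂ α β).hom
  φ₀_monoidal : NatTrans.IsMonoidal φ₀.hom
  φ₂_assoc (α β γ : G) (X : C) :
    (φ α).map ((φ₂ β γ).hom.app X) ≫ (φ₂ α (γ * β)).hom.app X =
      (φ₂ α β).hom.app ((φ γ).obj X) ≫ (φ₂ (β * α) γ).hom.app X ≫
        eqToHom (by rw [mul_assoc])
  φ₂_unit_right (α : G) (X : C) :
    (φ α).map (φ₀.hom.app X) ≫ (φ₂ α 1).hom.app X = eqToHom (by simp)
  φ₂_unit_left (α : G) (X : C) :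
    φ₀.hom.app ((φ α).obj X) ≫ (φ₂ 1 α).hom.app X = eqToHom (by simp)
  map_mem (α : G) {β : G} {X : C} : 𝒞 β X → 𝒞 (α⁻¹ * β * α) ((φ α).obj X)

attribute [instance] Crossing.monoidal Crossing.additive Crossing.linear Crossing.isEquivalence

open Functor.LaxMonoidal

variable {k}

/-- A `G`-braiding for a crossing: isomorphisms `τ : X ⊗ Y ≅ Y ⊗ φ_{|Y|}(X)` for `Y` homogeneous. -/
structure GBraiding {𝒞 : G → ObjectProperty C} (K : Crossing k 𝒞) where
  τ (X : C) {β : G} (Y : C) (hY : 𝒞 β Y) : X ⊗ Y ≅ Y ⊗ (K.φ β).obj X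
  naturality_left {X X' : C} (f : X ⟶ X') {β : G} (Y : C) (hY : 𝒞 β Y) :
    f ▷ Y ≫ (τ X' Y hY).hom = (τ X Y hY).hom ≫ Y ◁ (K.φ β).map f
  naturality_right (X : C) {β : G} {Y Y' : C} (hY : 𝒞 β Y) (hY' : 𝒞 β Y') (f : Y ⟶ Y') :
    X ◁ f ≫ (τ X Y' hY').hom = (τ X Y hY).hom ≫ f ▷ (K.φ β).obj X
  tensor_right (X : C) {β γ : G} (Y Z : C) (hY : 𝒞 β Y) (hZ : 𝒞 γ Z)
      (hYZ : 𝒞 (β * γ) (Y ⊗ Z)) :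
    (α_ X Y Z).hom ≫ (τ X (Y ⊗ Z) hYZ).hom =
      (τ X Y hY).hom ▷ Z ≫ (α_ _ _ _).hom ≫ Y ◁ (τ ((K.φ β).obj X) Z hZ).hom ≫
        (α_ _ _ _).inv ≫ (Y ⊗ Z) ◁ (K.φ₂ γ β).hom.app X
  tensor_left (X Y : C) {γ : G} (Z : C) (hZ : 𝒞 γ Z) :
    (τ (X ⊗ Y) Z hZ).hom =
      (α_ _ _ _).hom ≫ X ◁ (τ Y Z hZ).hom ≫ (α_ _ _ _).inv ≫
        (τ X Z hZ).hom ▷ (K.φ γ).obj Y ≫ (α_ _ _ _).hom ≫ Z ◁ μ (K.φ γ) X Y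
  map_φ (α : G) (X : C) {β : G} (Y : C) (hY : 𝒞 β Y) :
    μ (K.φ α) X Y ≫ (K.φ α).map (τ X Y hY).hom =
      (τ ((K.φ α).obj X) ((K.φ α).obj Y) (K.map_mem α hY)).hom ≫
        (K.φ α).obj Y ◁ ((K.φ₂ (α⁻¹ * β * α) α).hom.app X ≫
          eqToHom (by simp [mul_assoc]) ≫ (K.φ₂ α β).inv.app X) ≫
        μ (K.φ α) Y ((K.φ β).obj X)

end Crossed

section RelativeCenter

variable {C : Type u} [Category.{v} C] [MonoidalCategory C]

/-- A (left) half braiding on `A` relative to the full subcategory of `C` on the class `D`. -/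
structure RelHalfBraiding (D : ObjectProperty C) (A : C) where
  β (U : C) (hU : D U) : A ⊗ U ≅ U ⊗ A
  monoidal (U U' : C) (hU : D U) (hU' : D U') (h : D (U ⊗ U')) :
    (β (U ⊗ U') h).hom =
      (α_ _ _ _).inv ≫ (β U hU).hom ▷ U' ≫ (α_ _ _ _).hom ≫ U ◁ (β U' hU').hom ≫ (α_ _ _ _).inv
  naturality {U U' : C} (hU : D U) (hU' : D U') (f : U ⟶ U') :
    A ◁ f ≫ (β U' hU').hom = (β U hU).hom ≫ f ▷ A

/-- Objects of the center of `C` relative to `D`. -/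
structure RelCenter (D : ObjectProperty C) where
  X : C
  hb : RelHalfBraiding D X

namespace RelCenter

variable {D : ObjectProperty C}

/-- Morphisms of the relative center are the morphisms of `C` commuting with half braidings. -/
@[ext]
structure Hom (A B : RelCenter D) where
  f : A.X ⟶ B.X
  comm (U : C) (hU : D U) : f ▷ U ≫ (B.hb.β U hU).hom = (A.hb.β U hU).hom ≫ U ◁ f

instance : Category (RelCenter D) where
  Hom A B := Hom A B
  id A := ⟨𝟙 A.X, fun U hU => by simp⟩
  comp f g := ⟨f.f ≫ g.f, fun U hU => by
    rw [comp_whiskerRight, Category.assoc, g.comm, ← Category.assoc, f.comm, Category.assoc,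
      MonoidalCategory.whiskerLeft_comp]⟩

@[ext]
theorem hom_ext {A B : RelCenter D} (f g : A ⟶ B) (h : f.f = g.f) : f = g := Hom.ext h

@[simp]
theorem id_f (A : RelCenter D) : Hom.f (𝟙 A) = 𝟙 A.X := rfl

@[simp]
theorem comp_f {A B E : RelCenter D} (f : A ⟶ B) (g : B ⟶ E) : Hom.f (f ≫ g) = f.f ≫ g.f := rfl

/-- An isomorphism of `C` commuting with half braidings is an isomorphism of the center. -/
def isoMk {A B : RelCenter D} (e : A.X ≅ B.X)
    (h : ∀ (U : C) (hU : D U), e.hom ▷ U ≫ (B.hb.β U hU).hom = (A.hb.β U hU).hom ≫ U ◁ e.hom) :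
    A ≅ B where
  hom := ⟨e.hom, h⟩
  inv := ⟨e.inv, fun U hU => by
    rw [← cancel_epi (e.hom ▷ U), ← Category.assoc, ← comp_whiskerRight, e.hom_inv_id,
      id_whiskerRight, Category.id_comp, ← Category.assoc, h, Category.assoc,
      ← MonoidalCategory.whiskerLeft_comp, e.hom_inv_id, MonoidalCategory.whiskerLeft_id,
      Category.comp_id]⟩
  hom_inv_id := Hom.ext e.hom_inv_id
  inv_hom_id := Hom.ext e.inv_hom_id

/-- The half braiding `(σ_A ⊗ B)(A ⊗ σ_B)` on `A ⊗ B`. -/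
def tensorHalfBraiding (A B : RelCenter D) : RelHalfBraiding D (A.X ⊗ B.X) where
  β U hU := α_ _ _ _ ≪≫ whiskerLeftIso A.X (B.hb.β U hU) ≪≫ (α_ _ _ _).symm ≪≫
    whiskerRightIso (A.hb.β U hU) B.X ≪≫ α_ _ _ _
  monoidal U U' hU hU' h := by
    simp only [Iso.trans_hom, whiskerLeftIso_hom, Iso.symm_hom, whiskerRightIso_hom]
    rw [RelHalfBraiding.monoidal _ U U' hU hU' h, RelHalfBraiding.monoidal _ U U' hU hU' h]
    calc
      _ = 𝟙 _ ⊗≫ A.X ◁ (B.hb.β U hU).hom ▷ U' ⊗≫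
            (_ ◁ (B.hb.β U' hU').hom ≫ (A.hb.β U hU).hom ▷ _) ⊗≫
            U ◁ (A.hb.β U' hU').hom ▷ B.X ⊗≫ 𝟙 _ := by monoidal
      _ = _ := by rw [whisker_exchange]; monoidal
  naturality {U U'} hU hU' f := by
    simp only [Iso.trans_hom, whiskerLeftIso_hom, Iso.symm_hom, whiskerRightIso_hom]
    calc
      _ = 𝟙 _ ⊗≫ (A.X ◁ (B.X ◁ f ≫ (B.hb.β U' hU').hom)) ⊗≫
            (A.hb.β U' hU').hom ▷ B.X ⊗≫ 𝟙 _ := by monoidal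
      _ = 𝟙 _ ⊗≫ A.X ◁ (B.hb.β U hU).hom ⊗≫
            (A.X ◁ f ≫ (A.hb.β U' hU').hom) ▷ B.X ⊗≫ 𝟙 _ := by
          rw [RelHalfBraiding.naturality _ hU hU']; monoidal
      _ = _ := by rw [RelHalfBraiding.naturality _ hU hU']; monoidal

/-- Tensor product of objects of the center. -/
def tensorObj' (A B : RelCenter D) : RelCenter D := ⟨A.X ⊗ B.X, tensorHalfBraiding A B⟩

/-- The unit object of the center. -/
def tensorUnit' : RelCenter D where
  X := 𝟙_ C
  hb :=
    { β := fun U _ => λ_ U ≪≫ (ρ_ U).symm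
      monoidal := fun U U' _ _ _ => by
        dsimp only [Iso.trans_hom, Iso.symm_hom]; monoidal
      naturality := fun _ _ f => by
        dsimp only [Iso.trans_hom, Iso.symm_hom]; monoidal }

theorem tensorObj'_σ_hom (A B : RelCenter D) (U : C) (hU : D U) :
    ((tensorObj' A B).hb.β U hU).hom =
      (α_ _ _ _).hom ≫ A.X ◁ (B.hb.β U hU).hom ≫ (α_ _ _ _).inv ≫ (A.hb.β U hU).hom ▷ B.X ≫
        (α_ _ _ _).hom := by
  simp [tensorObj', tensorHalfBraiding]

theorem tensorUnit'_σ_hom (U : C) (hU : D U) :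
    ((tensorUnit' : RelCenter D).hb.β U hU).hom = (λ_ U).hom ≫ (ρ_ U).inv := rfl

def whiskerLeft' (A : RelCenter D) {B B' : RelCenter D} (f : B ⟶ B') :
    tensorObj' A B ⟶ tensorObj' A B' :=
  ⟨A.X ◁ f.f, fun U hU => by
    rw [tensorObj'_σ_hom, tensorObj'_σ_hom]
    change (A.X ◁ f.f) ▷ U ≫ (α_ A.X B'.X U).hom ≫ A.X ◁ (B'.hb.β U hU).hom ≫ (α_ A.X U B'.X).inv ≫
      (A.hb.β U hU).hom ▷ B'.X ≫ (α_ U A.X B'.X).hom = _ ≫ U ◁ A.X ◁ f.f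
    calc
      _ = 𝟙 _ ⊗≫ A.X ◁ (f.f ▷ U ≫ (B'.hb.β U hU).hom) ⊗≫ (A.hb.β U hU).hom ▷ B'.X ⊗≫ 𝟙 _ := by
          monoidal
      _ = 𝟙 _ ⊗≫ A.X ◁ (B.hb.β U hU).hom ⊗≫
            ((A.X ⊗ U) ◁ f.f ≫ (A.hb.β U hU).hom ▷ B'.X) ⊗≫ 𝟙 _ := by
          rw [f.comm]; monoidal
      _ = _ := by rw [whisker_exchange]; monoidal⟩

def whiskerRight' {A A' : RelCenter D} (f : A ⟶ A') (B : RelCenter D) :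
    tensorObj' A B ⟶ tensorObj' A' B :=
  ⟨f.f ▷ B.X, fun U hU => by
    rw [tensorObj'_σ_hom, tensorObj'_σ_hom]
    change (f.f ▷ B.X) ▷ U ≫ (α_ A'.X B.X U).hom ≫ A'.X ◁ (B.hb.β U hU).hom ≫ (α_ A'.X U B.X).inv ≫
      (A'.hb.β U hU).hom ▷ B.X ≫ (α_ U A'.X B.X).hom = _ ≫ U ◁ f.f ▷ B.X
    calc
      _ = 𝟙 _ ⊗≫ (f.f ▷ (B.X ⊗ U) ≫ A'.X ◁ (B.hb.β U hU).hom) ⊗≫ (A'.hb.β U hU).hom ▷ B.X ⊗≫ 𝟙 _ := by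
          monoidal
      _ = 𝟙 _ ⊗≫ A.X ◁ (B.hb.β U hU).hom ⊗≫
            (f.f ▷ U ≫ (A'.hb.β U hU).hom) ▷ B.X ⊗≫ 𝟙 _ := by
          rw [← whisker_exchange]; monoidal
      _ = _ := by rw [f.comm]; monoidal⟩

def associator' (A B E : RelCenter D) :
    tensorObj' (tensorObj' A B) E ≅ tensorObj' A (tensorObj' B E) :=
  isoMk (α_ A.X B.X E.X) fun U hU => by
    simp only [tensorObj'_σ_hom]
    simp only [tensorObj']
    monoidal

def leftUnitor' (A : RelCenter D) : tensorObj' tensorUnit' A ≅ A :=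
  isoMk (λ_ A.X) fun U hU => by
    simp only [tensorObj'_σ_hom, tensorUnit'_σ_hom]
    simp only [tensorObj', tensorUnit']
    monoidal

def rightUnitor' (A : RelCenter D) : tensorObj' A tensorUnit' ≅ A :=
  isoMk (ρ_ A.X) fun U hU => by
    simp only [tensorObj'_σ_hom, tensorUnit'_σ_hom]
    simp only [tensorObj', tensorUnit']
    monoidal

def tensorHom' {A A' B B' : RelCenter D} (f : A ⟶ A') (g : B ⟶ B') :
    tensorObj' A B ⟶ tensorObj' A' B' :=
  ⟨f.f ⊗ₘ g.f, fun U hU => by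
    rw [MonoidalCategory.tensorHom_def]
    exact (whiskerRight' f B ≫ whiskerLeft' A' g).comm U hU⟩

instance : MonoidalCategoryStruct (RelCenter D) where
  tensorObj A B := tensorObj' A B
  tensorHom f g := tensorHom' f g
  whiskerLeft A _ _ f := whiskerLeft' A f
  whiskerRight f B := whiskerRight' f B
  tensorUnit := tensorUnit'
  associator := associator'
  leftUnitor := leftUnitor'
  rightUnitor := rightUnitor'

instance : MonoidalCategory (RelCenter D) where
  tensorHom_def f g := hom_ext _ _ (MonoidalCategory.tensorHom_def f.f g.f)
  id_tensorHom_id A B := hom_ext _ _ (id_tensorHom_id A.X B.X)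
  tensorHom_comp_tensorHom f₁ f₂ g₁ g₂ :=
    hom_ext _ _ (tensorHom_comp_tensorHom f₁.f f₂.f g₁.f g₂.f)
  whiskerLeft_id A B := hom_ext _ _ (MonoidalCategory.whiskerLeft_id A.X B.X)
  id_whiskerRight A B := hom_ext _ _ (id_whiskerRight A.X B.X)
  associator_naturality f g h := hom_ext _ _ (associator_naturality f.f g.f h.f)
  leftUnitor_naturality f := hom_ext _ _ (leftUnitor_naturality f.f)
  rightUnitor_naturality f := hom_ext _ _ (rightUnitor_naturality f.f)
  pentagon A B E F := hom_ext _ _ (pentagon A.X B.X E.X F.X)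
  triangle A B := hom_ext _ _ (triangle A.X B.X)

theorem tensor_X (A B : RelCenter D) : (A ⊗ B).X = A.X ⊗ B.X := rfl

theorem unit_X : (𝟙_ (RelCenter D)).X = 𝟙_ C := rfl

section Linear

variable [Preadditive C] [MonoidalPreadditive C]

instance (A B : RelCenter D) : Zero (A ⟶ B) := ⟨⟨0, fun U hU => by simp⟩⟩

instance (A B : RelCenter D) : Add (A ⟶ B) :=
  ⟨fun f g => ⟨f.f + g.f, fun U hU => by simp [f.comm, g.comm]⟩⟩

instance (A B : RelCenter D) : Neg (A ⟶ B) :=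
  ⟨fun f => ⟨-f.f, fun U hU => by
    have h := f.comm U hU
    rw [← add_right_inj (f.f ▷ U ≫ (B.hb.β U hU).hom), ← Preadditive.add_comp,
      ← MonoidalPreadditive.add_whiskerRight, h, ← Preadditive.comp_add,
      ← MonoidalPreadditive.whiskerLeft_add]
    simp⟩⟩

instance : Preadditive (RelCenter D) where
  homGroup A B :=
    { add_assoc := fun f g h => hom_ext _ _ (add_assoc f.f g.f h.f)
      zero_add := fun f => hom_ext _ _ (zero_add f.f)
      add_zero := fun f => hom_ext _ _ (add_zero f.f)
      neg_add_cancel := fun f => hom_ext _ _ (neg_add_cancel f.f)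
      add_comm := fun f g => hom_ext _ _ (add_comm f.f g.f)
      nsmul := nsmulRec
      zsmul := zsmulRec }
  add_comp _ _ _ f g h := hom_ext _ _ (Preadditive.add_comp _ _ _ f.f g.f h.f)
  comp_add _ _ _ f g h := hom_ext _ _ (Preadditive.comp_add _ _ _ f.f g.f h.f)

instance : MonoidalPreadditive (RelCenter D) where
  whiskerLeft_zero := hom_ext _ _ MonoidalPreadditive.whiskerLeft_zero
  zero_whiskerRight := hom_ext _ _ MonoidalPreadditive.zero_whiskerRight
  whiskerLeft_add f g := hom_ext _ _ (MonoidalPreadditive.whiskerLeft_add f.f g.f)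
  add_whiskerRight f g := hom_ext _ _ (MonoidalPreadditive.add_whiskerRight f.f g.f)

variable {k : Type*} [CommRing k] [Linear k C] [MonoidalLinear k C]

instance (A B : RelCenter D) : SMul k (A ⟶ B) :=
  ⟨fun r f => ⟨r • f.f, fun U hU => by simp [f.comm]⟩⟩

instance : Linear k (RelCenter D) where
  homModule _ _ :=
    { one_smul := fun f => hom_ext _ _ (one_smul k f.f)
      mul_smul := fun r s f => hom_ext _ _ (mul_smul r s f.f)
      smul_zero := fun r => hom_ext _ _ (smul_zero r)
      smul_add := fun r f g => hom_ext _ _ (smul_add r f.f g.f)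
      add_smul := fun r s f => hom_ext _ _ (add_smul r s f.f)
      zero_smul := fun f => hom_ext _ _ (zero_smul k f.f) }
  smul_comp _ _ _ r f g := hom_ext _ _ (Linear.smul_comp _ _ _ r f.f g.f)
  comp_smul _ _ _ f r g := hom_ext _ _ (Linear.comp_smul _ _ _ f.f r g.f)

instance : MonoidalLinear k (RelCenter D) where
  whiskerLeft_smul A _ _ r f := hom_ext _ _ (MonoidalLinear.whiskerLeft_smul A.X r f.f)
  smul_whiskerRight r _ _ f A := hom_ext _ _ (MonoidalLinear.smul_whiskerRight r f.f A.X)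

end Linear

end RelCenter

end RelativeCenter

section CenterPivotal

variable {C : Type u} [Category.{v} C] [MonoidalCategory C] {D : ObjectProperty C}

/-- A morphism of `C` between underlying objects is a morphism of the relative center. -/
def RelCenter.IsHom (A B : RelCenter D) (f : A.X ⟶ B.X) : Prop :=
  ∀ (U : C) (hU : D U), f ▷ U ≫ (B.hb.β U hU).hom = (A.hb.β U hU).hom ≫ U ◁ f

variable (D) in
/-- The pivotal structure of the center relative to `D` lifted from a pivotal structure of `C`:
`(A, σ)* = (A*, σ†)`, with the evaluations and coevaluations of `C`. -/
structure CenterPivotal (P : PivotalStructure C) where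
  /-- the half braiding `σ†` on `A*` -/
  dagger (A : RelCenter D) : RelHalfBraiding D (P.dual A.X)
  dagger_hom (A : RelCenter D) (U : C) (hU : D U) :
    ((dagger A).β U hU).hom =
      𝟙 (P.dual A.X ⊗ U) ⊗≫ (P.dual A.X ⊗ U) ◁ P.coev A.X ⊗≫
        P.dual A.X ◁ ((A.hb.β U hU).inv ▷ P.dual A.X) ⊗≫
        P.ev A.X ▷ (U ⊗ P.dual A.X) ⊗≫ 𝟙 (U ⊗ P.dual A.X)
  ev_isHom (A : RelCenter D) :
    RelCenter.IsHom ((⟨P.dual A.X, dagger A⟩ : RelCenter D) ⊗ A) (𝟙_ _) (P.ev A.X)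
  coev_isHom (A : RelCenter D) :
    RelCenter.IsHom (𝟙_ _) (A ⊗ (⟨P.dual A.X, dagger A⟩ : RelCenter D)) (P.coev A.X)
  ev'_isHom (A : RelCenter D) :
    RelCenter.IsHom (A ⊗ (⟨P.dual A.X, dagger A⟩ : RelCenter D)) (𝟙_ _) (P.ev' A.X)
  coev'_isHom (A : RelCenter D) :
    RelCenter.IsHom (𝟙_ _) ((⟨P.dual A.X, dagger A⟩ : RelCenter D) ⊗ A) (P.coev' A.X)

/-- The lifted structure as a pivotal structure on the relative center. -/
def CenterPivotal.pivotal {P : PivotalStructure C} (L : CenterPivotal D P) :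
    PivotalStructure (RelCenter D) where
  dual A := ⟨P.dual A.X, L.dagger A⟩
  left A :=
    { coevaluation' := ⟨P.coev A.X, L.coev_isHom A⟩
      evaluation' := ⟨P.ev A.X, L.ev_isHom A⟩
      coevaluation_evaluation' := RelCenter.hom_ext _ _ (P.left A.X).coevaluation_evaluation'
      evaluation_coevaluation' := RelCenter.hom_ext _ _ (P.left A.X).evaluation_coevaluation' }
  right A :=
    { coevaluation' := ⟨P.coev' A.X, L.coev'_isHom A⟩
      evaluation' := ⟨P.ev' A.X, L.ev'_isHom A⟩
      coevaluation_evaluation' := RelCenter.hom_ext _ _ (P.right A.X).coevaluation_evaluation'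
      evaluation_coevaluation' := RelCenter.hom_ext _ _ (P.right A.X).evaluation_coevaluation' }
  dual_map f := RelCenter.hom_ext _ _ (P.dual_map f.f)
  dual_unit := RelCenter.hom_ext _ _ P.dual_unit
  dual_tensor A B := RelCenter.hom_ext _ _ (P.dual_tensor A.X B.X)

end CenterPivotal

section GCenter

variable {G : Type w} [Group G] {C : Type u} [Category.{v} C] [MonoidalCategory C]

/-- The `G`-center of a `G`-graded category: the center relative to the neutral component. -/
abbrev GCenter (𝒞 : G → ObjectProperty C) : Type (max u v) := RelCenter (𝒞 1)

/-- The grading of the `G`-center by the degree of the underlying object. -/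
def GCenter.grading (𝒞 : G → ObjectProperty C) : G → ObjectProperty (GCenter 𝒞) :=
  fun α A => 𝒞 α A.X

variable {P : PivotalStructure C} {𝒞 : G → ObjectProperty C}

/-- The inverse of the left dimension. -/
noncomputable def InvObj.dimInv {α : G} (V : InvObj P 𝒞 α) : 𝟙_ C ⟶ 𝟙_ C :=
  haveI := V.isIso_dim
  inv (P.dimLeft V.obj)

variable (P) in
/-- `V* ⊗ A ⊗ V` -/
abbrev PivotalStructure.conj (V A : C) : C := (P.dual V ⊗ A) ⊗ V

variable (P) in
/-- `A ⊗ Y ⟶ A ⊗ Y ⊗ W* ⊗ W ⟶ Y ⊗ W* ⊗ A ⊗ W`: create `W* ⊗ W`, then move `A` across `Y ⊗ W*` by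
its half braiding. -/
def crossOver (A : GCenter 𝒞) (Y W : C) (h : 𝒞 1 (Y ⊗ P.dual W)) :
    A.X ⊗ Y ⟶ Y ⊗ P.conj W A.X :=
  𝟙 (A.X ⊗ Y) ⊗≫ (A.X ⊗ Y) ◁ P.coev' W ⊗≫ (A.hb.β (Y ⊗ P.dual W) h).hom ▷ W ⊗≫
    𝟙 (Y ⊗ P.conj W A.X)

variable [Preadditive C]

theorem IsPivotalGGraded.mem_one (h : IsPivotalGGraded P 𝒞) {α : G} {Y W : C}
    (hY : 𝒞 α Y) (hW : 𝒞 α W) : 𝒞 1 (Y ⊗ P.dual W) := by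
  have := h.tensor_mem hY (h.dual_mem hW)
  rwa [mul_inv_cancel] at this

theorem IsPivotalGGraded.mem_mul_one (h : IsPivotalGGraded P 𝒞) {α : G} {Y X : C}
    (hY : 𝒞 α Y) (hX : 𝒞 1 X) : 𝒞 α (Y ⊗ X) := by
  have := h.tensor_mem hY hX
  rwa [mul_one] at this

theorem IsPivotalGGraded.dual_mem_one (h : IsPivotalGGraded P 𝒞) {W : C}
    (hW : 𝒞 1 W) : 𝒞 1 (P.dual W) := by
  have := h.dual_mem hW
  rwa [inv_one] at this

variable (h : IsPivotalGGraded P 𝒞)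

/-- The idempotent `π^V_{(A,σ)}` of `V* ⊗ A ⊗ V`. -/
noncomputable def idem {α : G} (V : InvObj P 𝒞 α) (A : GCenter 𝒞) :
    P.conj V.obj A.X ⟶ P.conj V.obj A.X :=
  unitScalar V.dimInv _ ≫
    (𝟙 (P.conj V.obj A.X) ⊗≫ P.dual V.obj ◁ crossOver P A V.obj V.obj (h.mem_one V.mem V.mem) ⊗≫
      P.ev V.obj ▷ P.conj V.obj A.X ⊗≫ 𝟙 (P.conj V.obj A.X))

open Functor.LaxMonoidal

/-- A choice, for every object `(A,σ)` of the `G`-center, of a splitting triple `(E, p, q)` of the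
idempotent `π^V_{(A,σ)}`, with `E` of degree `α⁻¹ β α` if `A` has degree `β`. -/
structure SplittingChoice {α : G} (V : InvObj P 𝒞 α) where
  E (A : GCenter 𝒞) : C
  p (A : GCenter 𝒞) : P.conj V.obj A.X ⟶ E A
  q (A : GCenter 𝒞) : E A ⟶ P.conj V.obj A.X
  p_q (A : GCenter 𝒞) : p A ≫ q A = idem h V A
  q_p (A : GCenter 𝒞) : q A ≫ p A = 𝟙 (E A)
  mem {β : G} {A : GCenter 𝒞} : 𝒞 β A.X → 𝒞 (α⁻¹ * β * α) (E A)

/-- The monoidal endofunctor `φ_V` of the `G`-center determined by splittings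
`p : V* ⊗ A ⊗ V ⟶ E`, `q : E ⟶ V* ⊗ A ⊗ V` of the idempotents `π^V_{(A,σ)}`, where
`E` is the underlying object of `φ_V(A,σ)`. -/
structure SplittingFunctor {α : G} (V : InvObj P 𝒞 α) where
  functor : GCenter 𝒞 ⥤ GCenter 𝒞
  monoidal : functor.Monoidal
  p (A : GCenter 𝒞) : P.conj V.obj A.X ⟶ (functor.obj A).X
  q (A : GCenter 𝒞) : (functor.obj A).X ⟶ P.conj V.obj A.X
  p_q (A : GCenter 𝒞) : p A ≫ q A = idem h V A
  q_p (A : GCenter 𝒞) : q A ≫ p A = 𝟙 (functor.obj A).X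
  /-- the half braiding `γ^V` of `φ_V(A,σ)` -/
  halfBraiding (A : GCenter 𝒞) (X : C) (hX : 𝒞 1 X) :
    ((functor.obj A).hb.β X hX).hom =
      unitScalar V.dimInv _ ≫
        (𝟙 ((functor.obj A).X ⊗ X) ⊗≫ q A ▷ X ⊗≫
          P.dual V.obj ◁ crossOver P A (V.obj ⊗ X) V.obj
            (h.mem_one (h.mem_mul_one V.mem hX) V.mem) ⊗≫
          P.ev V.obj ▷ (X ⊗ P.conj V.obj A.X) ⊗≫ X ◁ p A)
  map {A B : GCenter 𝒞} (f : A ⟶ B) :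
    (functor.map f).f = q A ≫ (P.dual V.obj ◁ f.f) ▷ V.obj ≫ p B
  tensor (A B : GCenter 𝒞) :
    (μ functor A B).f =
      (q A ⊗ₘ q B) ⊗≫ (P.dual V.obj ⊗ A.X) ◁ (P.ev' V.obj ▷ (B.X ⊗ V.obj)) ⊗≫
        𝟙 (P.conj V.obj (A.X ⊗ B.X)) ≫ p (A ⊗ B)
  unit : (ε functor).f = P.coev' V.obj ⊗≫ 𝟙 (P.conj V.obj (𝟙_ C)) ≫ p (𝟙_ (GCenter 𝒞))
  mem {β : G} {A : GCenter 𝒞} : GCenter.grading 𝒞 β A →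
    GCenter.grading 𝒞 (α⁻¹ * β * α) (functor.obj A)

attribute [instance] SplittingFunctor.monoidal

/-- The splitting triples underlying `φ_V`. -/
def SplittingFunctor.choice {h : IsPivotalGGraded P 𝒞} {α : G} {V : InvObj P 𝒞 α}
    (F : SplittingFunctor h V) : SplittingChoice h V where
  E A := (F.functor.obj A).X
  p := F.p
  q := F.q
  p_q := F.p_q
  q_p := F.q_p
  mem hA := F.mem hA

variable {h}

/-- `ζ^{U,V,W}_{(A,σ)} : φ_U φ_V (A,σ) ⟶ φ_W (A,σ)` -/
noncomputable def zetaMor {α β : G} {U : InvObj P 𝒞 α} {V : InvObj P 𝒞 β} {W : InvObj P 𝒞 (β * α)}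
    (ΦU : SplittingFunctor h U) (ΦV : SplittingFunctor h V) (ΦW : SplittingFunctor h W)
    (A : GCenter 𝒞) :
    (ΦU.functor.obj (ΦV.functor.obj A)).X ⟶ (ΦW.functor.obj A).X :=
  unitScalar (U.dimInv ≫ V.dimInv) _ ≫ ΦU.q (ΦV.functor.obj A) ≫
    (P.dual U.obj ◁ ΦV.q A) ▷ U.obj ⊗≫
    P.dual U.obj ◁ P.dual V.obj ◁ crossOver P A (V.obj ⊗ U.obj) W.obj
      (h.mem_one (h.tensor_mem V.mem U.mem) W.mem) ⊗≫
    P.dual U.obj ◁ P.ev V.obj ▷ (U.obj ⊗ P.conj W.obj A.X) ⊗≫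
    P.ev U.obj ▷ P.conj W.obj A.X ⊗≫ ΦW.p A

/-- `η^U_{(A,σ)} : (A,σ) ⟶ φ_U (A,σ)` for `U` of degree `1` -/
def etaMor {U : InvObj P 𝒞 1} (ΦU : SplittingFunctor h U) (A : GCenter 𝒞) :
    A.X ⟶ (ΦU.functor.obj A).X :=
  𝟙 A.X ⊗≫ A.X ◁ P.coev' U.obj ⊗≫
    (A.hb.β (P.dual U.obj) (h.dual_mem_one U.mem)).hom ▷ U.obj ⊗≫ ΦU.p A

/-- `δ^{U,V}_{(A,σ)} : φ_V (A,σ) ⟶ φ_U (A,σ)` -/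
noncomputable def deltaMor {α : G} {U V : InvObj P 𝒞 α}
    (ΦU : SplittingFunctor h U) (ΦV : SplittingFunctor h V) (A : GCenter 𝒞) :
    (ΦV.functor.obj A).X ⟶ (ΦU.functor.obj A).X :=
  unitScalar V.dimInv _ ≫ ΦV.q A ⊗≫
    P.dual V.obj ◁ crossOver P A V.obj U.obj (h.mem_one V.mem U.mem) ⊗≫
    P.ev V.obj ▷ P.conj U.obj A.X ⊗≫ ΦU.p A

/-- `Γ^V_{(A,σ),X} : A ⊗ X ⟶ X ⊗ E` for `X` and `V` of the same degree, where `E` is the underlying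
object of `φ_V (A,σ)` -/
def gammaMor {α : G} {V : InvObj P 𝒞 α} (ΦV : SplittingFunctor h V) (A : GCenter 𝒞)
    (X : C) (hX : 𝒞 α X) : A.X ⊗ X ⟶ X ⊗ (ΦV.functor.obj A).X :=
  crossOver P A X V.obj (h.mem_one hX V.mem) ≫ X ◁ ΦV.p A

variable (h)

/-- The functors `φ_V` for all homogeneous objects `V` of invertible left dimension. -/
abbrev SplittingSystem := ∀ (α : G) (V : InvObj P 𝒞 α), SplittingFunctor h V

variable {h} [MonoidalPreadditive C] (k : Type*) [CommRing k] [Linear k C] [MonoidalLinear k C]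

/-- The `G`-braided structure of the `G`-center obtained from a choice `Φ` of the functors `φ_V`:
`φ_α` is the projective limit, with universal cone `ι α`, of the monoidal functors `φ_V`
(`V` of degree `α` and of invertible left dimension) along the `δ^{U,V}`, and `φ₂`, `φ₀` and `τ` are
induced by `ζ`, `η` and `Γ`. -/
structure CanonicalGBraiding (Φ : SplittingSystem h) where
  crossing : Crossing k (GCenter.grading 𝒞)
  braiding : GBraiding crossing
  ι (α : G) (V : InvObj P 𝒞 α) : crossing.φ α ≅ (Φ α V).functor
  ι_monoidal (α : G) (V : InvObj P 𝒞 α) : NatTrans.IsMonoidal (ι α V).hom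
  ι_delta (α : G) (U V : InvObj P 𝒞 α) (A : GCenter 𝒞) :
    ((ι α V).hom.app A).f ≫ deltaMor (Φ α U) (Φ α V) A = ((ι α U).hom.app A).f
  isLimit (α : G) (F : GCenter 𝒞 ⥤ GCenter 𝒞) [F.Monoidal]
    (κ : ∀ V : InvObj P 𝒞 α, F ⟶ (Φ α V).functor) :
    (∀ V, NatTrans.IsMonoidal (κ V)) →
    (∀ (U V : InvObj P 𝒞 α) (A : GCenter 𝒞),
      ((κ V).app A).f ≫ deltaMor (Φ α U) (Φ α V) A = ((κ U).app A).f) →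
    ∃! u : F ⟶ crossing.φ α, NatTrans.IsMonoidal u ∧ ∀ V, u ≫ (ι α V).hom = κ V
  φ₂_zeta (α β : G) (U : InvObj P 𝒞 α) (V : InvObj P 𝒞 β) (W : InvObj P 𝒞 (β * α))
      (A : GCenter 𝒞) :
    ((crossing.φ₂ α β).hom.app A).f ≫ ((ι (β * α) W).hom.app A).f =
      ((ι α U).hom.app ((crossing.φ β).obj A)).f ≫
        ((Φ α U).functor.map ((ι β V).hom.app A)).f ≫ zetaMor (Φ α U) (Φ β V) (Φ (β * α) W) A
  φ₀_eta (U : InvObj P 𝒞 1) (A : GCenter 𝒞) :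
    (crossing.φ₀.hom.app A).f ≫ ((ι 1 U).hom.app A).f = etaMor (Φ 1 U) A
  τ_gamma (A : GCenter 𝒞) {β : G} (B : GCenter 𝒞) (hB : GCenter.grading 𝒞 β B)
      (V : InvObj P 𝒞 β) :
    (braiding.τ A B hB).hom.f ≫ B.X ◁ ((ι β V).hom.app A).f = gammaMor (Φ β V) A B.X hB

end GCenter

section Comparison

variable {k : Type*} [CommRing k] {G : Type*} [Group G]
  {C : Type u} [Category.{v} C] [Preadditive C] [Linear k C] [MonoidalCategory C]

/-- A family of natural isomorphisms `φ_α ≅ φ'_α` is an isomorphism between two `G`-braided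
structures on the same `G`-graded category. -/
structure IsGBraidedIso {𝒞 : G → ObjectProperty C} {K K' : Crossing k 𝒞} (T : GBraiding K)
    (T' : GBraiding K') (θ : ∀ α, K.φ α ≅ K'.φ α) : Prop where
  monoidal (α : G) : NatTrans.IsMonoidal (θ α).hom
  φ₂ (α β : G) (X : C) :
    (K.φ₂ α β).hom.app X ≫ (θ (β * α)).hom.app X =
      (θ α).hom.app ((K.φ β).obj X) ≫ (K'.φ α).map ((θ β).hom.app X) ≫ (K'.φ₂ α β).hom.app X
  φ₀ (X : C) : K.φ₀.hom.app X ≫ (θ 1).hom.app X = K'.φ₀.hom.app X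
  τ (X : C) {β : G} (Y : C) (hY : 𝒞 β Y) :
    (T.τ X Y hY).hom ≫ Y ◁ (θ β).hom.app X = (T'.τ X Y hY).hom

end Comparison

/-! The mechanism is descent along tensoring with objects of invertible dimension. If $d_V$ is
invertible, closing the strand $V$ by a normalized partial trace is a left inverse of $f\mapsto
\mathrm{id}_V\otimes f$. So $V\otimes -$ is faithful and reflects isomorphisms. Moreover, a family
$X\otimes M\to X\otimes N$ that is natural in $X\in\mathcal C_\alpha$ and compatible with tensoring
on the left by $\mathcal C_1$ is $\mathrm{id}_X\otimes g$ for a unique $g\colon M\to N$, namely the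
partial trace of its value at $V$ (`ModuleTransformation.whiskerLeft_ptr`).

A `Transfer` of degree $\alpha$ from $A$ to $B$ is a family $A\otimes X\cong X\otimes B$,
$X\in\mathcal C_\alpha$, compatible with the half braidings. Descent shows that its target is unique
up to unique isomorphism: a morphism $A\to A'$ induces exactly one morphism between the targets
compatible with the transfers (`Transfer.exists_intertwines`, `Transfer.Intertwines.ext`), and it
automatically commutes with the half braidings. Transfers exist because after tensoring with $X$ the
idempotent $\pi^V_A$ factors through $A\otimes X$ (`whiskerLeft_idem`); hence a splitting $E$
satisfies $A\otimes X\cong X\otimes E$, and this isomorphism is $\Gamma^V$. The half braiding,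
functoriality and monoidal constraints of $\varphi_V$ are all forced by $\Gamma^V$, and the explicit
formulas are verified by showing that they have the defining property.

A transfer of degree $\beta$ followed by one of degree $\alpha$ is defined on products $X\otimes Y$;
descending in $X$ and then in $Y$ compares it with any transfer of degree $\beta\alpha$
(`Transfer.exists_composes`). This gives $\varphi_2$, with $\varphi_0$ coming from the half braiding
viewed as a transfer of degree $1$, and $\tau$ is the transfer itself. Coherence laws hold because
both sides are determined by the same transfers. The morphisms $\delta,\eta,\zeta$ are the induced
comparisons (`deltaMor_intertwines`, `etaMor_intertwines`, `zetaMor_composes`), so all $\delta$ are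
invertible and the limit over $V$ is any single $\varphi_V$. The same uniqueness compares two
choices of splittings.

Duality rests on the agreement of left and right rotations by half a turn
(`PivotalStructure.exists_rotation`). If $a\colon A\otimes X\cong X\otimes E$ has a reverse
$E\otimes X^*\cong X^*\otimes A$, its left and right mates are mutually inverse. For half braidings
this makes $\sigma^\dagger$ invertible; for transfers it makes $\varphi_\alpha$ pivotal. -/

/-! ### Scalars, normalized partial traces and descent -/

section Scalars

variable {C : Type u} [Category.{v} C] [MonoidalCategory C]

theorem unitScalar_naturality (f : 𝟙_ C ⟶ 𝟙_ C) {X Y : C} (g : X ⟶ Y) :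
    unitScalar f X ≫ g = g ≫ unitScalar f Y := by
  simp only [unitScalar, Category.assoc, ← leftUnitor_naturality, leftUnitor_inv_naturality_assoc]
  rw [← whisker_exchange_assoc]

theorem unitScalar_naturality_assoc (f : 𝟙_ C ⟶ 𝟙_ C) {X Y Z : C} (g : X ⟶ Y) (g' : Y ⟶ Z) :
    unitScalar f X ≫ g ≫ g' = g ≫ unitScalar f Y ≫ g' := by
  rw [← Category.assoc, unitScalar_naturality, Category.assoc]

theorem unitScalar_whiskerRight (f : 𝟙_ C ⟶ 𝟙_ C) (X Y : C) :
    unitScalar f X ▷ Y = unitScalar f (X ⊗ Y) := by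
  simp only [unitScalar]; monoidal

/-- Purity moves a scalar across the left factor, so normalizing factors such as $d_V^{-1}$ can be
pulled out of a left whiskering. -/
theorem IsPure.whiskerLeft_unitScalar (hp : IsPure C) (f : 𝟙_ C ⟶ 𝟙_ C) (X Y : C) :
    X ◁ unitScalar f Y = unitScalar f (X ⊗ Y) := by
  calc
    _ = 𝟙 _ ⊗≫ (((ρ_ X).inv ≫ X ◁ f ≫ (ρ_ X).hom) ▷ Y) ⊗≫ 𝟙 _ := by
      simp only [unitScalar]; monoidal
    _ = _ := by rw [← hp, unitScalar_whiskerRight]; monoidal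

theorem unitScalar_comp (f g : 𝟙_ C ⟶ 𝟙_ C) (X : C) :
    unitScalar (f ≫ g) X = unitScalar f X ≫ unitScalar g X := by
  simp [unitScalar]

theorem unitScalar_id (X : C) : unitScalar (𝟙 (𝟙_ C)) X = 𝟙 X := by
  simp [unitScalar]

variable {P : PivotalStructure C} {G : Type w} {𝒞 : G → ObjectProperty C} {α : G}

theorem InvObj.unitScalar_dimInv_dim (V : InvObj P 𝒞 α) (X : C) :
    unitScalar V.dimInv X ≫ unitScalar (P.dimLeft V.obj) X = 𝟙 X := by
  have := V.isIso_dim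
  rw [← unitScalar_comp, InvObj.dimInv, IsIso.inv_hom_id, unitScalar_id]

/-- The normalized left partial trace over an object of invertible dimension. -/
noncomputable def InvObj.ptr (V : InvObj P 𝒞 α) {M N : C} (g : V.obj ⊗ M ⟶ V.obj ⊗ N) : M ⟶ N :=
  unitScalar V.dimInv M ≫ (𝟙 M ⊗≫ P.coev' V.obj ▷ M ⊗≫ P.dual V.obj ◁ g ⊗≫
    P.ev V.obj ▷ N ⊗≫ 𝟙 N)

theorem InvObj.ptr_id (V : InvObj P 𝒞 α) (M : C) : V.ptr (𝟙 (V.obj ⊗ M)) = 𝟙 M := by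
  refine Eq.trans ?_ (V.unitScalar_dimInv_dim M)
  rw [InvObj.ptr]
  congr 1
  simp only [unitScalar, PivotalStructure.dimLeft]
  monoidal

theorem InvObj.ptr_whiskerLeft_comp (V : InvObj P 𝒞 α) {M M' N : C} (f : M ⟶ M')
    (g : V.obj ⊗ M' ⟶ V.obj ⊗ N) : V.ptr (V.obj ◁ f ≫ g) = f ≫ V.ptr g := by
  unfold InvObj.ptr
  rw [← Category.assoc f, ← unitScalar_naturality, Category.assoc]
  congr 1
  calc
    _ = 𝟙 _ ⊗≫ (P.coev' V.obj ▷ M ≫ (P.dual V.obj ⊗ V.obj) ◁ f) ⊗≫ P.dual V.obj ◁ g ⊗≫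
          P.ev V.obj ▷ N ⊗≫ 𝟙 N := by monoidal
    _ = _ := by rw [← whisker_exchange]; monoidal

theorem InvObj.ptr_comp_whiskerLeft (V : InvObj P 𝒞 α) {M N N' : C}
    (g : V.obj ⊗ M ⟶ V.obj ⊗ N) (f : N ⟶ N') : V.ptr (g ≫ V.obj ◁ f) = V.ptr g ≫ f := by
  unfold InvObj.ptr
  rw [Category.assoc]
  congr 1
  calc
    _ = 𝟙 _ ⊗≫ P.coev' V.obj ▷ M ⊗≫ P.dual V.obj ◁ g ⊗≫
          ((P.dual V.obj ⊗ V.obj) ◁ f ≫ P.ev V.obj ▷ N') ⊗≫ 𝟙 N' := by monoidal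
    _ = _ := by rw [whisker_exchange]; monoidal

/-- The closed strand $V$ contributes $d_V$, which the normalization cancels. This is where
invertibility of the dimension is used. -/
theorem InvObj.ptr_whiskerLeft (V : InvObj P 𝒞 α) {M N : C} (f : M ⟶ N) :
    V.ptr (V.obj ◁ f) = f := by
  simpa [V.ptr_id] using V.ptr_whiskerLeft_comp f (𝟙 _)

theorem InvObj.whiskerLeft_injective (V : InvObj P 𝒞 α) {M N : C} {f g : M ⟶ N}
    (h : V.obj ◁ f = V.obj ◁ g) : f = g := by
  rw [← V.ptr_whiskerLeft f, h, V.ptr_whiskerLeft]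

/-- The inverse is the partial trace of the inverse of $\mathrm{id}_V\otimes f$; bilinearity of the
trace over morphisms $\mathrm{id}_V\otimes f$ gives both identities. -/
theorem InvObj.isIso_of_whiskerLeft (V : InvObj P 𝒞 α) {M N : C} (f : M ⟶ N)
    (h : IsIso (V.obj ◁ f)) : IsIso f :=
  ⟨V.ptr (inv (V.obj ◁ f)), by
    rw [← V.ptr_whiskerLeft_comp, IsIso.hom_inv_id, V.ptr_id], by
    rw [← V.ptr_comp_whiskerLeft, IsIso.inv_hom_id, V.ptr_id]⟩

theorem IsNonsingular.whiskerLeft_ext (hns : IsNonsingular P 𝒞) (α : G) {M N : C}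
    {f g : M ⟶ N} (H : ∀ X, 𝒞 α X → X ◁ f = X ◁ g) : f = g := by
  obtain ⟨V⟩ := hns.nonempty_invObj α
  exact V.whiskerLeft_injective (H _ V.mem)

/-- Composites of transfers are only defined on products $X\otimes Y$, so identities between them
are tested there. -/
theorem IsNonsingular.whiskerLeft_tensor_ext (hns : IsNonsingular P 𝒞) (β α : G) {M N : C}
    {f g : M ⟶ N} (H : ∀ X Y, 𝒞 β X → 𝒞 α Y → (X ⊗ Y) ◁ f = (X ⊗ Y) ◁ g) : f = g :=
  hns.whiskerLeft_ext α fun Y hY => hns.whiskerLeft_ext β fun X hX => by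
    have := H X Y hX hY
    rw [tensor_whiskerLeft, tensor_whiskerLeft] at this
    simpa using this

variable [Group G] [Preadditive C]

/-- Families of morphisms `X ⊗ M ⟶ X ⊗ N`, for `X` of degree `α`, which are natural in `X` and
compatible with tensoring by objects of degree `1` on the left. -/
structure ModuleTransformation (𝒞 : G → ObjectProperty C) (α : G) (M N : C) where
  app (X : C) (hX : 𝒞 α X) : X ⊗ M ⟶ X ⊗ N
  naturality {X Y : C} (hX : 𝒞 α X) (hY : 𝒞 α Y) (f : X ⟶ Y) :
    f ▷ M ≫ app Y hY = app X hX ≫ f ▷ N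
  tensor (Y X : C) (hY : 𝒞 1 Y) (hX : 𝒞 α X) (hYX : 𝒞 α (Y ⊗ X)) :
    app (Y ⊗ X) hYX = (α_ _ _ _).hom ≫ Y ◁ app X hX ≫ (α_ _ _ _).inv

theorem IsPivotalGGraded.one_mul_mem (h : IsPivotalGGraded P 𝒞) {X Y : C}
    (hY : 𝒞 1 Y) (hX : 𝒞 α X) : 𝒞 α (Y ⊗ X) := by
  simpa using h.tensor_mem hY hX

/-- A module transformation is induced by a morphism `M ⟶ N`. -/
theorem ModuleTransformation.whiskerLeft_ptr (h : IsPivotalGGraded P 𝒞) (hp : IsPure C)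
    {M N : C} (t : ModuleTransformation 𝒞 α M N) (V : InvObj P 𝒞 α) (X : C) (hX : 𝒞 α X) :
    X ◁ V.ptr (t.app V.obj V.mem) = t.app X hX := by
  -- Since $X\otimes V^*$ has degree $1$, the value of $t$ at $(X\otimes V^*)\otimes V$ is
  -- determined by its value at $V$. Naturality along $\mathrm{id}_X\otimes\mathrm{ev}_V$ compares
  -- it with the value at $X$, and the loop that remains is $d_V$.
  have hXV := h.mem_one hX V.mem
  have hXVV := h.one_mul_mem hXV V.mem
  have e1 := t.tensor _ _ hXV V.mem hXVV
  have e2 := t.naturality hXVV hX (𝟙 _ ⊗≫ X ◁ P.ev V.obj ⊗≫ 𝟙 _)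
  rw [InvObj.ptr, MonoidalCategory.whiskerLeft_comp, hp.whiskerLeft_unitScalar]
  calc
    _ = unitScalar V.dimInv (X ⊗ M) ≫ (𝟙 _ ⊗≫ X ◁ P.coev' V.obj ▷ M ⊗≫
          (((α_ _ _ _).hom ≫ (X ⊗ P.dual V.obj) ◁ t.app V.obj V.mem ≫ (α_ _ _ _).inv) ≫
          (𝟙 _ ⊗≫ X ◁ P.ev V.obj ⊗≫ 𝟙 _) ▷ N)) := by
      congr 1; monoidal
    _ = unitScalar V.dimInv (X ⊗ M) ≫ (X ◁ (unitScalar (P.dimLeft V.obj) M) ≫ t.app X hX) := by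
      rw [← e1, ← e2]
      congr 1
      simp only [unitScalar, PivotalStructure.dimLeft]
      monoidal
    _ = _ := by
      rw [hp.whiskerLeft_unitScalar, ← Category.assoc, V.unitScalar_dimInv_dim, Category.id_comp]

end Scalars

/-! ### Half braidings at the unit object -/

section HalfBraiding

variable {C : Type u} [Category.{v} C] [MonoidalCategory C] {D : ObjectProperty C}

/-- Up to unitors $\sigma_1$ is idempotent, by multiplicativity and naturality along $1\otimes
1\cong 1$; an invertible idempotent is the identity. -/
theorem RelHalfBraiding.unit {A : C} (s : RelHalfBraiding D A) (h₁ : D (𝟙_ C)) (h₂ : D (𝟙_ C ⊗ 𝟙_ C)) :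
    (s.β (𝟙_ C) h₁).hom = (ρ_ A).hom ≫ (λ_ A).inv := by
  have e1 := s.monoidal _ _ h₁ h₁ h₂
  have e2 := s.naturality h₂ h₁ (λ_ (𝟙_ C)).hom
  rw [e1] at e2
  have e3 : (s.β (𝟙_ C) h₁).hom ▷ 𝟙_ C ≫ (α_ _ _ _).hom ≫ 𝟙_ C ◁ (s.β (𝟙_ C) h₁).hom =
      (s.β (𝟙_ C) h₁).hom ▷ 𝟙_ C ≫ 𝟙 _ ⊗≫ 𝟙 _ := by
    rw [← cancel_epi (α_ A (𝟙_ C) (𝟙_ C)).inv]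
    rw [← cancel_mono (α_ (𝟙_ C) (𝟙_ C) A).inv, ← cancel_mono ((λ_ (𝟙_ C)).hom ▷ A)]
    simp only [Category.assoc] at e2 ⊢
    rw [← e2]
    monoidal
  rw [cancel_epi, ← cancel_epi (α_ _ _ _).inv] at e3
  have e4 : (s.β (𝟙_ C) h₁).hom = (λ_ _).inv ≫ (𝟙_ C ◁ (s.β (𝟙_ C) h₁).hom) ≫ (λ_ _).hom := by
    simp
  rw [Iso.inv_hom_id_assoc] at e3
  rw [e4, e3]
  monoidal

end HalfBraiding

/-! ### The graphical calculus of `crossOver` and `crossBack` -/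

section CrossOver

variable {G : Type w} [Group G] {C : Type u} [Category.{v} C] [MonoidalCategory C]
  {P : PivotalStructure C} {𝒞 : G → ObjectProperty C}

variable (P) in
/-- `Y ⊗ W* ⊗ A ⊗ W ⟶ A ⊗ Y ⊗ W* ⊗ W ⟶ A ⊗ Y`: move `A` back across `Y ⊗ W*`, then evaluate. -/
def crossBack (A : GCenter 𝒞) (Y W : C) (h : 𝒞 1 (Y ⊗ P.dual W)) :
    Y ⊗ P.conj W A.X ⟶ A.X ⊗ Y :=
  𝟙 (Y ⊗ P.conj W A.X) ⊗≫ (A.hb.β (Y ⊗ P.dual W) h).inv ▷ W ⊗≫ (A.X ⊗ Y) ◁ P.ev W ⊗≫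
    𝟙 (A.X ⊗ Y)

theorem crossOver_eq (A : GCenter 𝒞) (Y W : C) (h : 𝒞 1 (Y ⊗ P.dual W)) :
    crossOver P A Y W h =
      (ρ_ _).inv ≫ (A.X ⊗ Y) ◁ P.coev' W ≫ (α_ _ _ _).inv ≫ (α_ _ _ _).hom ▷ W ≫
        (A.hb.β (Y ⊗ P.dual W) h).hom ▷ W ≫ (α_ _ _ _).hom ▷ W ≫ (α_ _ _ _).hom := by
  unfold crossOver; monoidal

/-- The two half braidings cancel and leave a loop $W$ to the right of $A\otimes Y$; purity turns it
into a scalar on the left. -/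
theorem crossOver_crossBack (hp : IsPure C) (A : GCenter 𝒞) (Y W : C)
    (h : 𝒞 1 (Y ⊗ P.dual W)) :
    crossOver P A Y W h ≫ crossBack P A Y W h = unitScalar (P.dimLeft W) (A.X ⊗ Y) := by
  rw [hp]
  unfold crossOver crossBack
  calc
    _ = 𝟙 _ ⊗≫ (A.X ⊗ Y) ◁ P.coev' W ⊗≫
          ((A.hb.β (Y ⊗ P.dual W) h).hom ≫ (A.hb.β (Y ⊗ P.dual W) h).inv) ▷ W ⊗≫
          (A.X ⊗ Y) ◁ P.ev W ⊗≫ 𝟙 (A.X ⊗ Y) := by monoidal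
    _ = _ := by
      rw [Iso.hom_inv_id]; simp only [PivotalStructure.dimLeft]; monoidal

theorem crossOver_naturality (A : GCenter 𝒞) {Y Y' : C} (W : C) (h : 𝒞 1 (Y ⊗ P.dual W))
    (h' : 𝒞 1 (Y' ⊗ P.dual W)) (f : Y ⟶ Y') :
    A.X ◁ f ≫ crossOver P A Y' W h' = crossOver P A Y W h ≫ f ▷ P.conj W A.X := by
  unfold crossOver
  calc
    _ = 𝟙 _ ⊗≫ A.X ◁ (f ▷ 𝟙_ C ≫ Y' ◁ P.coev' W) ⊗≫
          (A.hb.β (Y' ⊗ P.dual W) h').hom ▷ W ⊗≫ 𝟙 _ := by monoidal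
    _ = 𝟙 _ ⊗≫ (A.X ⊗ Y) ◁ P.coev' W ⊗≫
          (A.X ◁ (f ▷ P.dual W) ≫ (A.hb.β (Y' ⊗ P.dual W) h').hom) ▷ W ⊗≫ 𝟙 _ := by
      rw [← whisker_exchange]; monoidal
    _ = _ := by rw [A.hb.naturality h h']; monoidal

theorem crossOver_tensor (A : GCenter 𝒞) {Y X : C} (W : C) (hY : 𝒞 1 Y)
    (h : 𝒞 1 (X ⊗ P.dual W)) (h' : 𝒞 1 ((Y ⊗ X) ⊗ P.dual W)) (h'' : 𝒞 1 (Y ⊗ X ⊗ P.dual W)) :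
    crossOver P A (Y ⊗ X) W h' =
      (α_ _ _ _).inv ≫ (A.hb.β Y hY).hom ▷ X ≫ (α_ _ _ _).hom ≫ Y ◁ crossOver P A X W h ≫
        (α_ _ _ _).inv := by
  have e1 := A.hb.naturality h' h'' (α_ _ _ _).hom
  rw [A.hb.monoidal _ _ hY h] at e1
  unfold crossOver
  calc
    _ = 𝟙 _ ⊗≫ (A.X ⊗ (Y ⊗ X)) ◁ P.coev' W ⊗≫ ((A.hb.β _ h').hom ≫ (α_ _ _ _).hom ▷ A.X) ▷ W ⊗≫
        𝟙 _ := by monoidal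
    _ = 𝟙 _ ⊗≫ ((A.X ⊗ Y) ◁ (X ◁ P.coev' W) ≫ (A.hb.β Y hY).hom ▷ _) ⊗≫
        Y ◁ (A.hb.β _ h).hom ▷ W ⊗≫ 𝟙 _ := by rw [← e1]; monoidal
    _ = _ := by rw [whisker_exchange]; monoidal

theorem crossOver_naturality_left {A B : GCenter 𝒞} (f : A ⟶ B) (Y W : C)
    (h : 𝒞 1 (Y ⊗ P.dual W)) :
    f.f ▷ Y ≫ crossOver P B Y W h =
      crossOver P A Y W h ≫ Y ◁ ((P.dual W ◁ f.f) ▷ W) := by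
  unfold crossOver
  calc
    _ = 𝟙 _ ⊗≫ (f.f ▷ (Y ⊗ 𝟙_ C) ≫ B.X ◁ (Y ◁ P.coev' W)) ⊗≫
          (B.hb.β (Y ⊗ P.dual W) h).hom ▷ W ⊗≫ 𝟙 _ := by monoidal
    _ = 𝟙 _ ⊗≫ (A.X ⊗ Y) ◁ P.coev' W ⊗≫
          (f.f ▷ (Y ⊗ P.dual W) ≫ (B.hb.β (Y ⊗ P.dual W) h).hom) ▷ W ⊗≫ 𝟙 _ := by
      rw [← whisker_exchange]; monoidal
    _ = _ := by rw [f.comm]; monoidal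

theorem ev'_zigzag (P : PivotalStructure C) (X : C) :
    𝟙 (P.dual X) ⊗≫ P.coev' X ▷ P.dual X ⊗≫ P.dual X ◁ P.ev' X ⊗≫ 𝟙 (P.dual X) = 𝟙 _ := by
  have := (P.right X).evaluation_coevaluation'
  calc
    _ = 𝟙 _ ⊗≫ (P.coev' X ▷ P.dual X ≫ (α_ _ _ _).hom ≫ P.dual X ◁ P.ev' X) ⊗≫ 𝟙 _ := by monoidal
    _ = _ := by
      unfold PivotalStructure.coev' PivotalStructure.ev'
      rw [this]; monoidal

theorem ev'_zigzag' (P : PivotalStructure C) (X : C) :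
    𝟙 X ⊗≫ X ◁ P.coev' X ⊗≫ P.ev' X ▷ X ⊗≫ 𝟙 X = 𝟙 _ := by
  have := (P.right X).coevaluation_evaluation'
  calc
    _ = 𝟙 _ ⊗≫ (X ◁ P.coev' X ≫ (α_ _ _ _).inv ≫ P.ev' X ▷ X) ⊗≫ 𝟙 _ := by monoidal
    _ = _ := by
      unfold PivotalStructure.coev' PivotalStructure.ev'
      rw [this]; monoidal

theorem ev_zigzag (P : PivotalStructure C) (X : C) :
    𝟙 X ⊗≫ P.coev X ▷ X ⊗≫ X ◁ P.ev X ⊗≫ 𝟙 X = 𝟙 _ := by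
  have := (P.left X).evaluation_coevaluation'
  calc
    _ = 𝟙 _ ⊗≫ (P.coev X ▷ X ≫ (α_ _ _ _).hom ≫ X ◁ P.ev X) ⊗≫ 𝟙 _ := by monoidal
    _ = _ := by
      unfold PivotalStructure.coev PivotalStructure.ev
      rw [this]; monoidal

/-- Source of the formula for $(\varphi_V)_2$. Moving $A$ and $B$ separately creates two pairs
$W^*\otimes W$; contracting the inner $W\otimes W^*$ by $\widetilde{\mathrm{ev}}_W$ removes one of
them by a zigzag identity. -/
theorem crossOver_tensor_left (A B : GCenter 𝒞) (X W : C) (h : 𝒞 1 (X ⊗ P.dual W)) :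
    crossOver P (A ⊗ B) X W h =
      (α_ _ _ _).hom ≫ A.X ◁ crossOver P B X W h ≫ (α_ _ _ _).inv ≫
        crossOver P A X W h ▷ P.conj W B.X ≫ (α_ _ _ _).hom ≫
        X ◁ (𝟙 _ ⊗≫ (P.dual W ⊗ A.X) ◁ (P.ev' W ▷ (B.X ⊗ W)) ⊗≫
          𝟙 (P.conj W (A.X ⊗ B.X))) := by
  symm
  rw [crossOver_eq (A ⊗ B)]
  unfold crossOver
  calc
    _ = 𝟙 _ ⊗≫ (A.X ⊗ B.X ⊗ X) ◁ P.coev' W ⊗≫ A.X ◁ (B.hb.β _ h).hom ▷ W ⊗≫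
          ((A.X ⊗ X) ◁ (P.coev' W ▷ (P.dual W ⊗ B.X ⊗ W)) ⊗≫
          ((A.hb.β _ h).hom ▷ (W ⊗ P.dual W ⊗ B.X ⊗ W) ≫ ((X ⊗ P.dual W) ⊗ A.X) ◁
            (𝟙 _ ⊗≫ P.ev' W ▷ (B.X ⊗ W)))) ⊗≫ 𝟙 _ := by monoidal
    _ = 𝟙 _ ⊗≫ (A.X ⊗ B.X ⊗ X) ◁ P.coev' W ⊗≫ A.X ◁ (B.hb.β _ h).hom ▷ W ⊗≫
          ((A.X ⊗ X) ◁ ((𝟙 (P.dual W) ⊗≫ P.coev' W ▷ P.dual W ⊗≫ P.dual W ◁ P.ev' W ⊗≫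
            𝟙 (P.dual W)) ▷ (B.X ⊗ W)) ⊗≫
          ((A.hb.β _ h).hom ▷ (B.X ⊗ W))) ⊗≫ 𝟙 _ := by rw [← whisker_exchange]; monoidal
    _ = (ρ_ _).inv ≫ ((A.X ⊗ B.X) ⊗ X) ◁ P.coev' W ≫ (α_ _ _ _).inv ≫ (α_ _ _ _).hom ▷ W ≫
          ((α_ _ _ _).hom ≫ A.X ◁ (B.hb.β _ h).hom ≫
          (α_ _ _ _).inv ≫ (A.hb.β _ h).hom ▷ B.X ≫ (α_ _ _ _).hom) ▷ W ≫
          (α_ _ _ _).hom ▷ W ≫ (α_ _ _ _).hom := by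
      rw [ev'_zigzag]; monoidal
    _ = _ := by rw [← RelCenter.tensorObj'_σ_hom]; rfl

theorem crossOver_unit (X W : C) (h : 𝒞 1 (X ⊗ P.dual W)) :
    crossOver P (𝟙_ (GCenter 𝒞)) X W h =
      (λ_ X).hom ≫ (ρ_ X).inv ≫ X ◁ (P.coev' W ⊗≫ 𝟙 (P.conj W (𝟙_ C))) := by
  rw [crossOver_eq]
  change (ρ_ _).inv ≫ (𝟙_ C ⊗ X) ◁ P.coev' W ≫ (α_ _ _ _).inv ≫ (α_ (𝟙_ C) X (P.dual W)).hom ▷ W ≫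
        ((λ_ (X ⊗ P.dual W)).hom ≫ (ρ_ _).inv) ▷ W ≫ (α_ _ _ _).hom ▷ W ≫ (α_ _ _ _).hom = _
  monoidal

variable [Preadditive C]

/-- After inserting $\sigma^{-1}\sigma$ for $X\otimes V^*$, multiplicativity merges $\sigma$ with
the crossing over $V\otimes Y$ into one crossing over $(X\otimes V^*)\otimes(V\otimes Y)$, and
naturality slides $\mathrm{ev}_V$ through it. -/
theorem crossBack_crossOver (h : IsPivotalGGraded P 𝒞) {β : G} (A : GCenter 𝒞) {X V Y W : C}
    (hVY' : 𝒞 β (V ⊗ Y)) (hW : 𝒞 β W) (hXV : 𝒞 1 (X ⊗ P.dual V)) (hVY : 𝒞 1 ((V ⊗ Y) ⊗ P.dual W))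
    (hXY : 𝒞 1 ((X ⊗ Y) ⊗ P.dual W)) :
    𝟙 ((X ⊗ P.conj V A.X) ⊗ Y) ⊗≫ (X ⊗ P.dual V) ◁ crossOver P A (V ⊗ Y) W hVY ⊗≫
        (X ◁ P.ev V) ▷ (Y ⊗ P.conj W A.X) ⊗≫ 𝟙 ((X ⊗ Y) ⊗ P.conj W A.X) =
      crossBack P A X V hXV ▷ Y ≫ (α_ _ _ _).hom ≫ crossOver P A (X ⊗ Y) W hXY := by
  have hm : 𝒞 1 (((X ⊗ P.dual V) ⊗ V ⊗ Y) ⊗ P.dual W) :=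
    h.mem_one (h.one_mul_mem hXV hVY') hW
  have hm' : 𝒞 1 ((X ⊗ P.dual V) ⊗ (V ⊗ Y) ⊗ P.dual W) := h.one_mul_mem hXV hVY
  have e1 := crossOver_tensor A W hXV hVY hm hm'
  have e2 := crossOver_naturality A W hm hXY (𝟙 _ ⊗≫ X ◁ P.ev V ▷ Y ⊗≫ 𝟙 _)
  unfold crossBack
  calc
    _ = 𝟙 _ ⊗≫ ((A.hb.β _ hXV).inv ≫ (A.hb.β _ hXV).hom) ▷ (V ⊗ Y) ⊗≫
          (X ⊗ P.dual V) ◁ crossOver P A (V ⊗ Y) W hVY ⊗≫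
          (X ◁ P.ev V) ▷ (Y ⊗ P.conj W A.X) ⊗≫ 𝟙 ((X ⊗ Y) ⊗ P.conj W A.X) := by
      rw [Iso.inv_hom_id]; monoidal
    _ = 𝟙 _ ⊗≫ (A.hb.β _ hXV).inv ▷ (V ⊗ Y) ⊗≫ (crossOver P A ((X ⊗ P.dual V) ⊗ V ⊗ Y) W hm ≫
          (𝟙 ((X ⊗ P.dual V) ⊗ V ⊗ Y) ⊗≫ X ◁ P.ev V ▷ Y ⊗≫ 𝟙 (X ⊗ Y)) ▷ _) := by
      rw [e1]; monoidal
    _ = _ := by rw [← e2]; monoidal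

/-- The version without $Y$, by the same argument. For $W=V$ the left side is
$\mathrm{id}_X\otimes\pi^V_A$ up to the factor $d_V$; for general $W$ it governs $\delta$. -/
theorem crossBack_crossOver_self (h : IsPivotalGGraded P 𝒞) {α : G} (A : GCenter 𝒞) {X V W : C}
    (hV : 𝒞 α V) (hW : 𝒞 α W) (hXV : 𝒞 1 (X ⊗ P.dual V)) (hVW : 𝒞 1 (V ⊗ P.dual W))
    (hXW : 𝒞 1 (X ⊗ P.dual W)) :
    X ◁ (𝟙 (P.conj V A.X) ⊗≫ P.dual V ◁ crossOver P A V W hVW ⊗≫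
        P.ev V ▷ (P.conj W A.X) ⊗≫ 𝟙 (P.conj W A.X)) =
      crossBack P A X V hXV ≫ crossOver P A X W hXW := by
  have hm : 𝒞 1 (((X ⊗ P.dual V) ⊗ V) ⊗ P.dual W) :=
    h.mem_one (h.one_mul_mem hXV hV) hW
  have hm' : 𝒞 1 ((X ⊗ P.dual V) ⊗ V ⊗ P.dual W) := h.one_mul_mem hXV hVW
  have e1 := crossOver_tensor A W hXV hVW hm hm'
  have e2 := crossOver_naturality A W hm hXW (𝟙 _ ⊗≫ X ◁ P.ev V ⊗≫ 𝟙 _)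
  unfold crossBack
  calc
    _ = 𝟙 _ ⊗≫ ((A.hb.β _ hXV).inv ≫ (A.hb.β _ hXV).hom) ▷ V ⊗≫
          (X ⊗ P.dual V) ◁ crossOver P A V W hVW ⊗≫
          (X ◁ P.ev V) ▷ (P.conj W A.X) ⊗≫ 𝟙 (X ⊗ P.conj W A.X) := by
      rw [Iso.inv_hom_id]; monoidal
    _ = 𝟙 _ ⊗≫ (A.hb.β _ hXV).inv ▷ V ⊗≫ (crossOver P A ((X ⊗ P.dual V) ⊗ V) W hm ≫
          (𝟙 ((X ⊗ P.dual V) ⊗ V) ⊗≫ X ◁ P.ev V ⊗≫ 𝟙 X) ▷ _) := by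
      rw [e1]; monoidal
    _ = _ := by rw [← e2]; monoidal

end CrossOver

/-! ### Transfers and the morphisms they induce -/

section Transfer

variable {G : Type w} [Group G] {C : Type u} [Category.{v} C] [MonoidalCategory C]
  {P : PivotalStructure C} {𝒞 : G → ObjectProperty C}

/-- A transfer of degree `α` from `A` to `B` is a family of isomorphisms `A ⊗ X ≅ X ⊗ B`, natural in
`X` of degree `α`, and compatible with the half braidings of `A` and `B`. -/
structure Transfer (α : G) (A B : GCenter 𝒞) where
  Γ (X : C) (hX : 𝒞 α X) : A.X ⊗ X ≅ X ⊗ B.X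
  naturality {X Y : C} (hX : 𝒞 α X) (hY : 𝒞 α Y) (f : X ⟶ Y) :
    A.X ◁ f ≫ (Γ Y hY).hom = (Γ X hX).hom ≫ f ▷ B.X
  tensor_left (Y X : C) (hY : 𝒞 1 Y) (hX : 𝒞 α X) (hYX : 𝒞 α (Y ⊗ X)) :
    (Γ (Y ⊗ X) hYX).hom = (α_ _ _ _).inv ≫ (A.hb.β Y hY).hom ▷ X ≫ (α_ _ _ _).hom ≫
      Y ◁ (Γ X hX).hom ≫ (α_ _ _ _).inv
  tensor_right (X Y : C) (hX : 𝒞 α X) (hY : 𝒞 1 Y) (hXY : 𝒞 α (X ⊗ Y)) :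
    (Γ (X ⊗ Y) hXY).hom = (α_ _ _ _).inv ≫ (Γ X hX).hom ▷ Y ≫ (α_ _ _ _).hom ≫
      X ◁ (B.hb.β Y hY).hom ≫ (α_ _ _ _).inv

namespace Transfer

/-- The half braiding of an object of the `G`-center is a transfer of degree `1`. -/
def ofHalfBraiding (A : GCenter 𝒞) : Transfer 1 A A where
  Γ := A.hb.β
  naturality := A.hb.naturality
  tensor_left _ _ hY hX h := A.hb.monoidal _ _ hY hX h
  tensor_right _ _ hX hY h := A.hb.monoidal _ _ hX hY h

section Tensor

variable {α : G} {A B A' B' : GCenter 𝒞} (t : Transfer α A B) (t' : Transfer α A' B')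

/-- The isomorphisms underlying the tensor product of transfers. -/
def tensorΓ (X : C) (hX : 𝒞 α X) : (A.X ⊗ A'.X) ⊗ X ≅ X ⊗ (B.X ⊗ B'.X) :=
  α_ _ _ _ ≪≫ whiskerLeftIso A.X (t'.Γ X hX) ≪≫ (α_ _ _ _).symm ≪≫
    whiskerRightIso (t.Γ X hX) B'.X ≪≫ α_ _ _ _

theorem tensorΓ_hom (X : C) (hX : 𝒞 α X) :
    (tensorΓ t t' X hX).hom = (α_ _ _ _).hom ≫ A.X ◁ (t'.Γ X hX).hom ≫ (α_ _ _ _).inv ≫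
      (t.Γ X hX).hom ▷ B'.X ≫ (α_ _ _ _).hom := by
  simp [tensorΓ]

theorem tensorΓ_naturality {X Y : C} (hX : 𝒞 α X) (hY : 𝒞 α Y) (f : X ⟶ Y) :
    (A.X ⊗ A'.X) ◁ f ≫ (tensorΓ t t' Y hY).hom =
      (tensorΓ t t' X hX).hom ≫ f ▷ (B.X ⊗ B'.X) := by
  simp only [tensorΓ_hom]
  calc
    _ = 𝟙 _ ⊗≫ (A.X ◁ (A'.X ◁ f ≫ (t'.Γ Y hY).hom)) ⊗≫ (t.Γ Y hY).hom ▷ B'.X ⊗≫ 𝟙 _ := by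
      monoidal
    _ = 𝟙 _ ⊗≫ A.X ◁ (t'.Γ X hX).hom ⊗≫ (A.X ◁ f ≫ (t.Γ Y hY).hom) ▷ B'.X ⊗≫ 𝟙 _ := by
      rw [t'.naturality hX hY]; monoidal
    _ = _ := by rw [t.naturality hX hY]; monoidal

theorem tensorΓ_tensor_left (Y X : C) (hY : 𝒞 1 Y) (hX : 𝒞 α X) (hYX : 𝒞 α (Y ⊗ X)) :
    (tensorΓ t t' (Y ⊗ X) hYX).hom = (α_ _ _ _).inv ≫
      ((RelCenter.tensorHalfBraiding A A').β Y hY).hom ▷ X ≫ (α_ _ _ _).hom ≫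
      Y ◁ (tensorΓ t t' X hX).hom ≫ (α_ _ _ _).inv := by
  simp only [tensorΓ_hom, RelCenter.tensorHalfBraiding, Iso.trans_hom, whiskerLeftIso_hom,
    Iso.symm_hom, whiskerRightIso_hom]
  rw [t.tensor_left Y X hY hX hYX, t'.tensor_left Y X hY hX hYX]
  calc
    _ = 𝟙 _ ⊗≫ A.X ◁ (A'.hb.β Y hY).hom ▷ X ⊗≫
          (_ ◁ (t'.Γ X hX).hom ≫ (A.hb.β Y hY).hom ▷ _) ⊗≫
          Y ◁ (t.Γ X hX).hom ▷ B'.X ⊗≫ 𝟙 _ := by monoidal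
    _ = _ := by rw [whisker_exchange]; monoidal

theorem tensorΓ_tensor_right (X Y : C) (hX : 𝒞 α X) (hY : 𝒞 1 Y) (hXY : 𝒞 α (X ⊗ Y)) :
    (tensorΓ t t' (X ⊗ Y) hXY).hom = (α_ _ _ _).inv ≫ (tensorΓ t t' X hX).hom ▷ Y ≫
      (α_ _ _ _).hom ≫ X ◁ ((RelCenter.tensorHalfBraiding B B').β Y hY).hom ≫
      (α_ _ _ _).inv := by
  simp only [tensorΓ_hom, RelCenter.tensorHalfBraiding, Iso.trans_hom, whiskerLeftIso_hom,
    Iso.symm_hom, whiskerRightIso_hom]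
  rw [t.tensor_right X Y hX hY hXY, t'.tensor_right X Y hX hY hXY]
  calc
    _ = 𝟙 _ ⊗≫ A.X ◁ (t'.Γ X hX).hom ▷ Y ⊗≫
          (_ ◁ (B'.hb.β Y hY).hom ≫ (t.Γ X hX).hom ▷ _) ⊗≫
          X ◁ (B.hb.β Y hY).hom ▷ B'.X ⊗≫ 𝟙 _ := by monoidal
    _ = _ := by rw [whisker_exchange]; monoidal

/-- Transfers can be tensored. -/
def tensor : Transfer α (A ⊗ A') (B ⊗ B') where
  Γ := tensorΓ t t'
  naturality := tensorΓ_naturality t t'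
  tensor_left := tensorΓ_tensor_left t t'
  tensor_right := tensorΓ_tensor_right t t'

theorem tensor_Γ_hom (X : C) (hX : 𝒞 α X) :
    ((t.tensor t').Γ X hX).hom = (α_ _ _ _).hom ≫ A.X ◁ (t'.Γ X hX).hom ≫ (α_ _ _ _).inv ≫
      (t.Γ X hX).hom ▷ B'.X ≫ (α_ _ _ _).hom :=
  tensorΓ_hom t t' X hX

end Tensor

/-- The transfer of the unit object. -/
def unit (α : G) : Transfer α (𝟙_ (GCenter 𝒞)) (𝟙_ (GCenter 𝒞)) where
  Γ X hX := (λ_ X ≪≫ (ρ_ X).symm : 𝟙_ C ⊗ X ≅ X ⊗ 𝟙_ C)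
  naturality {X Y} hX hY f := by
    change 𝟙_ C ◁ f ≫ (λ_ Y).hom ≫ (ρ_ Y).inv = ((λ_ X).hom ≫ (ρ_ X).inv) ≫ f ▷ 𝟙_ C
    monoidal
  tensor_left Y X hY hX hYX := by
    change (λ_ (Y ⊗ X)).hom ≫ (ρ_ (Y ⊗ X)).inv = (α_ (𝟙_ C) Y X).inv ≫
      ((λ_ Y).hom ≫ (ρ_ Y).inv) ▷ X ≫ (α_ Y (𝟙_ C) X).hom ≫ Y ◁ ((λ_ X).hom ≫ (ρ_ X).inv) ≫
      (α_ Y X (𝟙_ C)).inv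
    monoidal
  tensor_right Y X hY hX hYX := by
    change (λ_ (Y ⊗ X)).hom ≫ (ρ_ (Y ⊗ X)).inv = (α_ (𝟙_ C) Y X).inv ≫
      ((λ_ Y).hom ≫ (ρ_ Y).inv) ▷ X ≫ (α_ Y (𝟙_ C) X).hom ≫ Y ◁ ((λ_ X).hom ≫ (ρ_ X).inv) ≫
      (α_ Y X (𝟙_ C)).inv
    monoidal

theorem unit_Γ_hom (α : G) (X : C) (hX : 𝒞 α X) :
    ((unit α).Γ X hX).hom = (λ_ X).hom ≫ (ρ_ X).inv := rfl

/-- `g` is the image of `f` under the transfers `t` and `t'`. -/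
def Intertwines {α : G} {A B A' B' : GCenter 𝒞} (t : Transfer α A B) (t' : Transfer α A' B')
    (f : A ⟶ A') (g : B.X ⟶ B'.X) : Prop :=
  ∀ (X : C) (hX : 𝒞 α X), (t.Γ X hX).hom ≫ X ◁ g = f.f ▷ X ≫ (t'.Γ X hX).hom

variable {α : G} {A B A' B' A'' B'' : GCenter 𝒞} {t : Transfer α A B} {t' : Transfer α A' B'}
  {t'' : Transfer α A'' B''}

theorem Intertwines.id (t : Transfer α A B) : t.Intertwines t (𝟙 A) (𝟙 B.X) :=
  fun X hX => by simp

theorem Intertwines.comp {f : A ⟶ A'} {g : B.X ⟶ B'.X} {f' : A' ⟶ A''} {g' : B'.X ⟶ B''.X}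
    (H : t.Intertwines t' f g) (H' : t'.Intertwines t'' f' g') :
    t.Intertwines t'' (f ≫ f') (g ≫ g') := fun X hX => by
  rw [MonoidalCategory.whiskerLeft_comp, reassoc_of% (H X hX), H' X hX, RelCenter.comp_f,
    comp_whiskerRight, Category.assoc]

theorem Intertwines.id_comp {t' : Transfer α A B'} {f' : A ⟶ A''} {g : B.X ⟶ B'.X}
    {g' : B'.X ⟶ B''.X} (H : t.Intertwines t' (𝟙 A) g) (H' : t'.Intertwines t'' f' g') :
    t.Intertwines t'' f' (g ≫ g') := by
  simpa only [Category.id_comp] using H.comp H'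

theorem Intertwines.comp_id {t'' : Transfer α A' B''} {f : A ⟶ A'} {g : B.X ⟶ B'.X}
    {g' : B'.X ⟶ B''.X} (H : t.Intertwines t' f g) (H' : t'.Intertwines t'' (𝟙 A') g') :
    t.Intertwines t'' f (g ≫ g') := by
  simpa only [Category.comp_id] using H.comp H'

theorem Intertwines.inv {f : A ≅ A'} {g : B.X ≅ B'.X}
    (H : t.Intertwines t' f.hom g.hom) : t'.Intertwines t f.inv g.inv := fun X hX => by
  have hf : f.inv.f ≫ f.hom.f = 𝟙 _ := congrArg RelCenter.Hom.f f.inv_hom_id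
  rw [← cancel_mono (X ◁ g.hom), Category.assoc, Category.assoc, H X hX,
    ← MonoidalCategory.whiskerLeft_comp, g.inv_hom_id, MonoidalCategory.whiskerLeft_id,
    Category.comp_id, ← comp_whiskerRight_assoc, hf, id_whiskerRight, Category.id_comp]

theorem Intertwines.tensor {A₁ B₁ A₁' B₁' : GCenter 𝒞} {s : Transfer α A₁ B₁}
    {s' : Transfer α A₁' B₁'} {f : A ⟶ A'} {g : B.X ⟶ B'.X} {f' : A₁ ⟶ A₁'} {g' : B₁.X ⟶ B₁'.X}
    (H : t.Intertwines t' f g) (H' : s.Intertwines s' f' g') :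
    (t.tensor s).Intertwines (t'.tensor s') (f ⊗ₘ f') (g ⊗ₘ g') := fun X hX => by
  change (tensorΓ t s X hX).hom ≫ X ◁ (g ⊗ₘ g') = (f.f ⊗ₘ f'.f) ▷ X ≫ (tensorΓ t' s' X hX).hom
  rw [tensorΓ_hom, tensorΓ_hom, MonoidalCategory.tensorHom_def, MonoidalCategory.tensorHom_def]
  calc
    _ = 𝟙 _ ⊗≫ A.X ◁ (s.Γ X hX).hom ⊗≫ ((t.Γ X hX).hom ≫ X ◁ g) ▷ B₁.X ⊗≫ (X ⊗ B'.X) ◁ g' ⊗≫ 𝟙 _ := by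
      monoidal
    _ = 𝟙 _ ⊗≫ A.X ◁ (s.Γ X hX).hom ⊗≫ f.f ▷ (X ⊗ B₁.X) ⊗≫
          ((t'.Γ X hX).hom ▷ B₁.X ≫ (X ⊗ B'.X) ◁ g') ⊗≫ 𝟙 _ := by
      rw [H X hX]; monoidal
    _ = 𝟙 _ ⊗≫ (A.X ◁ (s.Γ X hX).hom ≫ f.f ▷ (X ⊗ B₁.X)) ⊗≫ A'.X ◁ X ◁ g' ⊗≫
          (t'.Γ X hX).hom ▷ B₁'.X ⊗≫ 𝟙 _ := by
      rw [← whisker_exchange]; monoidal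
    _ = 𝟙 _ ⊗≫ f.f ▷ (A₁.X ⊗ X) ⊗≫ A'.X ◁ ((s.Γ X hX).hom ≫ X ◁ g') ⊗≫
          (t'.Γ X hX).hom ▷ B₁'.X ⊗≫ 𝟙 _ := by
      rw [whisker_exchange]; monoidal
    _ = _ := by rw [H' X hX]; monoidal

theorem Intertwines.whiskerRight {A₁ B₁ : GCenter 𝒞} {f : A ⟶ A'} {g : B.X ⟶ B'.X}
    (H : t.Intertwines t' f g) (s : Transfer α A₁ B₁) :
    (t.tensor s).Intertwines (t'.tensor s) (f ▷ A₁) (g ▷ B₁.X) := by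
  rw [← tensorHom_id, ← tensorHom_id]
  exact H.tensor (.id s)

theorem Intertwines.whiskerLeft {A₁ B₁ : GCenter 𝒞} {f : A ⟶ A'} {g : B.X ⟶ B'.X}
    (s : Transfer α A₁ B₁) (H : t.Intertwines t' f g) :
    (s.tensor t).Intertwines (s.tensor t') (A₁ ◁ f) (B₁.X ◁ g) := by
  rw [← id_tensorHom, ← id_tensorHom]
  exact Intertwines.tensor (.id s) H

theorem Intertwines.associator {A₁ A₂ A₃ B₁ B₂ B₃ : GCenter 𝒞} (t₁ : Transfer α A₁ B₁)
    (t₂ : Transfer α A₂ B₂) (t₃ : Transfer α A₃ B₃) :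
    ((t₁.tensor t₂).tensor t₃).Intertwines (t₁.tensor (t₂.tensor t₃)) (α_ A₁ A₂ A₃).hom
      (α_ B₁.X B₂.X B₃.X).hom := fun X hX => by
  simp only [tensor_Γ_hom, RelCenter.tensor_X]
  rw [show (α_ A₁ A₂ A₃).hom.f = (α_ A₁.X A₂.X A₃.X).hom from rfl]
  monoidal

theorem Intertwines.leftUnitor (t : Transfer α A B) :
    ((unit α).tensor t).Intertwines t (λ_ A).hom (λ_ B.X).hom := fun X hX => by
  simp only [tensor_Γ_hom, RelCenter.tensor_X, RelCenter.unit_X, unit_Γ_hom]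
  rw [show (λ_ A).hom.f = (λ_ A.X).hom from rfl]
  monoidal

theorem Intertwines.rightUnitor (t : Transfer α A B) :
    (t.tensor (unit α)).Intertwines t (ρ_ A).hom (ρ_ B.X).hom := fun X hX => by
  simp only [tensor_Γ_hom, RelCenter.tensor_X, RelCenter.unit_X, unit_Γ_hom]
  rw [show (ρ_ A).hom.f = (ρ_ A.X).hom from rfl]
  monoidal

/-- As $\Gamma_X$ is invertible, the intertwining relation determines $\mathrm{id}_X\otimes g$ for
every $X$ of degree $\alpha$, hence $g$. Most coherence identities below are instances: both sides
are shown to lie over the same morphism of sources. -/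
theorem Intertwines.ext (hns : IsNonsingular P 𝒞) {f : A ⟶ A'} {g g' : B.X ⟶ B'.X}
    (H : t.Intertwines t' f g) (H' : t.Intertwines t' f g') : g = g' :=
  hns.whiskerLeft_ext α fun X hX => by
    rw [← cancel_epi (t.Γ X hX).hom, H X hX, H' X hX]

variable [Preadditive C]

/-- The half braiding of $B$ is recorded by the transfer at $X\otimes U$, so the intertwining
relation at $X\otimes U$, compared with the one at $X$, yields compatibility with the half braidings
after tensoring with $X$. -/
theorem Intertwines.isHom (h : IsPivotalGGraded P 𝒞) (hns : IsNonsingular P 𝒞) {f : A ⟶ A'}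
    {g : B.X ⟶ B'.X} (H : t.Intertwines t' f g) : RelCenter.IsHom B B' g := fun U hU =>
  hns.whiskerLeft_ext α fun X hX => by
    have hXU := h.mem_mul_one hX hU
    have e1 := t.tensor_right X U hX hU hXU
    have e2 := t'.tensor_right X U hX hU hXU
    rw [← cancel_epi ((α_ _ _ _).inv ≫ (t.Γ X hX).hom ▷ U ≫ (α_ _ _ _).hom),
      ← cancel_mono (α_ _ _ _).inv]
    calc
      _ = 𝟙 _ ⊗≫ ((t.Γ X hX).hom ≫ X ◁ g) ▷ U ⊗≫ X ◁ (B'.hb.β U hU).hom ⊗≫ 𝟙 _ := by monoidal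
      _ = f.f ▷ (X ⊗ U) ≫ (t'.Γ _ hXU).hom := by rw [H X hX, e2]; monoidal
      _ = (t.Γ _ hXU).hom ≫ (X ⊗ U) ◁ g := by rw [H _ hXU]
      _ = _ := by rw [e1]; monoidal

/-- Conjugating $f$ by the transfers gives a family that descends: its compatibility with tensoring
by $\mathcal C_1$ on the left only involves the half braidings of the sources, with which $f$
commutes. -/
theorem exists_intertwines (h : IsPivotalGGraded P 𝒞) (hns : IsNonsingular P 𝒞)
    (t : Transfer α A B) (t' : Transfer α A' B') (f : A ⟶ A') :
    ∃ g : B ⟶ B', t.Intertwines t' f g.f := by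
  obtain ⟨V⟩ := hns.nonempty_invObj α
  let T : ModuleTransformation 𝒞 α B.X B'.X :=
    { app := fun X hX => (t.Γ X hX).inv ≫ f.f ▷ X ≫ (t'.Γ X hX).hom
      naturality := fun {X Y} hX hY k => by
        rw [← cancel_epi (t.Γ X hX).hom, ← reassoc_of% (t.naturality hX hY k),
          Iso.hom_inv_id_assoc, Category.assoc, Category.assoc, ← t'.naturality hX hY k,
          whisker_exchange_assoc, Iso.hom_inv_id_assoc]
      tensor := fun Y X hY hX hYX => by
        rw [← cancel_epi (t.Γ _ hYX).hom, Iso.hom_inv_id_assoc, t.tensor_left Y X hY hX hYX,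
          t'.tensor_left Y X hY hX hYX]
        symm
        calc
          _ = 𝟙 _ ⊗≫ (A.hb.β Y hY).hom ▷ X ⊗≫ Y ◁ ((t.Γ X hX).hom ≫ (t.Γ X hX).inv) ⊗≫
                Y ◁ f.f ▷ X ⊗≫ Y ◁ (t'.Γ X hX).hom ⊗≫ 𝟙 _ := by monoidal
          _ = 𝟙 _ ⊗≫ ((A.hb.β Y hY).hom ≫ Y ◁ f.f) ▷ X ⊗≫ Y ◁ (t'.Γ X hX).hom ⊗≫ 𝟙 _ := by
            rw [Iso.hom_inv_id]; monoidal
          _ = _ := by rw [← f.comm Y hY]; monoidal }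
  have H : t.Intertwines t' f (V.ptr (T.app V.obj V.mem)) := fun X hX => by
    rw [T.whiskerLeft_ptr h hns.pure V X hX]
    simp [T]
  exact ⟨⟨_, H.isHom h hns⟩, H⟩

/-- The morphism induced by transfers on their targets. -/
noncomputable def map (h : IsPivotalGGraded P 𝒞) (hns : IsNonsingular P 𝒞)
    (t : Transfer α A B) (t' : Transfer α A' B') (f : A ⟶ A') : B ⟶ B' :=
  (exists_intertwines h hns t t' f).choose

theorem map_intertwines (h : IsPivotalGGraded P 𝒞) (hns : IsNonsingular P 𝒞)
    (t : Transfer α A B) (t' : Transfer α A' B') (f : A ⟶ A') :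
    t.Intertwines t' f (map h hns t t' f).f :=
  (exists_intertwines h hns t t' f).choose_spec

/-- The isomorphism induced by transfers on their targets. -/
noncomputable def mapIso (h : IsPivotalGGraded P 𝒞) (hns : IsNonsingular P 𝒞)
    (t : Transfer α A B) (t' : Transfer α A' B') (f : A ≅ A') : B ≅ B' where
  hom := map h hns t t' f.hom
  inv := map h hns t' t f.inv
  hom_inv_id := RelCenter.hom_ext _ _ <| Intertwines.ext hns
    ((map_intertwines h hns t t' f.hom).comp (map_intertwines h hns t' t f.inv))
    (by rw [f.hom_inv_id]; exact Intertwines.id t)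
  inv_hom_id := RelCenter.hom_ext _ _ <| Intertwines.ext hns
    ((map_intertwines h hns t' t f.inv).comp (map_intertwines h hns t t' f.hom))
    (by rw [f.inv_hom_id]; exact Intertwines.id t')

end Transfer

end Transfer

/-! ### The idempotents $\pi^V$ and the isomorphisms $\Gamma^V$ -/

section Splitting

variable {G : Type w} [Group G] {C : Type u} [Category.{v} C] [MonoidalCategory C]
  {P : PivotalStructure C} {𝒞 : G → ObjectProperty C} [Preadditive C]
  {h : IsPivotalGGraded P 𝒞}

/-- The factorization through $A\otimes X$ is what identifies $A\otimes X$ with the image of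
$\mathrm{id}_X\otimes\pi^V_A$, that is, with $X\otimes E^V_A$. -/
theorem whiskerLeft_idem (hp : IsPure C) {α : G} (V : InvObj P 𝒞 α) (A : GCenter 𝒞) (X : C)
    (hX : 𝒞 α X) :
    X ◁ idem h V A = unitScalar V.dimInv _ ≫ crossBack P A X V.obj (h.mem_one hX V.mem) ≫
      crossOver P A X V.obj (h.mem_one hX V.mem) := by
  rw [idem, MonoidalCategory.whiskerLeft_comp, hp.whiskerLeft_unitScalar,
    crossBack_crossOver_self h A V.mem V.mem (h.mem_one hX V.mem)]

theorem crossOver_comp_whiskerLeft_idem (hp : IsPure C) {α : G} (V : InvObj P 𝒞 α)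
    (A : GCenter 𝒞) (X : C) (hX : 𝒞 α X) :
    crossOver P A X V.obj (h.mem_one hX V.mem) ≫ X ◁ idem h V A =
      crossOver P A X V.obj (h.mem_one hX V.mem) := by
  rw [whiskerLeft_idem hp V A X hX, ← unitScalar_naturality_assoc,
    reassoc_of% (crossOver_crossBack hp A X V.obj (h.mem_one hX V.mem)),
    reassoc_of% (V.unitScalar_dimInv_dim (A.X ⊗ X))]

theorem idem_comp_idem (hp : IsPure C) {α : G} (V : InvObj P 𝒞 α) (A : GCenter 𝒞) :
    idem h V A ≫ idem h V A = idem h V A :=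
  V.whiskerLeft_injective <| by
    rw [MonoidalCategory.whiskerLeft_comp]
    -- Only the first factor is opened; it ends in `crossOver`, which absorbs the second one.
    nth_rw 1 [whiskerLeft_idem (h := h) hp V A V.obj V.mem]
    rw [Category.assoc, Category.assoc, crossOver_comp_whiskerLeft_idem hp V A V.obj V.mem,
      ← whiskerLeft_idem hp V A V.obj V.mem]

namespace SplittingChoice

variable {α : G} {V : InvObj P 𝒞 α} (S : SplittingChoice h V) (hp : IsPure C)

/-- The isomorphism `A ⊗ X ≅ X ⊗ E` determined by a splitting. -/
noncomputable def Γ (A : GCenter 𝒞) (X : C) (hX : 𝒞 α X) : A.X ⊗ X ≅ X ⊗ S.E A where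
  hom := crossOver P A X V.obj (h.mem_one hX V.mem) ≫ X ◁ S.p A
  inv := unitScalar V.dimInv _ ≫ X ◁ S.q A ≫ crossBack P A X V.obj (h.mem_one hX V.mem)
  hom_inv_id := by
    rw [← unitScalar_naturality_assoc, Category.assoc, ← MonoidalCategory.whiskerLeft_comp_assoc,
      S.p_q, reassoc_of% (crossOver_comp_whiskerLeft_idem (h := h) hp V A X hX),
      crossOver_crossBack hp, V.unitScalar_dimInv_dim]
  inv_hom_id := by
    rw [Category.assoc, Category.assoc, unitScalar_naturality_assoc,
      ← reassoc_of% (whiskerLeft_idem (h := h) hp V A X hX), ← MonoidalCategory.whiskerLeft_comp,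
      ← MonoidalCategory.whiskerLeft_comp, ← S.p_q, Category.assoc, S.q_p, Category.comp_id,
      S.q_p, MonoidalCategory.whiskerLeft_id]

theorem Γ_hom_q (A : GCenter 𝒞) (X : C) (hX : 𝒞 α X) :
    (S.Γ hp A X hX).hom ≫ X ◁ S.q A = crossOver P A X V.obj (h.mem_one hX V.mem) := by
  simp only [Γ, Category.assoc, ← MonoidalCategory.whiskerLeft_comp, S.p_q]
  exact crossOver_comp_whiskerLeft_idem hp V A X hX

theorem Γ_naturality (A : GCenter 𝒞) {X Y : C} (hX : 𝒞 α X) (hY : 𝒞 α Y) (f : X ⟶ Y) :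
    A.X ◁ f ≫ (S.Γ hp A Y hY).hom = (S.Γ hp A X hX).hom ≫ f ▷ S.E A := by
  simp only [Γ, Category.assoc]
  rw [reassoc_of% (crossOver_naturality A V.obj (h.mem_one hX V.mem) (h.mem_one hY V.mem) f),
    whisker_exchange]

theorem Γ_tensor_left (A : GCenter 𝒞) (Y X : C) (hY : 𝒞 1 Y) (hX : 𝒞 α X)
    (hYX : 𝒞 α (Y ⊗ X)) :
    (S.Γ hp A (Y ⊗ X) hYX).hom = (α_ _ _ _).inv ≫ (A.hb.β Y hY).hom ▷ X ≫ (α_ _ _ _).hom ≫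
      Y ◁ (S.Γ hp A X hX).hom ≫ (α_ _ _ _).inv := by
  simp only [Γ]
  rw [crossOver_tensor A V.obj hY (h.mem_one hX V.mem) (h.mem_one hYX V.mem)
    (h.one_mul_mem hY (h.mem_one hX V.mem))]
  monoidal

/-- The half braiding of the image of a splitting. -/
noncomputable def braid (A : GCenter 𝒞) (X : C) (hX : 𝒞 1 X) : S.E A ⊗ X ⟶ X ⊗ S.E A :=
  unitScalar V.dimInv _ ≫
    (𝟙 (S.E A ⊗ X) ⊗≫ S.q A ▷ X ⊗≫
      P.dual V.obj ◁ crossOver P A (V.obj ⊗ X) V.obj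
        (h.mem_one (h.mem_mul_one V.mem hX) V.mem) ⊗≫
      P.ev V.obj ▷ (X ⊗ P.conj V.obj A.X) ⊗≫ X ◁ S.p A)

/-- This property characterizes $\gamma^V$. Once $\Gamma_X$ is cancelled, the loop through $V$ in
the formula for $\gamma^V$ is shrunk by `crossBack_crossOver`. -/
theorem Γ_tensor_right (A : GCenter 𝒞) (X Y : C) (hX : 𝒞 α X) (hY : 𝒞 1 Y)
    (hXY : 𝒞 α (X ⊗ Y)) :
    (S.Γ hp A (X ⊗ Y) hXY).hom = (α_ _ _ _).inv ≫ (S.Γ hp A X hX).hom ▷ Y ≫ (α_ _ _ _).hom ≫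
      X ◁ S.braid A Y hY ≫ (α_ _ _ _).inv := by
  rw [← cancel_epi ((S.Γ hp A X hX).inv ▷ Y ≫ (α_ _ _ _).hom)]
  have L := crossBack_crossOver h A (h.mem_mul_one V.mem hY) V.mem (h.mem_one hX V.mem)
    (h.mem_one (h.mem_mul_one V.mem hY) V.mem) (h.mem_one hXY V.mem)
  rw [braid, MonoidalCategory.whiskerLeft_comp, hp.whiskerLeft_unitScalar]
  symm
  calc
    _ = ((S.Γ hp A X hX).inv ≫ (S.Γ hp A X hX).hom) ▷ Y ≫ (α_ _ _ _).hom ≫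
          unitScalar V.dimInv _ ≫ (𝟙 _ ⊗≫ (X ◁ S.q A) ▷ Y ⊗≫
          (𝟙 ((X ⊗ P.conj V.obj A.X) ⊗ Y) ⊗≫ (X ⊗ P.dual V.obj) ◁ crossOver P A (V.obj ⊗ Y) V.obj
            (h.mem_one (h.mem_mul_one V.mem hY) V.mem) ⊗≫
          (X ◁ P.ev V.obj) ▷ (Y ⊗ P.conj V.obj A.X) ⊗≫ 𝟙 ((X ⊗ Y) ⊗ P.conj V.obj A.X)) ⊗≫
          (X ⊗ Y) ◁ S.p A) := by
      monoidal
    _ = (unitScalar V.dimInv _ ≫ (X ◁ S.q A) ▷ Y ≫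
          crossBack P A X V.obj (h.mem_one hX V.mem) ▷ Y) ≫ (α_ _ _ _).hom ≫
          crossOver P A (X ⊗ Y) V.obj (h.mem_one hXY V.mem) ≫ (X ⊗ Y) ◁ S.p A := by
      rw [L, Iso.inv_hom_id, id_whiskerRight, Category.id_comp, ← unitScalar_naturality_assoc,
        Category.assoc]
      congr 1
      monoidal
    _ = _ := by
      rw [← unitScalar_whiskerRight]; simp only [Γ]; monoidal

end SplittingChoice

end Splitting

/-! ### Monoidal functors determined by transfers -/

section Transport

open Functor.LaxMonoidal

variable {G : Type w} [Group G] {C : Type u} [Category.{v} C] [MonoidalCategory C]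
  {P : PivotalStructure C} {𝒞 : G → ObjectProperty C}

/-- A monoidal endofunctor of the `G`-center equipped with transfers of degree `α` which determine
its action on morphisms and its monoidal constraints. -/
structure Transport (α : G) (F : GCenter 𝒞 ⥤ GCenter 𝒞) [F.Monoidal] where
  transfer (A : GCenter 𝒞) : Transfer α A (F.obj A)
  map {A B : GCenter 𝒞} (f : A ⟶ B) :
    (transfer A).Intertwines (transfer B) f (F.map f).f
  tensor (A B : GCenter 𝒞) :
    ((transfer A).tensor (transfer B)).Intertwines (transfer (A ⊗ B)) (𝟙 _) (μ F A B).f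
  unit : (Transfer.unit α).Intertwines (transfer (𝟙_ (GCenter 𝒞))) (𝟙 _) (ε F).f

namespace Transfer

variable {α : G} [Preadditive C] (h : IsPivotalGGraded P 𝒞) (hns : IsNonsingular P 𝒞)
  {obj : GCenter 𝒞 → GCenter 𝒞} (T : ∀ A, Transfer α A (obj A))

/-- The functor determined by a family of transfers. -/
noncomputable def functor : GCenter 𝒞 ⥤ GCenter 𝒞 where
  obj := obj
  map f := Transfer.map h hns (T _) (T _) f
  map_id A := RelCenter.hom_ext _ _ <|
    Intertwines.ext hns (map_intertwines h hns (T A) (T A) _) (.id _)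
  map_comp f g := RelCenter.hom_ext _ _ <|
    Intertwines.ext hns (map_intertwines h hns (T _) (T _) _)
      ((map_intertwines h hns (T _) (T _) f).comp (map_intertwines h hns (T _) (T _) g))

theorem functor_map {A B : GCenter 𝒞} (f : A ⟶ B) :
    (T A).Intertwines (T B) f ((functor h hns T).map f).f :=
  map_intertwines h hns (T A) (T B) f

/-- The monoidal structure of the functor determined by a family of transfers. -/
noncomputable def coreMonoidal : (functor h hns T).CoreMonoidal where
  εIso := mapIso h hns (Transfer.unit α) (T _) (Iso.refl _)
  μIso A B := mapIso h hns ((T A).tensor (T B)) (T (A ⊗ B)) (Iso.refl _)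
  μIso_hom_natural_left {A B} f D := RelCenter.hom_ext _ _ <| Intertwines.ext hns (f := f ▷ D)
    (((functor_map h hns T f).whiskerRight (T D)).comp_id
      (map_intertwines h hns ((T B).tensor (T D)) (T (B ⊗ D)) (𝟙 _)))
    ((map_intertwines h hns ((T A).tensor (T D)) (T (A ⊗ D)) (𝟙 _)).id_comp
      (functor_map h hns T (f ▷ D)))
  μIso_hom_natural_right {A B} D f := RelCenter.hom_ext _ _ <| Intertwines.ext hns (f := D ◁ f)
    (((functor_map h hns T f).whiskerLeft (T D)).comp_id
      (map_intertwines h hns ((T D).tensor (T B)) (T (D ⊗ B)) (𝟙 _)))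
    ((map_intertwines h hns ((T D).tensor (T A)) (T (D ⊗ A)) (𝟙 _)).id_comp
      (functor_map h hns T (D ◁ f)))
  associativity A B D := RelCenter.hom_ext _ _ <| by
    -- The constraints lie over identities and remain so after whiskering, so both sides of the
    -- associativity square lie over the associator.
    have e₁ := (map_intertwines h hns ((T A).tensor (T B)) (T (A ⊗ B)) (𝟙 _)).whiskerRight (T D)
    have e₂ := (map_intertwines h hns ((T B).tensor (T D)) (T (B ⊗ D)) (𝟙 _)).whiskerLeft (T A)
    rw [id_whiskerRight] at e₁
    rw [MonoidalCategory.whiskerLeft_id] at e₂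
    exact Intertwines.ext hns (f := (α_ A B D).hom)
      (e₁.id_comp ((map_intertwines h hns ((T (A ⊗ B)).tensor (T D))
          (T ((A ⊗ B) ⊗ D)) (𝟙 _)).id_comp (functor_map h hns T (α_ A B D).hom)))
      ((Intertwines.associator (T A) (T B) (T D)).comp_id
        (e₂.id_comp (map_intertwines h hns ((T A).tensor (T (B ⊗ D))) (T (A ⊗ B ⊗ D)) (𝟙 _))))
  left_unitality A := RelCenter.hom_ext _ _ <| by
    have e := (map_intertwines h hns (Transfer.unit α) (T (𝟙_ _)) (𝟙 _)).whiskerRight (T A)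
    rw [id_whiskerRight] at e
    exact Intertwines.ext hns (Intertwines.leftUnitor (T A))
      (e.id_comp ((map_intertwines h hns ((T (𝟙_ _)).tensor (T A))
          (T (𝟙_ _ ⊗ A)) (𝟙 _)).id_comp (functor_map h hns T (λ_ A).hom)))
  right_unitality A := RelCenter.hom_ext _ _ <| by
    have e := (map_intertwines h hns (Transfer.unit α) (T (𝟙_ _)) (𝟙 _)).whiskerLeft (T A)
    rw [MonoidalCategory.whiskerLeft_id] at e
    exact Intertwines.ext hns (Intertwines.rightUnitor (T A))
      (e.id_comp ((map_intertwines h hns ((T A).tensor (T (𝟙_ _)))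
          (T (A ⊗ 𝟙_ _)) (𝟙 _)).id_comp (functor_map h hns T (ρ_ A).hom)))

noncomputable instance monoidalFunctor : (functor h hns T).Monoidal := (coreMonoidal h hns T).toMonoidal

/-- The functor determined by a family of transfers is a transport. -/
noncomputable def transport : Transport α (functor h hns T) where
  transfer := T
  map f := functor_map h hns T f
  tensor A B := map_intertwines h hns ((T A).tensor (T B)) (T (A ⊗ B)) (𝟙 _)
  unit := map_intertwines h hns (Transfer.unit α) (T (𝟙_ _)) (𝟙 _)

end Transfer

namespace Transport

variable {α : G} {F F' : GCenter 𝒞 ⥤ GCenter 𝒞} [F.Monoidal] [F'.Monoidal]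

/-- The identity functor is a transport of degree `1`. -/
def identity : Transport 1 (𝟭 (GCenter 𝒞)) where
  transfer := Transfer.ofHalfBraiding
  map f X hX := (f.comm X hX).symm
  tensor _ _ := Transfer.Intertwines.id _
  unit := Transfer.Intertwines.id _

/-- A transformation compatible with transports is monoidal. -/
theorem isMonoidal_of_intertwines (hns : IsNonsingular P 𝒞) {T : Transport α F}
    {T' : Transport α F'} (θ : F ⟶ F')
    (H : ∀ A, (T.transfer A).Intertwines (T'.transfer A) (𝟙 A) (θ.app A).f) :
    NatTrans.IsMonoidal θ where
  unit := RelCenter.hom_ext _ _ <| Transfer.Intertwines.ext hns (T.unit.id_comp (H _)) T'.unit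
  tensor A B := RelCenter.hom_ext _ _ <| by
    have e := (H A).tensor (H B)
    rw [id_tensorHom_id] at e
    exact Transfer.Intertwines.ext hns ((T.tensor A B).id_comp (H _)) (e.id_comp (T'.tensor A B))

variable [Preadditive C] (h : IsPivotalGGraded P 𝒞) (hns : IsNonsingular P 𝒞)
  (T : Transport α F) (T' : Transport α F')

/-- The unique isomorphism between two transports of the same degree. -/
noncomputable def comparison : F ≅ F' :=
  NatIso.ofComponents
    (fun A => Transfer.mapIso h hns (T.transfer A) (T'.transfer A) (Iso.refl A))
    fun {A B} f => RelCenter.hom_ext _ _ <| Transfer.Intertwines.ext hns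
      ((T.map f).comp_id (Transfer.map_intertwines h hns (T.transfer B) (T'.transfer B) (𝟙 _)))
      ((Transfer.map_intertwines h hns (T.transfer A) (T'.transfer A) (𝟙 _)).id_comp (T'.map f))

theorem comparison_intertwines (A : GCenter 𝒞) :
    (T.transfer A).Intertwines (T'.transfer A) (𝟙 A) ((comparison h hns T T').hom.app A).f :=
  Transfer.map_intertwines h hns (T.transfer A) (T'.transfer A) (𝟙 _)

theorem comparison_isMonoidal : NatTrans.IsMonoidal (comparison h hns T T').hom :=
  isMonoidal_of_intertwines hns _ (comparison_intertwines h hns T T')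

end Transport

end Transport

/-! ### The functors $\varphi_V$ and their explicit formulas -/

section SplittingTransport

open Functor.LaxMonoidal

variable {G : Type w} [Group G] {C : Type u} [Category.{v} C] [MonoidalCategory C]
  {P : PivotalStructure C} {𝒞 : G → ObjectProperty C} [Preadditive C]
  {h : IsPivotalGGraded P 𝒞}

namespace SplittingChoice

variable {α : G} {V : InvObj P 𝒞 α} (S : SplittingChoice h V) (hns : IsNonsingular P 𝒞)

/-- By `Γ_tensor_right`, $\mathrm{id}_V\otimes\gamma^V_{A,X}$ is $\Gamma_V^{-1}$ followed by
$\Gamma_{V\otimes X}$ up to associators, and $V\otimes -$ reflects isomorphisms. Naturality and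
multiplicativity of $\gamma^V$ are likewise read off from $\Gamma$. -/
theorem isIso_braid (hp : IsPure C) (A : GCenter 𝒞) (X : C) (hX : 𝒞 1 X) :
    IsIso (S.braid A X hX) := by
  refine V.isIso_of_whiskerLeft _ ?_
  have hVX := h.mem_mul_one V.mem hX
  have e := S.Γ_tensor_right hp A V.obj X V.mem hX hVX
  have : V.obj ◁ S.braid A X hX = (α_ _ _ _).inv ≫ (S.Γ hp A V.obj V.mem).inv ▷ X ≫
      (α_ _ _ _).hom ≫ (S.Γ hp A _ hVX).hom ≫ (α_ _ _ _).hom := by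
    rw [e]; simp
  rw [this]
  infer_instance

theorem braid_naturality (hp : IsPure C) (A : GCenter 𝒞) {X Y : C} (hX : 𝒞 1 X) (hY : 𝒞 1 Y)
    (f : X ⟶ Y) : S.E A ◁ f ≫ S.braid A Y hY = S.braid A X hX ≫ f ▷ S.E A := by
  refine V.whiskerLeft_injective ?_
  have hVX := h.mem_mul_one V.mem hX
  have hVY := h.mem_mul_one V.mem hY
  have e1 := S.Γ_tensor_right hp A V.obj X V.mem hX hVX
  have e2 := S.Γ_tensor_right hp A V.obj Y V.mem hY hVY
  have e3 := S.Γ_naturality hp A hVX hVY (V.obj ◁ f)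
  rw [e1, e2] at e3
  rw [← cancel_epi ((α_ _ _ _).inv ≫ (S.Γ hp A V.obj V.mem).hom ▷ X ≫ (α_ _ _ _).hom),
    ← cancel_mono (α_ _ _ _).inv]
  calc
    _ = 𝟙 _ ⊗≫ ((S.Γ hp A V.obj V.mem).hom ▷ X ≫ _ ◁ f) ⊗≫
          V.obj ◁ S.braid A Y hY ⊗≫ 𝟙 _ := by monoidal
    _ = A.X ◁ (V.obj ◁ f) ≫ (α_ _ _ _).inv ≫ (S.Γ hp A V.obj V.mem).hom ▷ Y ≫
          (α_ _ _ _).hom ≫ V.obj ◁ S.braid A Y hY ≫ (α_ _ _ _).inv := by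
      rw [← whisker_exchange]; monoidal
    _ = _ := by rw [e3]; monoidal

theorem braid_tensor (hp : IsPure C) (A : GCenter 𝒞) (X Y : C) (hX : 𝒞 1 X) (hY : 𝒞 1 Y)
    (hXY : 𝒞 1 (X ⊗ Y)) :
    S.braid A (X ⊗ Y) hXY =
      (α_ _ _ _).inv ≫ S.braid A X hX ▷ Y ≫ (α_ _ _ _).hom ≫ X ◁ S.braid A Y hY ≫
        (α_ _ _ _).inv := by
  refine V.whiskerLeft_injective ?_
  have hVX := h.mem_mul_one V.mem hX
  have hVXY := h.mem_mul_one V.mem hXY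
  have hVXY' := h.mem_mul_one hVX hY
  have e1 := S.Γ_tensor_right hp A V.obj X V.mem hX hVX
  have e2 := S.Γ_tensor_right hp A (V.obj ⊗ X) Y hVX hY hVXY'
  have e3 := S.Γ_tensor_right hp A V.obj (X ⊗ Y) V.mem hXY hVXY
  -- The two bracketings of $V\otimes X\otimes Y$ are compared: one involves $\gamma_X$ and then
  -- $\gamma_Y$, the other $\gamma_{X\otimes Y}$.
  have e4 := S.Γ_naturality hp A hVXY' hVXY (α_ _ _ _).hom
  rw [e2, e3, e1] at e4
  rw [← cancel_epi ((α_ _ _ _).inv ≫ (S.Γ hp A V.obj V.mem).hom ▷ (X ⊗ Y) ≫ (α_ _ _ _).hom),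
    ← cancel_mono (α_ _ _ _).inv, ← cancel_epi (A.X ◁ (α_ _ _ _).hom)]
  simp only [Category.assoc] at e4 ⊢
  rw [e4]
  monoidal

/-- The object `(E, γ)` of the `G`-center determined by a splitting. -/
noncomputable def obj (A : GCenter 𝒞) : GCenter 𝒞 where
  X := S.E A
  hb :=
    { β := fun X hX =>
        haveI := S.isIso_braid hns.pure A X hX
        asIso (S.braid A X hX)
      monoidal := fun X Y hX hY hXY => S.braid_tensor hns.pure A X Y hX hY hXY
      naturality := fun hX hY f => S.braid_naturality hns.pure A hX hY f }

/-- The transfer from `A` to the image of a splitting. -/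
noncomputable def transfer (A : GCenter 𝒞) : Transfer α A (S.obj hns A) where
  Γ := S.Γ hns.pure A
  naturality := S.Γ_naturality hns.pure A
  tensor_left := S.Γ_tensor_left hns.pure A
  tensor_right := S.Γ_tensor_right hns.pure A

/-- Since $\Gamma$ followed by $q$ is `crossOver`, which is natural in $A$, the explicit formula for
$\varphi_V(f)$ has the property defining the induced morphism. -/
theorem Γ_map (hp : IsPure C) {A B : GCenter 𝒞} (f : A ⟶ B) (X : C) (hX : 𝒞 α X) :
    (S.Γ hp A X hX).hom ≫ X ◁ (S.q A ≫ (P.dual V.obj ◁ f.f) ▷ V.obj ≫ S.p B) =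
      f.f ▷ X ≫ (S.Γ hp B X hX).hom := by
  rw [MonoidalCategory.whiskerLeft_comp, reassoc_of% (S.Γ_hom_q hp A X hX),
    MonoidalCategory.whiskerLeft_comp, ← reassoc_of% (crossOver_naturality_left f X V.obj
      (h.mem_one hX V.mem))]
  rfl

/-- An arbitrary $g$ replaces $p_{A\otimes B}$, whose source is typed by the tensor product of the
$G$-center, so that the coherence computation only sees objects of $\mathcal C$. -/
theorem Γ_tensor_comp (hp : IsPure C) (A B : GCenter 𝒞) (X : C) (hX : 𝒞 α X) {Z : C}
    (g : P.conj V.obj (A.X ⊗ B.X) ⟶ Z) :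
    ((α_ _ _ _).hom ≫ A.X ◁ (S.Γ hp B X hX).hom ≫ (α_ _ _ _).inv ≫
      (S.Γ hp A X hX).hom ▷ S.E B ≫ (α_ _ _ _).hom) ≫
      X ◁ ((S.q A ⊗ₘ S.q B) ⊗≫ (P.dual V.obj ⊗ A.X) ◁ (P.ev' V.obj ▷ (B.X ⊗ V.obj)) ⊗≫
        𝟙 (P.conj V.obj (A.X ⊗ B.X)) ≫ g) =
      ((α_ _ _ _).hom ≫ A.X ◁ ((S.Γ hp B X hX).hom ≫ X ◁ S.q B) ≫ (α_ _ _ _).inv ≫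
        ((S.Γ hp A X hX).hom ≫ X ◁ S.q A) ▷ P.conj V.obj B.X ≫ (α_ _ _ _).hom ≫
        X ◁ (𝟙 _ ⊗≫ (P.dual V.obj ⊗ A.X) ◁ (P.ev' V.obj ▷ (B.X ⊗ V.obj)) ⊗≫
          𝟙 (P.conj V.obj (A.X ⊗ B.X)))) ≫ X ◁ g := by
  rw [MonoidalCategory.tensorHom_def]
  calc
    _ = 𝟙 ((A.X ⊗ B.X) ⊗ X) ⊗≫ A.X ◁ (S.Γ hp B X hX).hom ⊗≫ (S.Γ hp A X hX).hom ▷ S.E B ⊗≫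
      X ◁ (S.q A ▷ S.E B ≫ P.conj V.obj A.X ◁ S.q B) ⊗≫
      X ◁ ((P.dual V.obj ⊗ A.X) ◁ (P.ev' V.obj ▷ (B.X ⊗ V.obj))) ⊗≫ X ◁ g := by
      monoidal
    _ = 𝟙 ((A.X ⊗ B.X) ⊗ X) ⊗≫ A.X ◁ (S.Γ hp B X hX).hom ⊗≫
      ((S.Γ hp A X hX).hom ▷ S.E B ≫ (X ⊗ S.E A) ◁ S.q B) ⊗≫ X ◁ S.q A ▷ P.conj V.obj B.X ⊗≫
      X ◁ ((P.dual V.obj ⊗ A.X) ◁ (P.ev' V.obj ▷ (B.X ⊗ V.obj))) ⊗≫ X ◁ g := by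
      rw [← whisker_exchange]; monoidal
    _ = _ := by rw [← whisker_exchange]; monoidal

theorem Γ_tensor (hp : IsPure C) (A B : GCenter 𝒞) (X : C) (hX : 𝒞 α X) :
    ((α_ _ _ _).hom ≫ A.X ◁ (S.Γ hp B X hX).hom ≫ (α_ _ _ _).inv ≫
      (S.Γ hp A X hX).hom ▷ S.E B ≫ (α_ _ _ _).hom) ≫
      X ◁ ((S.q A ⊗ₘ S.q B) ⊗≫ (P.dual V.obj ⊗ A.X) ◁ (P.ev' V.obj ▷ (B.X ⊗ V.obj)) ⊗≫
        𝟙 (P.conj V.obj (A.X ⊗ B.X)) ≫ S.p (A ⊗ B)) =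
      (S.Γ hp (A ⊗ B) X hX).hom := by
  refine (S.Γ_tensor_comp hp A B X hX (S.p (A ⊗ B))).trans ?_
  rw [S.Γ_hom_q hp A X hX, S.Γ_hom_q hp B X hX, ← crossOver_tensor_left]
  rfl

theorem Γ_unit (hp : IsPure C) (X : C) (hX : 𝒞 α X) :
    ((λ_ X).hom ≫ (ρ_ X).inv) ≫ X ◁ (P.coev' V.obj ⊗≫ 𝟙 (P.conj V.obj (𝟙_ C)) ≫
      S.p (𝟙_ (GCenter 𝒞))) = (S.Γ hp (𝟙_ (GCenter 𝒞)) X hX).hom := by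
  -- A general $g$ again hides that the source of $p_1$ is typed by the unit of the $G$-center.
  have e : ∀ {Z : C} (g : P.conj V.obj (𝟙_ C) ⟶ Z),
      ((λ_ X).hom ≫ (ρ_ X).inv) ≫ X ◁ (P.coev' V.obj ⊗≫ 𝟙 (P.conj V.obj (𝟙_ C)) ≫ g) =
      ((λ_ X).hom ≫ (ρ_ X).inv ≫ X ◁ (P.coev' V.obj ⊗≫ 𝟙 (P.conj V.obj (𝟙_ C)))) ≫ X ◁ g := by
    intro Z g; monoidal
  refine (e (S.p (𝟙_ (GCenter 𝒞)))).trans ?_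
  rw [← crossOver_unit X V.obj (h.mem_one hX V.mem)]
  rfl

/-- The functor `φ_V` determined by a choice of splittings. -/
noncomputable def splittingFunctor : SplittingFunctor h V where
  functor := Transfer.functor h hns (S.transfer hns)
  monoidal := inferInstance
  p := S.p
  q := S.q
  p_q := S.p_q
  q_p := S.q_p
  halfBraiding _ _ _ := rfl
  map f := Transfer.Intertwines.ext hns (Transfer.functor_map h hns (S.transfer hns) f)
    (S.Γ_map hns.pure f)
  tensor A B := Transfer.Intertwines.ext hns ((Transfer.transport h hns (S.transfer hns)).tensor A B)
    fun X hX => (S.Γ_tensor hns.pure A B X hX).trans (by simp; rfl)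
  unit := Transfer.Intertwines.ext hns (Transfer.transport h hns (S.transfer hns)).unit
    fun X hX => (S.Γ_unit hns.pure X hX).trans (by simp; rfl)
  mem hA := S.mem hA

theorem exists_splittingFunctor (hns : IsNonsingular P 𝒞) :
    ∃ F : SplittingFunctor h V, F.choice = S :=
  ⟨S.splittingFunctor hns, rfl⟩

end SplittingChoice

namespace SplittingFunctor

variable {α : G} {V : InvObj P 𝒞 α} (Φ : SplittingFunctor h V) (hns : IsNonsingular P 𝒞)

/-- The transport underlying `φ_V`. -/
noncomputable def transport : Transport α Φ.functor where
  transfer A :=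
    { Γ := Φ.choice.Γ hns.pure A
      naturality := Φ.choice.Γ_naturality hns.pure A
      tensor_left := Φ.choice.Γ_tensor_left hns.pure A
      tensor_right := fun X Y hX hY hXY => by
        rw [Φ.halfBraiding]
        exact Φ.choice.Γ_tensor_right hns.pure A X Y hX hY hXY }
  map f X hX := by
    rw [Φ.map]
    exact Φ.choice.Γ_map hns.pure f X hX
  tensor A B X hX := by
    rw [Φ.tensor]
    exact (Φ.choice.Γ_tensor hns.pure A B X hX).trans (by simp; rfl)
  unit X hX := by
    rw [Φ.unit]
    exact (Φ.choice.Γ_unit hns.pure X hX).trans (by simp; rfl)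

theorem transport_Γ_hom (A : GCenter 𝒞) (X : C) (hX : 𝒞 α X) :
    (((Φ.transport hns).transfer A).Γ X hX).hom = gammaMor Φ A X hX := rfl

theorem gammaMor_q (hns : IsNonsingular P 𝒞) (A : GCenter 𝒞) (X : C) (hX : 𝒞 α X) :
    gammaMor Φ A X hX ≫ X ◁ Φ.q A = crossOver P A X V.obj (h.mem_one hX V.mem) :=
  Φ.choice.Γ_hom_q hns.pure A X hX

end SplittingFunctor

end SplittingTransport

/-! ### The morphisms $\delta$, $\eta$ and $\zeta$ as comparisons of transfers -/

section Structure

variable {G : Type w} [Group G] {C : Type u} [Category.{v} C] [MonoidalCategory C]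
  {P : PivotalStructure C} {𝒞 : G → ObjectProperty C}

/-- `g` identifies the composite of the transfers `s` and `t` with `r`. -/
def Transfer.Composes {α β : G} {A B D E : GCenter 𝒞} (s : Transfer β A B) (t : Transfer α B D)
    (r : Transfer (β * α) A E) (g : D.X ⟶ E.X) : Prop :=
  ∀ (X Y : C) (hX : 𝒞 β X) (hY : 𝒞 α Y) (hXY : 𝒞 (β * α) (X ⊗ Y)),
    (α_ _ _ _).hom ≫ (r.Γ (X ⊗ Y) hXY).hom =
      (s.Γ X hX).hom ▷ Y ≫ (α_ _ _ _).hom ≫ X ◁ (t.Γ Y hY).hom ≫ (α_ _ _ _).inv ≫ (X ⊗ Y) ◁ g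

variable [Preadditive C] {h : IsPivotalGGraded P 𝒞} (hns : IsNonsingular P 𝒞)

/-- Precomposed with $\Gamma^V$, the morphism $\delta^{U,V}$ starts with a crossing over $V$ and
immediately undoes it; the resulting $d_V$ cancels and $\Gamma^U$ is left. -/
theorem deltaMor_intertwines {α : G} {U V : InvObj P 𝒞 α} (ΦU : SplittingFunctor h U)
    (ΦV : SplittingFunctor h V) (A : GCenter 𝒞) :
    ((ΦV.transport hns).transfer A).Intertwines ((ΦU.transport hns).transfer A) (𝟙 A)
      (deltaMor ΦU ΦV A) := fun X hX => by
  rw [SplittingFunctor.transport_Γ_hom, SplittingFunctor.transport_Γ_hom, deltaMor,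
    MonoidalCategory.whiskerLeft_comp, hns.pure.whiskerLeft_unitScalar,
    ← unitScalar_naturality_assoc]
  have L := crossBack_crossOver_self h A V.mem U.mem (h.mem_one hX V.mem) (h.mem_one V.mem U.mem)
    (h.mem_one hX U.mem)
  have e1 := crossOver_crossBack hns.pure A X V.obj (h.mem_one hX V.mem)
  calc
    _ = unitScalar V.dimInv _ ≫ (gammaMor ΦV A X hX ≫ X ◁ ΦV.q A) ≫
        X ◁ (𝟙 _ ⊗≫ P.dual V.obj ◁ crossOver P A V.obj U.obj (h.mem_one V.mem U.mem) ⊗≫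
        P.ev V.obj ▷ P.conj U.obj A.X ⊗≫ 𝟙 (P.conj U.obj A.X)) ≫ X ◁ ΦU.p A := by
      congr 1; monoidal
    _ = _ := by
      rw [L, ΦV.gammaMor_q hns, gammaMor, RelCenter.id_f, id_whiskerRight, Category.id_comp,
        Category.assoc, reassoc_of% e1, reassoc_of% (V.unitScalar_dimInv_dim (A.X ⊗ X))]

/-- Multiplicativity of $\sigma$ at $X\otimes U^*$ splits the crossing in $\Gamma^U_{A,X}$ into
$\sigma_X$ and the crossing in $\eta^U$. -/
theorem etaMor_intertwines {U : InvObj P 𝒞 1} (ΦU : SplittingFunctor h U) (A : GCenter 𝒞) :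
    (Transfer.ofHalfBraiding A).Intertwines ((ΦU.transport hns).transfer A) (𝟙 A)
      (etaMor ΦU A) := fun X hX => by
  rw [SplittingFunctor.transport_Γ_hom, etaMor, RelCenter.id_f, id_whiskerRight, Category.id_comp,
    gammaMor, crossOver, A.hb.monoidal X (P.dual U.obj) hX (h.dual_mem_one U.mem)]
  change (A.hb.β X hX).hom ≫ _ = _
  symm
  calc
    _ = 𝟙 _ ⊗≫ ((A.X ⊗ X) ◁ P.coev' U.obj ≫ (A.hb.β X hX).hom ▷ _) ⊗≫
          X ◁ (A.hb.β (P.dual U.obj) (h.dual_mem_one U.mem)).hom ▷ U.obj ⊗≫ X ◁ ΦU.p A := by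
      monoidal
    _ = _ := by rw [whisker_exchange]; monoidal

/-- The crossing of $\varphi_V(A)$ over $Y\otimes U^*$ and $\Gamma^V_{A,X}$ combine to $\Gamma^V_A$
at $X\otimes Y\otimes U^*$. Then $V$ and $U$ close up to loops, cancelled by $d_U^{-1}d_V^{-1}$, and
$\Gamma^W_A$ at $X\otimes Y$ remains. -/
theorem zetaMor_composes {α β : G} {U : InvObj P 𝒞 α} {V : InvObj P 𝒞 β}
    {W : InvObj P 𝒞 (β * α)} (ΦU : SplittingFunctor h U) (ΦV : SplittingFunctor h V)
    (ΦW : SplittingFunctor h W) (A : GCenter 𝒞) :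
    ((ΦV.transport hns).transfer A).Composes ((ΦU.transport hns).transfer (ΦV.functor.obj A))
      ((ΦW.transport hns).transfer A) (zetaMor ΦU ΦV ΦW A) := fun X Y hX hY hXY => by
  have hp := hns.pure
  have hYU := h.mem_one hY U.mem
  have hXYU := h.mem_mul_one hX hYU
  -- Here `e1` absorbs the half braiding of $\varphi_V(A)$ into $\Gamma^V$, `e4` and `e2` turn the
  -- $V$-strand into a loop, and `e3` slides $\mathrm{ev}_U$ through the crossing over $W$.
  have e1 := ((ΦV.transport hns).transfer A).tensor_right X (Y ⊗ P.dual U.obj) hX hYU hXYU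
  have hVU := h.tensor_mem V.mem U.mem
  have hZ : 𝒞 (β * α) ((X ⊗ Y ⊗ P.dual U.obj) ⊗ U.obj) := h.tensor_mem hXYU U.mem
  have L := crossBack_crossOver h (W := W.obj) A hVU W.mem (h.mem_one hXYU V.mem)
    (h.mem_one hVU W.mem) (h.mem_one hZ W.mem)
  have L' : 𝟙 (((X ⊗ Y ⊗ P.dual U.obj) ⊗ P.conj V.obj A.X) ⊗ U.obj) ⊗≫
      ((X ⊗ Y ⊗ P.dual U.obj) ⊗ P.dual V.obj) ◁ crossOver P A (V.obj ⊗ U.obj) W.obj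
        (h.mem_one hVU W.mem) ⊗≫
      ((X ⊗ Y ⊗ P.dual U.obj) ◁ P.ev V.obj) ▷ (U.obj ⊗ P.conj W.obj A.X) ⊗≫
      𝟙 (((X ⊗ Y ⊗ P.dual U.obj) ⊗ U.obj) ⊗ P.conj W.obj A.X) = _ :=
    Eq.trans (by monoidal) L
  have e2 := crossOver_crossBack hp A _ V.obj (h.mem_one hXYU V.mem)
  have e3 := crossOver_naturality A W.obj (h.mem_one hZ W.mem) (h.mem_one hXY W.mem)
    (𝟙 ((X ⊗ Y ⊗ P.dual U.obj) ⊗ U.obj) ⊗≫ (X ⊗ Y) ◁ P.ev U.obj ⊗≫ 𝟙 (X ⊗ Y))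
  have e4 := ΦV.gammaMor_q hns A _ hXYU
  simp only [SplittingFunctor.transport_Γ_hom] at e1 ⊢
  rw [zetaMor, MonoidalCategory.whiskerLeft_comp, hp.whiskerLeft_unitScalar]
  symm
  calc
    _ = gammaMor ΦV A X hX ▷ Y ≫ (α_ _ _ _).hom ≫
        X ◁ gammaMor ΦU (ΦV.functor.obj A) Y hY ≫ (α_ _ _ _).inv ≫
        unitScalar (U.dimInv ≫ V.dimInv) _ ≫
        (𝟙 _ ⊗≫ (X ⊗ Y) ◁ ΦU.q (ΦV.functor.obj A) ⊗≫
        (X ⊗ Y ⊗ P.dual U.obj) ◁ ΦV.q A ▷ U.obj ⊗≫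
        (𝟙 (((X ⊗ Y ⊗ P.dual U.obj) ⊗ P.conj V.obj A.X) ⊗ U.obj) ⊗≫
          ((X ⊗ Y ⊗ P.dual U.obj) ⊗ P.dual V.obj) ◁ crossOver P A (V.obj ⊗ U.obj) W.obj
          (h.mem_one hVU W.mem) ⊗≫ ((X ⊗ Y ⊗ P.dual U.obj) ◁ P.ev V.obj) ▷ (U.obj ⊗ P.conj W.obj A.X)
          ⊗≫ 𝟙 (((X ⊗ Y ⊗ P.dual U.obj) ⊗ U.obj) ⊗ P.conj W.obj A.X)) ⊗≫
        (X ⊗ Y) ◁ P.ev U.obj ▷ P.conj W.obj A.X ⊗≫ (X ⊗ Y) ◁ ΦW.p A) := by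
      congr 5; monoidal
    _ = unitScalar (U.dimInv ≫ V.dimInv) _ ≫
        (gammaMor ΦV A X hX ▷ Y ⊗≫
        X ◁ (gammaMor ΦU (ΦV.functor.obj A) Y hY ≫ Y ◁ ΦU.q (ΦV.functor.obj A)) ⊗≫
        (X ⊗ Y ⊗ P.dual U.obj) ◁ ΦV.q A ▷ U.obj ⊗≫
        crossBack P A (X ⊗ Y ⊗ P.dual U.obj) V.obj (h.mem_one hXYU V.mem) ▷ U.obj ⊗≫
        (crossOver P A ((X ⊗ Y ⊗ P.dual U.obj) ⊗ U.obj) W.obj (h.mem_one hZ W.mem) ≫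
          (𝟙 ((X ⊗ Y ⊗ P.dual U.obj) ⊗ U.obj) ⊗≫ (X ⊗ Y) ◁ P.ev U.obj ⊗≫ 𝟙 (X ⊗ Y)) ▷
            P.conj W.obj A.X) ⊗≫ (X ⊗ Y) ◁ ΦW.p A) := by
      rw [L', ← unitScalar_naturality_assoc, ← unitScalar_naturality_assoc,
        ← unitScalar_naturality_assoc, ← unitScalar_naturality_assoc]
      congr 1
      monoidal
    _ = unitScalar (U.dimInv ≫ V.dimInv) _ ≫
        (𝟙 _ ⊗≫ (gammaMor ΦV A X hX ▷ (Y ⊗ 𝟙_ C) ≫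
          (X ⊗ (ΦV.functor.obj A).X) ◁ (Y ◁ P.coev' U.obj)) ⊗≫
        X ◁ ((ΦV.functor.obj A).hb.β (Y ⊗ P.dual U.obj) hYU).hom ▷ U.obj ⊗≫
        (X ⊗ Y ⊗ P.dual U.obj) ◁ ΦV.q A ▷ U.obj ⊗≫
        crossBack P A (X ⊗ Y ⊗ P.dual U.obj) V.obj (h.mem_one hXYU V.mem) ▷ U.obj ⊗≫
        A.X ◁ (X ⊗ Y) ◁ P.ev U.obj ⊗≫
        crossOver P A (X ⊗ Y) W.obj (h.mem_one hXY W.mem) ≫ (X ⊗ Y) ◁ ΦW.p A) := by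
      rw [← e3, ΦU.gammaMor_q hns, crossOver]
      congr 1
      monoidal
    _ = unitScalar (U.dimInv ≫ V.dimInv) _ ≫
        (𝟙 _ ⊗≫ (A.X ⊗ X ⊗ Y) ◁ P.coev' U.obj ⊗≫
        ((gammaMor ΦV A _ hXYU ≫
        (X ⊗ Y ⊗ P.dual U.obj) ◁ ΦV.q A) ≫
        crossBack P A (X ⊗ Y ⊗ P.dual U.obj) V.obj (h.mem_one hXYU V.mem)) ▷ U.obj ⊗≫
        A.X ◁ (X ⊗ Y) ◁ P.ev U.obj ⊗≫
        crossOver P A (X ⊗ Y) W.obj (h.mem_one hXY W.mem) ≫ (X ⊗ Y) ◁ ΦW.p A) := by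
      rw [← whisker_exchange, e1]
      congr 1
      monoidal
    -- The crossing over $V$ has been undone, leaving $d_V$; the remaining pair
    -- $\widetilde{\mathrm{coev}}_U$, $\mathrm{ev}_U$ is about to form the loop $d_U$.
    _ = unitScalar (U.dimInv ≫ V.dimInv) ((A.X ⊗ X) ⊗ Y) ≫
        (𝟙 ((A.X ⊗ X) ⊗ Y) ⊗≫ (A.X ⊗ X ⊗ Y) ◁ P.coev' U.obj ⊗≫
          𝟙 ((A.X ⊗ X ⊗ Y ⊗ P.dual U.obj) ⊗ U.obj)) ≫
        unitScalar (P.dimLeft V.obj) _ ≫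
        (𝟙 ((A.X ⊗ X ⊗ Y ⊗ P.dual U.obj) ⊗ U.obj) ⊗≫ A.X ◁ (X ⊗ Y) ◁ P.ev U.obj ⊗≫
        crossOver P A (X ⊗ Y) W.obj (h.mem_one hXY W.mem) ≫ (X ⊗ Y) ◁ ΦW.p A) := by
      rw [e4, e2, unitScalar_whiskerRight]
      congr 1
      monoidal
    _ = unitScalar (U.dimInv ≫ V.dimInv) ((A.X ⊗ X) ⊗ Y) ≫
        unitScalar (P.dimLeft V.obj) ((A.X ⊗ X) ⊗ Y) ≫
        ((ρ_ ((A.X ⊗ X) ⊗ Y)).inv ≫ ((A.X ⊗ X) ⊗ Y) ◁ P.dimLeft U.obj ≫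
          (ρ_ ((A.X ⊗ X) ⊗ Y)).hom) ≫ (α_ _ _ _).hom ≫ gammaMor ΦW A (X ⊗ Y) hXY := by
      rw [← unitScalar_naturality_assoc, PivotalStructure.dimLeft, PivotalStructure.dimLeft,
        gammaMor]
      congr 2
      monoidal
    _ = _ := by
      rw [← hp, unitScalar_comp, Category.assoc,
        reassoc_of% (V.unitScalar_dimInv_dim ((A.X ⊗ X) ⊗ Y)),
        reassoc_of% (U.unitScalar_dimInv_dim ((A.X ⊗ X) ⊗ Y))]

end Structure

/-! ### Composition of transfers and descent in two variables -/

section Composition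

variable {G : Type w} [Group G] {C : Type u} [Category.{v} C] [MonoidalCategory C]
  {P : PivotalStructure C} {𝒞 : G → ObjectProperty C}

namespace Transfer

/-- Transfers along an equality of degrees. -/
def cast {α β : G} (e : α = β) {A B : GCenter 𝒞} (t : Transfer α A B) : Transfer β A B := e ▸ t

theorem cast_Γ {α β : G} (e : α = β) {A B : GCenter 𝒞} (t : Transfer α A B) (X : C)
    (hX : 𝒞 β X) : (t.cast e).Γ X hX = t.Γ X (e ▸ hX) := by
  subst e; rfl

section

variable {α β : G} {A B D E : GCenter 𝒞}

/-- The left and right compatibility axioms of a transfer say that half braidings are neutral for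
composition; the unit axioms of $\varphi_2$ come from this. -/
theorem composes_ofHalfBraiding_left (t : Transfer α A B) :
    (ofHalfBraiding A).Composes t (t.cast (one_mul α).symm) (𝟙 B.X) := fun X Y hX hY hXY => by
  rw [cast_Γ, t.tensor_left X Y hX hY (by simpa using hXY)]
  simp [ofHalfBraiding]

theorem composes_ofHalfBraiding_right (t : Transfer α A B) :
    t.Composes (ofHalfBraiding B) (t.cast (mul_one α).symm) (𝟙 B.X) := fun X Y hX hY hXY => by
  rw [cast_Γ, t.tensor_right X Y hX hY (by simpa using hXY)]
  simp [ofHalfBraiding]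

variable {s : Transfer β A B} {t : Transfer α B D} {r : Transfer (β * α) A E}

theorem Composes.tensor {A' B' D' E' : GCenter 𝒞} {s' : Transfer β A' B'} {t' : Transfer α B' D'}
    {r' : Transfer (β * α) A' E'} {g : D.X ⟶ E.X} {g' : D'.X ⟶ E'.X} (H : s.Composes t r g)
    (H' : s'.Composes t' r' g') :
    (s.tensor s').Composes (t.tensor t') (r.tensor r') (g ⊗ₘ g') := fun X Y hX hY hXY => by
  change (α_ (A.X ⊗ A'.X) X Y).hom ≫ (tensorΓ r r' (X ⊗ Y) hXY).hom =
    (tensorΓ s s' X hX).hom ▷ Y ≫ (α_ X (B.X ⊗ B'.X) Y).hom ≫ X ◁ (tensorΓ t t' Y hY).hom ≫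
      (α_ X Y (D.X ⊗ D'.X)).inv ≫ (X ⊗ Y) ◁ (g ⊗ₘ g')
  rw [tensorΓ_hom, tensorΓ_hom, tensorΓ_hom, MonoidalCategory.tensorHom_def]
  have e := H X Y hX hY hXY
  have e' := H' X Y hX hY hXY
  rw [← Iso.eq_inv_comp] at e e'
  rw [e, e']
  calc
    _ = 𝟙 _ ⊗≫ A.X ◁ (s'.Γ X hX).hom ▷ Y ⊗≫ (A.X ⊗ X) ◁ (t'.Γ Y hY).hom ⊗≫
          ((A.X ⊗ X ⊗ Y) ◁ g' ≫ (𝟙 _ ⊗≫ (s.Γ X hX).hom ▷ Y ⊗≫ X ◁ (t.Γ Y hY).hom ⊗≫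
            (X ⊗ Y) ◁ g) ▷ E'.X) ⊗≫ 𝟙 _ := by monoidal
    _ = 𝟙 _ ⊗≫ A.X ◁ (s'.Γ X hX).hom ▷ Y ⊗≫ ((A.X ⊗ X) ◁ (t'.Γ Y hY).hom ≫
            (s.Γ X hX).hom ▷ (Y ⊗ D'.X)) ⊗≫ X ◁ (t.Γ Y hY).hom ▷ D'.X ⊗≫
            (X ⊗ Y) ◁ g ▷ D'.X ⊗≫ (X ⊗ Y) ◁ E.X ◁ g' ⊗≫ 𝟙 _ := by
      rw [whisker_exchange]; monoidal
    _ = _ := by rw [whisker_exchange]; monoidal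

theorem composes_unit (α β : G) :
    (unit β : Transfer β (𝟙_ (GCenter 𝒞)) _).Composes (unit α) (unit (β * α)) (𝟙 (𝟙_ C)) :=
  fun X Y hX hY hXY => by
    change (α_ (𝟙_ C) X Y).hom ≫ (λ_ (X ⊗ Y)).hom ≫ (ρ_ (X ⊗ Y)).inv =
      ((λ_ X).hom ≫ (ρ_ X).inv) ▷ Y ≫ (α_ X (𝟙_ C) Y).hom ≫ X ◁ ((λ_ Y).hom ≫ (ρ_ Y).inv) ≫
        (α_ X Y (𝟙_ C)).inv ≫ (X ⊗ Y) ◁ (𝟙 (𝟙_ C))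
    monoidal

end

section Composite

variable {α β : G} {A B D : GCenter 𝒞} (s : Transfer β A B) (t : Transfer α B D)

/-- The composite of two transfers. -/
def compIso (X Y : C) (hX : 𝒞 β X) (hY : 𝒞 α Y) : (A.X ⊗ X) ⊗ Y ≅ X ⊗ Y ⊗ D.X :=
  whiskerRightIso (s.Γ X hX) Y ≪≫ α_ _ _ _ ≪≫ whiskerLeftIso X (t.Γ Y hY)

theorem compIso_hom (X Y : C) (hX : 𝒞 β X) (hY : 𝒞 α Y) :
    (compIso s t X Y hX hY).hom = (s.Γ X hX).hom ▷ Y ≫ (α_ _ _ _).hom ≫ X ◁ (t.Γ Y hY).hom := rfl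

theorem compIso_naturality_left {X X' : C} (Y : C) (hX : 𝒞 β X) (hX' : 𝒞 β X') (hY : 𝒞 α Y)
    (f : X ⟶ X') :
    (A.X ◁ f) ▷ Y ≫ (compIso s t X' Y hX' hY).hom =
      (compIso s t X Y hX hY).hom ≫ f ▷ (Y ⊗ D.X) := by
  rw [compIso_hom, compIso_hom]
  calc
    _ = (A.X ◁ f ≫ (s.Γ X' hX').hom) ▷ Y ⊗≫ X' ◁ (t.Γ Y hY).hom := by monoidal
    _ = 𝟙 _ ⊗≫ (s.Γ X hX).hom ▷ Y ⊗≫ (f ▷ (B.X ⊗ Y) ≫ X' ◁ (t.Γ Y hY).hom) := by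
      rw [s.naturality hX hX']; monoidal
    _ = _ := by rw [← whisker_exchange]; monoidal

theorem compIso_naturality_right (X : C) {Y Y' : C} (hX : 𝒞 β X) (hY : 𝒞 α Y) (hY' : 𝒞 α Y')
    (f : Y ⟶ Y') :
    (A.X ⊗ X) ◁ f ≫ (compIso s t X Y' hX hY').hom =
      (compIso s t X Y hX hY).hom ≫ X ◁ f ▷ D.X := by
  rw [compIso_hom, compIso_hom]
  calc
    _ = ((A.X ⊗ X) ◁ f ≫ (s.Γ X hX).hom ▷ Y') ⊗≫ X ◁ (t.Γ Y' hY').hom := by monoidal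
    _ = 𝟙 _ ⊗≫ (s.Γ X hX).hom ▷ Y ⊗≫ X ◁ (B.X ◁ f ≫ (t.Γ Y' hY').hom) := by
      rw [whisker_exchange]; monoidal
    _ = _ := by rw [t.naturality hY hY']; monoidal

theorem compIso_tensor_left (Z X Y : C) (hZ : 𝒞 1 Z) (hX : 𝒞 β X) (hY : 𝒞 α Y)
    (hZX : 𝒞 β (Z ⊗ X)) :
    (compIso s t (Z ⊗ X) Y hZX hY).hom = (α_ _ _ _).inv ▷ Y ≫ (A.hb.β Z hZ).hom ▷ X ▷ Y ≫
      (α_ _ _ _).hom ▷ Y ≫ (α_ _ _ _).hom ≫ Z ◁ (compIso s t X Y hX hY).hom ≫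
      (α_ _ _ _).inv := by
  rw [compIso_hom, compIso_hom, s.tensor_left Z X hZ hX hZX]
  monoidal

theorem compIso_tensor_middle (X Z Y : C) (hX : 𝒞 β X) (hZ : 𝒞 1 Z) (hY : 𝒞 α Y)
    (hZY : 𝒞 α (Z ⊗ Y)) (hXZ : 𝒞 β (X ⊗ Z)) :
    (compIso s t X (Z ⊗ Y) hX hZY).hom = (α_ _ _ _).inv ≫ (α_ _ _ _).hom ▷ Y ≫
      (compIso s t (X ⊗ Z) Y hXZ hY).hom ≫ (α_ _ _ _).hom ≫ X ◁ (α_ _ _ _).inv := by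
  rw [compIso_hom, compIso_hom, s.tensor_right X Z hX hZ hXZ, t.tensor_left Z Y hZ hY hZY]
  monoidal

theorem compIso_tensor_right (X Y Z : C) (hX : 𝒞 β X) (hY : 𝒞 α Y) (hZ : 𝒞 1 Z)
    (hYZ : 𝒞 α (Y ⊗ Z)) :
    (compIso s t X (Y ⊗ Z) hX hYZ).hom = (α_ _ _ _).inv ≫
      (compIso s t X Y hX hY).hom ▷ Z ≫ (α_ _ _ _).hom ≫ X ◁ (α_ _ _ _).hom ≫
      X ◁ Y ◁ (D.hb.β Z hZ).hom ≫ X ◁ (α_ _ _ _).inv := by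
  rw [compIso_hom, compIso_hom, t.tensor_right Y Z hY hZ hYZ]
  monoidal

end Composite

variable [Preadditive C]

variable {α β : G} {A B D E : GCenter 𝒞}

/-- On $X\otimes Y$ both sides are computed from the transfers $r$ and $r'$ of product degree. This
yields the naturality and monoidality of $\varphi_2$, its unit axioms, and its comparison with
$\zeta$. -/
theorem Composes.naturality (h : IsPivotalGGraded P 𝒞) (hns : IsNonsingular P 𝒞)
    {s : Transfer β A B} {t : Transfer α B D} {r : Transfer (β * α) A E}
    {A' B' D' E' : GCenter 𝒞} {s' : Transfer β A' B'} {t' : Transfer α B' D'}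
    {r' : Transfer (β * α) A' E'} {g : D.X ⟶ E.X} {g' : D'.X ⟶ E'.X} (H : s.Composes t r g)
    (H' : s'.Composes t' r' g') {f : A ⟶ A'} {b : B ⟶ B'} {d : D.X ⟶ D'.X} {e : E.X ⟶ E'.X}
    (hs : s.Intertwines s' f b.f) (ht : t.Intertwines t' b d) (hr : r.Intertwines r' f e) :
    d ≫ g' = g ≫ e :=
  hns.whiskerLeft_tensor_ext β α fun X Y hX hY => by
    have hXY := h.tensor_mem hX hY
    rw [← cancel_epi ((s.Γ X hX).hom ▷ Y ≫ (α_ _ _ _).hom ≫ X ◁ (t.Γ Y hY).hom ≫ (α_ _ _ _).inv)]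
    calc
      _ = 𝟙 _ ⊗≫ (s.Γ X hX).hom ▷ Y ⊗≫ X ◁ ((t.Γ Y hY).hom ≫ Y ◁ d) ⊗≫ (X ⊗ Y) ◁ g' := by
        monoidal
      _ = 𝟙 _ ⊗≫ ((s.Γ X hX).hom ≫ X ◁ b.f) ▷ Y ⊗≫ X ◁ ((t'.Γ Y hY).hom) ⊗≫ (X ⊗ Y) ◁ g' := by
        rw [ht Y hY]; monoidal
      _ = (f.f ▷ X ▷ Y) ≫ ((s'.Γ X hX).hom ▷ Y ≫ (α_ _ _ _).hom ≫ X ◁ (t'.Γ Y hY).hom ≫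
            (α_ _ _ _).inv ≫ (X ⊗ Y) ◁ g') := by
        rw [hs X hX]; monoidal
      _ = (α_ _ _ _).hom ≫ f.f ▷ (X ⊗ Y) ≫ (r'.Γ _ hXY).hom := by
        rw [← H' X Y hX hY hXY]; monoidal
      _ = ((α_ _ _ _).hom ≫ (r.Γ _ hXY).hom) ≫ (X ⊗ Y) ◁ e := by
        rw [← hr _ hXY, Category.assoc]
      _ = _ := by rw [H X Y hX hY hXY]; monoidal

/-- Both sides are determined on triple products $X\otimes Y\otimes Z$, where the transfers of total
degree at the two bracketings are related by naturality along the associator; $e$ bridges the equal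
but distinct degrees. -/
theorem Composes.assoc (h : IsPivotalGGraded P 𝒞) (hns : IsNonsingular P 𝒞) {γ : G}
    {K L M M' N : GCenter 𝒞}
    {s : Transfer γ A B} {t : Transfer β B D} {u : Transfer α D E} {r₁ : Transfer (γ * β) A K}
    {g₁ : D ⟶ K} (H₁ : s.Composes t r₁ g₁.f) {u' : Transfer α K L} {d : E.X ⟶ L.X}
    (hd : u.Intertwines u' g₁ d) {w : Transfer (γ * β * α) A M} {g₂ : L.X ⟶ M.X}
    (H₂ : r₁.Composes u' w g₂) {r₂ : Transfer (β * α) B N} {g₃ : E.X ⟶ N.X}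
    (H₃ : t.Composes u r₂ g₃) {w' : Transfer (γ * (β * α)) A M'} {g₄ : N.X ⟶ M'.X}
    (H₄ : s.Composes r₂ w' g₄) {e : M'.X ⟶ M.X}
    (he : (w'.cast (mul_assoc γ β α).symm).Intertwines w (𝟙 A) e) :
    d ≫ g₂ = g₃ ≫ g₄ ≫ e :=
  hns.whiskerLeft_ext α fun Z hZ => hns.whiskerLeft_tensor_ext γ β fun X Y hX hY => by
    have hXY := h.tensor_mem hX hY
    have hYZ := h.tensor_mem hY hZ
    have hXYZ := h.tensor_mem hXY hZ
    have hXYZ' : 𝒞 (γ * β * α) (X ⊗ Y ⊗ Z) := by simpa [mul_assoc] using h.tensor_mem hX hYZ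
    rw [← cancel_epi ((s.Γ X hX).hom ▷ Y ▷ Z ≫ (α_ _ _ _).hom ▷ Z ≫
      (X ◁ (t.Γ Y hY).hom) ▷ Z ≫ (α_ _ _ _).inv ▷ Z ≫ (α_ _ _ _).hom ≫ (X ⊗ Y) ◁ (u.Γ Z hZ).hom)]
    have e1 := H₁ X Y hX hY hXY
    have e2 := H₂ (X ⊗ Y) Z hXY hZ hXYZ
    have e3 := H₃ Y Z hY hZ hYZ
    have e4 := H₄ X (Y ⊗ Z) hX hYZ (h.tensor_mem hX hYZ)
    have e5 := he _ hXYZ'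
    have e6 := w.naturality hXYZ hXYZ' (α_ X Y Z).hom
    rw [cast_Γ, RelCenter.id_f, id_whiskerRight, Category.id_comp] at e5
    rw [← Iso.eq_inv_comp] at e1 e2 e3 e4
    calc
      _ = 𝟙 _ ⊗≫ (s.Γ X hX).hom ▷ (Y ⊗ Z) ⊗≫ X ◁ (t.Γ Y hY).hom ▷ Z ⊗≫
            (X ⊗ Y) ◁ ((u.Γ Z hZ).hom ≫ Z ◁ d) ⊗≫ (X ⊗ Y ⊗ Z) ◁ g₂ ⊗≫ 𝟙 _ := by monoidal
      _ = 𝟙 _ ⊗≫ (α_ A.X X Y).hom ▷ Z ⊗≫ (r₁.Γ _ hXY).hom ▷ Z ⊗≫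
            (X ⊗ Y) ◁ (u'.Γ Z hZ).hom ⊗≫ (X ⊗ Y ⊗ Z) ◁ g₂ ⊗≫ 𝟙 _ := by
        rw [hd Z hZ, e1]; monoidal
      _ = 𝟙 _ ⊗≫ ((w.Γ _ hXYZ).hom ≫ (α_ X Y Z).hom ▷ M.X) ⊗≫ 𝟙 _ := by rw [e2]; monoidal
      _ = 𝟙 _ ⊗≫ (w'.Γ _ (h.tensor_mem hX hYZ)).hom ⊗≫ (X ⊗ Y ⊗ Z) ◁ e ⊗≫ 𝟙 _ := by
        rw [← e6, ← e5]; monoidal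
      _ = _ := by rw [e4, e3]; monoidal

section Descent

variable (s : Transfer β A B) (t : Transfer α B D) (r : Transfer (β * α) A E)

theorem composes_iff (h : IsPivotalGGraded P 𝒞) (g : D.X ⟶ E.X) :
    s.Composes t r g ↔ ∀ (X Y : C) (hX : 𝒞 β X) (hY : 𝒞 α Y),
      (compIso s t X Y hX hY).hom ≫ X ◁ Y ◁ g =
        (α_ _ _ _).hom ≫ (r.Γ _ (h.tensor_mem hX hY)).hom ≫ (α_ _ _ _).hom := by
  refine ⟨fun H X Y hX hY => ?_, fun H X Y hX hY hXY => ?_⟩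
  · have := H X Y hX hY (h.tensor_mem hX hY)
    rw [reassoc_of% this, compIso_hom]
    simp
  · have := H X Y hX hY
    rw [compIso_hom, ← Category.assoc _ _ (α_ X Y E.X).hom, ← Iso.comp_inv_eq] at this
    rw [← this]
    simp

/-- First descent, in $X$ with $Y$ fixed: the comparison of $r$ at $X\otimes Y$ with the composite
of $s$ and $t$ is a module transformation of degree $\beta$. -/
theorem exists_whiskerLeft_descent (h : IsPivotalGGraded P 𝒞) (hns : IsNonsingular P 𝒞) (Y : C)
    (hY : 𝒞 α Y) :
    ∃ k : Y ⊗ D.X ⟶ Y ⊗ E.X, ∀ (X : C) (hX : 𝒞 β X),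
      (compIso s t X Y hX hY).hom ≫ X ◁ k =
        (α_ _ _ _).hom ≫ (r.Γ _ (h.tensor_mem hX hY)).hom ≫ (α_ _ _ _).hom := by
  obtain ⟨V⟩ := hns.nonempty_invObj β
  let T : ModuleTransformation 𝒞 β (Y ⊗ D.X) (Y ⊗ E.X) :=
    { app := fun X hX => (compIso s t X Y hX hY).inv ≫ (α_ _ _ _).hom ≫
        (r.Γ _ (h.tensor_mem hX hY)).hom ≫ (α_ _ _ _).hom
      naturality := fun {X X'} hX hX' f => by
        have e := r.naturality (h.tensor_mem hX hY) (h.tensor_mem hX' hY) (f ▷ Y)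
        rw [← cancel_epi (compIso s t X Y hX hY).hom,
          ← reassoc_of% (compIso_naturality_left s t Y hX hX' hY f), Iso.hom_inv_id_assoc,
          Category.assoc, Iso.hom_inv_id_assoc]
        calc
          _ = (α_ _ _ _).hom ≫ (A.X ◁ (f ▷ Y) ≫ (r.Γ _ (h.tensor_mem hX' hY)).hom) ≫
            (α_ _ _ _).hom := by monoidal
          _ = _ := by rw [e]; monoidal
      tensor := fun Z X hZ hX hZX => by
        have hZXY : 𝒞 (β * α) (Z ⊗ X ⊗ Y) := h.one_mul_mem hZ (h.tensor_mem hX hY)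
        have e1 := r.tensor_left Z (X ⊗ Y) hZ (h.tensor_mem hX hY) hZXY
        have e2 := r.naturality (h.tensor_mem hZX hY) hZXY (α_ _ _ _).hom
        rw [e1] at e2
        rw [← cancel_epi (compIso s t (Z ⊗ X) Y hZX hY).hom, Iso.hom_inv_id_assoc]
        rw [compIso_tensor_left s t Z X Y hZ hX hY hZX]
        symm
        calc
          _ = 𝟙 _ ⊗≫ (A.hb.β Z hZ).hom ▷ X ▷ Y ⊗≫
            Z ◁ ((compIso s t X Y hX hY).hom ≫ (compIso s t X Y hX hY).inv) ⊗≫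
            Z ◁ (r.Γ _ (h.tensor_mem hX hY)).hom ⊗≫ 𝟙 _ := by monoidal
          _ = 𝟙 _ ⊗≫ (A.X ◁ (α_ Z X Y).hom ≫ (α_ _ _ _).inv ≫ (A.hb.β Z hZ).hom ▷ (X ⊗ Y) ≫
            (α_ _ _ _).hom ≫ Z ◁ (r.Γ _ (h.tensor_mem hX hY)).hom ≫ (α_ _ _ _).inv) ⊗≫ 𝟙 _ := by
            rw [Iso.hom_inv_id]; monoidal
          _ = _ := by rw [e2]; monoidal }
  refine ⟨V.ptr (T.app V.obj V.mem), fun X hX => ?_⟩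
  rw [T.whiskerLeft_ptr h hns.pure V X hX]
  simp [T]

/-- Second descent, in $Y$. Its hypotheses are tested after tensoring with $X$ of degree $\beta$; a
factor $Z$ of degree $1$ in front of $Y$ is absorbed into $X$ (`compIso_tensor_middle`). -/
theorem exists_descent (h : IsPivotalGGraded P 𝒞) (hns : IsNonsingular P 𝒞) :
    ∃ g : D.X ⟶ E.X, s.Composes t r g := by
  obtain ⟨V⟩ := hns.nonempty_invObj α
  choose k hk using exists_whiskerLeft_descent s t r h hns
  let T : ModuleTransformation 𝒞 α D.X E.X :=
    { app := k
      naturality := fun {Y Y'} hY hY' f => hns.whiskerLeft_ext β fun X hX => by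
        have e := r.naturality (h.tensor_mem hX hY) (h.tensor_mem hX hY') (X ◁ f)
        rw [← cancel_epi (compIso s t X Y hX hY).hom, MonoidalCategory.whiskerLeft_comp,
          ← reassoc_of% (compIso_naturality_right s t X hX hY hY' f), hk Y' hY' X hX,
          MonoidalCategory.whiskerLeft_comp, reassoc_of% (hk Y hY X hX)]
        calc
          _ = (α_ _ _ _).hom ≫ (A.X ◁ (X ◁ f) ≫ (r.Γ _ (h.tensor_mem hX hY')).hom) ≫
            (α_ _ _ _).hom := by monoidal
          _ = _ := by rw [e]; monoidal
      tensor := fun Z Y hZ hY hZY => hns.whiskerLeft_ext β fun X hX => by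
        have hXZ := h.mem_mul_one hX hZ
        have e := r.naturality (h.tensor_mem hXZ hY) (h.tensor_mem hX hZY) (α_ _ _ _).hom
        rw [← cancel_epi (compIso s t X (Z ⊗ Y) hX hZY).hom, hk _ hZY X hX,
          compIso_tensor_middle s t X Z Y hX hZ hY hZY hXZ]
        symm
        calc
          _ = (α_ _ _ _).inv ≫ (α_ _ _ _).hom ▷ Y ≫ ((compIso s t (X ⊗ Z) Y hXZ hY).hom ≫
            (X ⊗ Z) ◁ k Y hY) ≫ (𝟙 _ ⊗≫ 𝟙 _) := by monoidal
          _ = 𝟙 _ ⊗≫ ((r.Γ _ (h.tensor_mem hXZ hY)).hom ≫ (α_ _ _ _).hom ▷ E.X) ⊗≫ 𝟙 _ := by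
            rw [hk Y hY _ hXZ]; monoidal
          _ = _ := by rw [← e]; monoidal }
  refine ⟨V.ptr (T.app V.obj V.mem), (composes_iff s t r h _).2 fun X Y hX hY => ?_⟩
  rw [T.whiskerLeft_ptr h hns.pure V Y hY]
  exact hk Y hY X hX

end Descent

/-- The half braidings of both targets are recorded by enlarging $Y$ to $Y\otimes U$, as in the case
of a single transfer. -/
theorem Composes.isHom (h : IsPivotalGGraded P 𝒞) (hns : IsNonsingular P 𝒞)
    {s : Transfer β A B} {t : Transfer α B D} {r : Transfer (β * α) A E} {g : D.X ⟶ E.X}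
    (H : s.Composes t r g) : RelCenter.IsHom D E g := fun U hU =>
  hns.whiskerLeft_ext α fun Y hY => hns.whiskerLeft_ext β fun X hX => by
    have H' := (composes_iff s t r h g).1 H
    have hXY := h.tensor_mem hX hY
    have hYU := h.mem_mul_one hY hU
    have e1 := H' X Y hX hY
    have e2 := H' X (Y ⊗ U) hX hYU
    have e3 := r.naturality (h.mem_mul_one hXY hU) (h.tensor_mem hX hYU) (α_ _ _ _).hom
    rw [r.tensor_right _ U hXY hU (h.mem_mul_one hXY hU)] at e3
    rw [compIso_tensor_right s t X Y U hX hY hU hYU] at e2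
    rw [← cancel_epi ((compIso s t X Y hX hY).hom ▷ U ≫ (α_ _ _ _).hom ≫ X ◁ (α_ _ _ _).hom)]
    calc
      _ = ((compIso s t X Y hX hY).hom ≫ X ◁ Y ◁ g) ▷ U ≫ (α_ _ _ _).hom ≫ X ◁ (α_ _ _ _).hom ≫
          X ◁ Y ◁ (E.hb.β U hU).hom := by monoidal
      _ = 𝟙 _ ⊗≫ (((α_ _ _ _).inv ≫ (r.Γ _ hXY).hom ▷ U ≫ (α_ _ _ _).hom ≫
          (X ⊗ Y) ◁ (E.hb.β U hU).hom ≫ (α_ _ _ _).inv) ≫ (α_ _ _ _).hom ▷ E.X) ⊗≫ 𝟙 _ := by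
        rw [e1]; monoidal
      _ = 𝟙 _ ⊗≫ ((α_ _ _ _).hom ≫ (r.Γ _ (h.tensor_mem hX hYU)).hom ≫ (α_ _ _ _).hom) ⊗≫ 𝟙 _ := by
        rw [← e3]; monoidal
      _ = _ := by rw [← e2]; monoidal

theorem exists_composes (h : IsPivotalGGraded P 𝒞) (hns : IsNonsingular P 𝒞)
    (s : Transfer β A B) (t : Transfer α B D) (r : Transfer (β * α) A E) :
    ∃ g : D ≅ E, s.Composes t r g.hom.f := by
  obtain ⟨V⟩ := hns.nonempty_invObj β
  obtain ⟨W⟩ := hns.nonempty_invObj α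
  obtain ⟨g, hg⟩ := exists_descent s t r h hns
  have e := (composes_iff s t r h g).1 hg V.obj W.obj V.mem W.mem
  rw [← Iso.eq_inv_comp] at e
  -- After tensoring with $V$ and $W$ the descended morphism is a composite of transfers and
  -- associators, hence invertible.
  have : IsIso g := W.isIso_of_whiskerLeft _ (V.isIso_of_whiskerLeft _ (by
    rw [e]; infer_instance))
  exact ⟨RelCenter.isoMk (asIso g) (hg.isHom h hns), hg⟩

end Transfer

end Composition

/-! ### The crossing and the $G$-braiding of a system of transports -/

section Systems

open Functor.LaxMonoidal

variable {G : Type w} [Group G] {C : Type u} [Category.{v} C] [MonoidalCategory C]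
  {P : PivotalStructure C} {𝒞 : G → ObjectProperty C}

/-- Transports of all degrees. -/
structure TransportSystem (𝒞 : G → ObjectProperty C) where
  F : G → GCenter 𝒞 ⥤ GCenter 𝒞
  monoidal (α : G) : (F α).Monoidal
  transport (α : G) : Transport α (F α)
  mem (α : G) {β : G} {A : GCenter 𝒞} : GCenter.grading 𝒞 β A →
    GCenter.grading 𝒞 (α⁻¹ * β * α) ((F α).obj A)

attribute [instance] TransportSystem.monoidal

namespace Transfer

variable {α : G} {A B A' B' : GCenter 𝒞} {t : Transfer α A B} {t' : Transfer α A' B'}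

theorem Intertwines.add [Preadditive C] [MonoidalPreadditive C] {f f' : A ⟶ A'}
    {g g' : B.X ⟶ B'.X} (H : t.Intertwines t' f g) (H' : t.Intertwines t' f' g') :
    t.Intertwines t' (f + f') (g + g') := fun X hX => by
  rw [MonoidalPreadditive.whiskerLeft_add, Preadditive.comp_add, H X hX, H' X hX,
    show (f + f').f = f.f + f'.f from rfl, MonoidalPreadditive.add_whiskerRight,
    Preadditive.add_comp]

theorem Intertwines.smul [Preadditive C] [MonoidalPreadditive C] {k : Type*} [CommRing k]
    [Linear k C] [MonoidalLinear k C] (c : k) {f : A ⟶ A'} {g : B.X ⟶ B'.X}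
    (H : t.Intertwines t' f g) : t.Intertwines t' (c • f) (c • g) := fun X hX => by
  rw [MonoidalLinear.whiskerLeft_smul, Linear.comp_smul, H X hX,
    show (c • f).f = c • f.f from rfl, MonoidalLinear.smul_whiskerRight, Linear.smul_comp]

/-- Naturality of $t$ along the half braiding $D\otimes U\cong U\otimes D$, expanded by the two
compatibility axioms; it makes $\tau$ a morphism of the $G$-center. -/
theorem Γ_comm (t : Transfer α A B) (D : GCenter 𝒞) (hD : 𝒞 α D.X) (U : C) (hU : 𝒞 1 U)
    (hUD : 𝒞 α (U ⊗ D.X)) (hDU : 𝒞 α (D.X ⊗ U)) :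
    (t.Γ D.X hD).hom ▷ U ≫ ((D ⊗ B).hb.β U hU).hom =
      ((A ⊗ D).hb.β U hU).hom ≫ U ◁ (t.Γ D.X hD).hom := by
  change (t.Γ D.X hD).hom ▷ U ≫ ((RelCenter.tensorHalfBraiding D B).β U hU).hom =
    ((RelCenter.tensorHalfBraiding A D).β U hU).hom ≫ U ◁ (t.Γ D.X hD).hom
  simp only [RelCenter.tensorHalfBraiding, Iso.trans_hom, whiskerLeftIso_hom,
    Iso.symm_hom, whiskerRightIso_hom]
  have e1 := t.tensor_left U D.X hU hD hUD
  have e2 := t.tensor_right D.X U hD hU hDU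
  have e3 := t.naturality hDU hUD (D.hb.β U hU).hom
  rw [e1, e2] at e3
  symm
  calc
    _ = (α_ _ _ _).hom ≫ (A.X ◁ (D.hb.β U hU).hom ≫ (α_ _ _ _).inv ≫ (A.hb.β U hU).hom ▷ D.X ≫
          (α_ _ _ _).hom ≫ U ◁ (t.Γ D.X hD).hom ≫ (α_ _ _ _).inv) ≫ (α_ _ _ _).hom := by monoidal
    _ = _ := by rw [e3]; monoidal

/-- The axiom for $\varphi_\alpha(\tau)$ at the level of transfers. It is naturality of the transfer
$w$ of degree $\beta\alpha$ along $Y\otimes Z\cong Z\otimes Y_1$; the value of $w$ at the source is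
a composite through degrees $\beta,\alpha$, and at the target through $\alpha,\beta'$ with
$\alpha\beta'=\beta\alpha$. -/
theorem Γ_hexagon {α β β' : G} (hβ : α * β' = β * α) {X X₁ X₂ X₃ X₄ Y Y₁ K K' : GCenter 𝒞}
    (tX : Transfer α X X₁) (tY : Transfer α Y Y₁) (s : Transfer β X X₂) (u : Transfer α X₂ X₃)
    {w : Transfer (β * α) X K} (g : X₃ ≅ K) (hg : s.Composes u w g.hom.f)
    (s' : Transfer β' X₁ X₄) {w' : Transfer (α * β') X K'} {g' : X₄.X ⟶ K'.X}
    (hg' : tX.Composes s' w' g') {e : K'.X ⟶ K.X} (he : (w'.cast hβ).Intertwines w (𝟙 X) e)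
    (hY : 𝒞 β Y.X) (hY₁ : 𝒞 β' Y₁.X) (Z : C) (hZ : 𝒞 α Z) (hYZ : 𝒞 (β * α) (Y.X ⊗ Z))
    (hZY : 𝒞 (α * β') (Z ⊗ Y₁.X)) {N : C} (m : Y₁.X ⊗ X₃.X ⟶ N) :
    (s.Γ Y.X hY).hom ▷ Z ≫ (tensorΓ tY u Z hZ).hom ≫ Z ◁ m =
      (tensorΓ tX tY Z hZ).hom ≫
        Z ◁ ((s'.Γ Y₁.X hY₁).hom ≫ Y₁.X ◁ (g' ≫ e ≫ g.inv.f) ≫ m) := by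
  rw [tensorΓ_hom, tensorΓ_hom]
  have e1 := hg Y.X Z hY hZ hYZ
  have e2 := hg' Z Y₁.X hZ hY₁ hZY
  have e3 := he (Z ⊗ Y₁.X) (hβ ▸ hZY)
  have e4 := w.naturality hYZ (hβ ▸ hZY) (tY.Γ Z hZ).hom
  have hgi : g.hom.f ≫ g.inv.f = 𝟙 _ := congrArg RelCenter.Hom.f g.hom_inv_id
  rw [cast_Γ, RelCenter.id_f, id_whiskerRight, Category.id_comp] at e3
  rw [← Iso.eq_inv_comp] at e1 e2
  symm
  calc
    _ = 𝟙 _ ⊗≫ X.X ◁ (tY.Γ Z hZ).hom ⊗≫ (((α_ _ _ _).inv ≫ (tX.Γ Z hZ).hom ▷ Y₁.X ≫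
        (α_ _ _ _).hom ≫ Z ◁ (s'.Γ Y₁.X hY₁).hom ≫ (α_ _ _ _).inv ≫ (Z ⊗ Y₁.X) ◁ g') ≫
        (Z ⊗ Y₁.X) ◁ e) ⊗≫ Z ◁ Y₁.X ◁ g.inv.f ⊗≫ Z ◁ m := by monoidal
    _ = 𝟙 _ ⊗≫ (X.X ◁ (tY.Γ Z hZ).hom ≫ (w.Γ _ (hβ ▸ hZY)).hom) ⊗≫ Z ◁ Y₁.X ◁ g.inv.f ⊗≫ Z ◁ m := by
      rw [← e2, e3]; monoidal
    _ = 𝟙 _ ⊗≫ (w.Γ _ hYZ).hom ⊗≫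
        ((tY.Γ Z hZ).hom ▷ K.X ≫ (Z ⊗ Y₁.X) ◁ g.inv.f) ⊗≫ Z ◁ m := by
      rw [e4]; monoidal
    _ = 𝟙 _ ⊗≫ (s.Γ Y.X hY).hom ▷ Z ⊗≫ Y.X ◁ (u.Γ Z hZ).hom ⊗≫
        (Y.X ⊗ Z) ◁ (g.hom.f ≫ g.inv.f) ⊗≫ (tY.Γ Z hZ).hom ▷ X₃.X ⊗≫ Z ◁ m := by
      rw [← whisker_exchange, e1]; monoidal
    _ = _ := by rw [hgi]; monoidal

end Transfer

theorem Transport.tensor_Γ {α : G} {F : GCenter 𝒞 ⥤ GCenter 𝒞} [F.Monoidal] (T : Transport α F)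
    (A B : GCenter 𝒞) (X : C) (hX : 𝒞 α X) :
    ((T.transfer (A ⊗ B)).Γ X hX).hom =
      (Transfer.tensorΓ (T.transfer A) (T.transfer B) X hX).hom ≫ X ◁ (μ F A B).f := by
  have := T.tensor A B X hX
  rw [RelCenter.id_f, id_whiskerRight, Category.id_comp] at this
  exact this.symm

theorem Transport.tensor_Γ_hom {α : G} {F : GCenter 𝒞 ⥤ GCenter 𝒞} [F.Monoidal]
    (T : Transport α F) (A B : GCenter 𝒞) (X : C) (hX : 𝒞 α X) :
    ((T.transfer (A ⊗ B)).Γ X hX).hom =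
      (α_ A.X B.X X).hom ≫ A.X ◁ ((T.transfer B).Γ X hX).hom ≫ (α_ A.X X (F.obj B).X).inv ≫
        ((T.transfer A).Γ X hX).hom ▷ (F.obj B).X ≫ (α_ X (F.obj A).X (F.obj B).X).hom ≫
        X ◁ (μ F A B).f := by
  refine (T.tensor_Γ A B X hX).trans ?_
  have := congrArg (fun z => z ≫ X ◁ (show (F.obj A).X ⊗ (F.obj B).X ⟶ (F.obj (A ⊗ B)).X from
    (μ F A B).f)) (Transfer.tensorΓ_hom (T.transfer A) (T.transfer B) X hX)
  simp only [Category.assoc] at this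
  exact this

namespace TransportSystem

variable (S : TransportSystem 𝒞)

theorem eqToHom_intertwines {a b : G} (e : a = b) (A : GCenter 𝒞)
    (p : (S.F a).obj A = (S.F b).obj A) :
    (((S.transport a).transfer A).cast e).Intertwines ((S.transport b).transfer A) (𝟙 A)
      (eqToHom p).f := by
  subst e
  exact Transfer.Intertwines.id _

variable [Preadditive C] (h : IsPivotalGGraded P 𝒞) (hns : IsNonsingular P 𝒞)

/-- The isomorphism comparing a composite of transports with the transport of product degree. -/
noncomputable def φ₂App (α β : G) (A : GCenter 𝒞) :
    (S.F α).obj ((S.F β).obj A) ≅ (S.F (β * α)).obj A :=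
  (Transfer.exists_composes h hns ((S.transport β).transfer A)
    ((S.transport α).transfer ((S.F β).obj A)) ((S.transport (β * α)).transfer A)).choose

theorem φ₂App_composes (α β : G) (A : GCenter 𝒞) :
    ((S.transport β).transfer A).Composes ((S.transport α).transfer ((S.F β).obj A))
      ((S.transport (β * α)).transfer A) (S.φ₂App h hns α β A).hom.f :=
  (Transfer.exists_composes h hns ((S.transport β).transfer A)
    ((S.transport α).transfer ((S.F β).obj A)) ((S.transport (β * α)).transfer A)).choose_spec

/-- `φ_α φ_β ≅ φ_{βα}` -/
noncomputable def φ₂ (α β : G) : S.F β ⋙ S.F α ≅ S.F (β * α) :=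
  NatIso.ofComponents (S.φ₂App h hns α β) fun f => RelCenter.hom_ext _ _ <|
    Transfer.Composes.naturality h hns (S.φ₂App_composes h hns α β _)
      (S.φ₂App_composes h hns α β _) ((S.transport β).map f)
      ((S.transport α).map ((S.F β).map f)) ((S.transport (β * α)).map f)

theorem φ₂_composes (α β : G) (A : GCenter 𝒞) :
    ((S.transport β).transfer A).Composes ((S.transport α).transfer ((S.F β).obj A))
      ((S.transport (β * α)).transfer A) ((S.φ₂ h hns α β).hom.app A).f :=
  S.φ₂App_composes h hns α β A

theorem φ₂_isMonoidal (α β : G) : NatTrans.IsMonoidal (S.φ₂ h hns α β).hom where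
  unit := RelCenter.hom_ext _ _ <| by
    rw [comp_ε]
    have := Transfer.Composes.naturality h hns (Transfer.composes_unit α β)
      (S.φ₂_composes h hns α β (𝟙_ _)) (S.transport β).unit
      ((S.transport α).unit.id_comp ((S.transport α).map (ε (S.F β))))
      (S.transport (β * α)).unit
    exact this.trans (Category.id_comp _)
  tensor A B := RelCenter.hom_ext _ _ <| by
    rw [comp_μ]
    exact Transfer.Composes.naturality h hns
      ((S.φ₂_composes h hns α β A).tensor (S.φ₂_composes h hns α β B))
      (S.φ₂_composes h hns α β (A ⊗ B)) ((S.transport β).tensor A B)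
      (((S.transport α).tensor _ _).id_comp ((S.transport α).map (μ (S.F β) A B)))
      ((S.transport (β * α)).tensor A B)

/-- The unit isomorphism of a transport system. -/
noncomputable def φ₀ : 𝟭 (GCenter 𝒞) ≅ S.F 1 :=
  Transport.comparison h hns Transport.identity (S.transport 1)

theorem φ₀_intertwines (A : GCenter 𝒞) :
    (Transfer.ofHalfBraiding A).Intertwines ((S.transport 1).transfer A) (𝟙 A)
      ((S.φ₀ h hns).hom.app A).f :=
  Transport.comparison_intertwines h hns Transport.identity (S.transport 1) A

/-- A quasi-inverse is $\varphi_{\alpha^{-1}}$, by $\varphi_2$ and $\varphi_0$. -/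
theorem isEquivalence (h : IsPivotalGGraded P 𝒞) (hns : IsNonsingular P 𝒞) (α : G) :
    (S.F α).IsEquivalence :=
  (CategoryTheory.Equivalence.mk (S.F α) (S.F α⁻¹)
    (S.φ₀ h hns ≪≫ eqToIso (by simp) ≪≫ (S.φ₂ h hns α⁻¹ α).symm)
    (S.φ₂ h hns α α⁻¹ ≪≫ eqToIso (by simp) ≪≫ (S.φ₀ h hns).symm)).isEquivalence_functor

variable [MonoidalPreadditive C] (k : Type*) [CommRing k] [Linear k C] [MonoidalLinear k C]

/-- The crossing determined by a transport system. -/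
noncomputable def crossing : Crossing k (GCenter.grading 𝒞) where
  φ := S.F
  monoidal := S.monoidal
  additive α :=
    { map_add := fun {A B f g} => RelCenter.hom_ext _ _ <| Transfer.Intertwines.ext hns
        ((S.transport α).map (f + g)) (((S.transport α).map f).add ((S.transport α).map g)) }
  linear α :=
    { map_smul := fun f c => RelCenter.hom_ext _ _ <| Transfer.Intertwines.ext hns
        ((S.transport α).map (c • f)) (((S.transport α).map f).smul c) }
  isEquivalence := S.isEquivalence h hns
  φ₂ := S.φ₂ h hns
  φ₀ := S.φ₀ h hns
  φ₂_monoidal := S.φ₂_isMonoidal h hns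
  φ₀_monoidal := Transport.comparison_isMonoidal h hns Transport.identity (S.transport 1)
  φ₂_assoc α β γ A := RelCenter.hom_ext _ _ <|
    Transfer.Composes.assoc h hns (S.φ₂_composes h hns β γ A)
      ((S.transport α).map ((S.φ₂ h hns β γ).hom.app A)) (S.φ₂_composes h hns α (γ * β) A)
      (S.φ₂_composes h hns α β ((S.F γ).obj A)) (S.φ₂_composes h hns (β * α) γ A)
      (S.eqToHom_intertwines _ A _)
  φ₂_unit_right α A := RelCenter.hom_ext _ _ <| by
    -- The identity and $\varphi_2(\alpha,1)$ both compare composites with target degree $\alpha$;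
    -- the first uses the half braiding of $A$, the second the transfer of degree $1$, and
    -- $\varphi_0$ mediates.
    have := Transfer.Composes.naturality h hns
      (Transfer.composes_ofHalfBraiding_left ((S.transport α).transfer A))
      (S.φ₂_composes h hns α 1 A) (S.φ₀_intertwines h hns A)
      ((S.transport α).map ((S.φ₀ h hns).hom.app A))
      (S.eqToHom_intertwines (one_mul α).symm A (by simp))
    exact this.trans (Category.id_comp _)
  φ₂_unit_left α A := RelCenter.hom_ext _ _ <| by
    have := Transfer.Composes.naturality h hns
      (Transfer.composes_ofHalfBraiding_right ((S.transport α).transfer A))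
      (S.φ₂_composes h hns 1 α A) (b := 𝟙 _) (Transfer.Intertwines.id _)
      (S.φ₀_intertwines h hns ((S.F α).obj A))
      (S.eqToHom_intertwines (mul_one α).symm A (by simp))
    exact this.trans (Category.id_comp _)
  map_mem := S.mem

/-- The isomorphism `A ⊗ B ≅ B ⊗ φ_β(A)` of the `G`-center. -/
noncomputable def τ (A : GCenter 𝒞) {β : G} (B : GCenter 𝒞) (hB : GCenter.grading 𝒞 β B) :
    A ⊗ B ≅ B ⊗ (S.F β).obj A :=
  RelCenter.isoMk (((S.transport β).transfer A).Γ B.X hB) fun U hU =>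
    Transfer.Γ_comm _ B hB U hU (h.one_mul_mem hU hB) (h.mem_mul_one hB hU)

/-- The `G`-braiding determined by a transport system. -/
noncomputable def braiding : GBraiding (S.crossing h hns k) where
  τ := S.τ h
  naturality_left f β Y hY := RelCenter.hom_ext _ _ ((S.transport β).map f Y.X hY).symm
  naturality_right X β Y Y' hY hY' f := RelCenter.hom_ext _ _ <|
    ((S.transport β).transfer X).naturality hY hY' f.f
  -- The two hexagons are the defining properties of $\varphi_2$ and of the monoidal constraint.
  tensor_right X β γ Y Z hY hZ hYZ := RelCenter.hom_ext _ _ <|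
    S.φ₂_composes h hns γ β X Y.X Z.X hY hZ hYZ
  tensor_left X Y γ Z hZ := RelCenter.hom_ext _ _ <|
    (S.transport γ).tensor_Γ_hom X Y Z.X hZ
  -- The identity is tested after tensoring with $Z$ of degree $\alpha$ and precomposing with the
  -- tensor product of the transfers of $X$ and $Y$.
  map_φ α X β Y hY := RelCenter.hom_ext _ _ <| hns.whiskerLeft_ext α fun Z hZ => by
    refine (cancel_epi (Transfer.tensorΓ ((S.transport α).transfer X)
      ((S.transport α).transfer Y) Z hZ).hom).1 ?_
    have H := ((S.transport α).tensor X Y).id_comp ((S.transport α).map (S.τ h X Y hY).hom) Z hZ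
    refine H.trans ?_
    refine (congrArg (fun z => (S.τ h X Y hY).hom.f ▷ Z ≫ z)
      ((S.transport α).tensor_Γ Y ((S.F β).obj X) Z hZ)).trans ?_
    exact Transfer.Γ_hexagon (by simp [mul_assoc]) ((S.transport α).transfer X)
      ((S.transport α).transfer Y) ((S.transport β).transfer X)
      ((S.transport α).transfer ((S.F β).obj X)) ((S.φ₂ h hns α β).app X)
      (S.φ₂_composes h hns α β X)
      ((S.transport (α⁻¹ * β * α)).transfer ((S.F α).obj X))
      (S.φ₂_composes h hns (α⁻¹ * β * α) α X)
      (S.eqToHom_intertwines (by simp [mul_assoc]) X (by simp [mul_assoc])) hY (S.mem α hY) Z hZ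
      (h.tensor_mem hY hZ) (h.tensor_mem hZ (S.mem α hY)) _

end TransportSystem

end Systems

/-! ### The canonical structure and its independence of choices -/

section Canonical

open Functor.LaxMonoidal

variable {G : Type w} [Group G] {C : Type u} [Category.{v} C] [MonoidalCategory C]
  {P : PivotalStructure C} {𝒞 : G → ObjectProperty C}

/-- Replace the target of a transfer by an isomorphic object of the `G`-center. -/
def Transfer.ofIso {α : G} {A B B' : GCenter 𝒞} (t : Transfer α A B) (e : B' ≅ B) :
    Transfer α A B' where
  Γ X hX := t.Γ X hX ≪≫ whiskerLeftIso X
    ⟨e.inv.f, e.hom.f, congrArg RelCenter.Hom.f e.inv_hom_id, congrArg RelCenter.Hom.f e.hom_inv_id⟩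
  naturality hX hY f := by
    simp only [Iso.trans_hom, whiskerLeftIso_hom]
    rw [← Category.assoc, t.naturality hX hY, Category.assoc, Category.assoc, whisker_exchange]
  tensor_left Y X hY hX hYX := by
    simp only [Iso.trans_hom, whiskerLeftIso_hom]
    rw [t.tensor_left Y X hY hX hYX]
    monoidal
  tensor_right X Y hX hY hXY := by
    simp only [Iso.trans_hom, whiskerLeftIso_hom]
    rw [t.tensor_right X Y hX hY hXY]
    have := e.inv.comm Y hY
    calc
      _ = 𝟙 _ ⊗≫ (t.Γ X hX).hom ▷ Y ⊗≫ X ◁ ((B.hb.β Y hY).hom ≫ Y ◁ e.inv.f) ⊗≫ 𝟙 _ := by monoidal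
      _ = _ := by rw [← this]; monoidal

theorem Transfer.ofIso_intertwines {α : G} {A B B' : GCenter 𝒞} (t : Transfer α A B)
    (e : B' ≅ B) : (t.ofIso e).Intertwines t (𝟙 A) e.hom.f := fun X hX => by
  have : e.inv.f ≫ e.hom.f = 𝟙 _ := congrArg RelCenter.Hom.f e.inv_hom_id
  simp only [ofIso, Iso.trans_hom, whiskerLeftIso_hom]
  rw [Category.assoc, ← MonoidalCategory.whiskerLeft_comp, this]
  simp

theorem Transfer.Intertwines.of_comp {α : G} {A B A' B' B'' : GCenter 𝒞} {t : Transfer α A B}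
    {t' : Transfer α A' B'} {t'' : Transfer α A' B''} {f : A ⟶ A'} {g : B.X ⟶ B'.X}
    {e : B' ≅ B''} (he : t'.Intertwines t'' (𝟙 A') e.hom.f) {m : B.X ⟶ B''.X}
    (hm : g ≫ e.hom.f = m) (H : t.Intertwines t'' f m) : t.Intertwines t' f g := fun X hX => by
  have hi : IsIso e.hom.f := ⟨e.inv.f, congrArg RelCenter.Hom.f e.hom_inv_id,
    congrArg RelCenter.Hom.f e.inv_hom_id⟩
  have h1 := H X hX
  have h2 := he X hX
  rw [RelCenter.id_f, id_whiskerRight, Category.id_comp] at h2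
  rw [← cancel_mono (X ◁ e.hom.f), Category.assoc, Category.assoc, h2, ← h1, ← hm,
    MonoidalCategory.whiskerLeft_comp]

/-- Pull back a transport along an isomorphism of monoidal functors. -/
def Transport.ofIso {α : G} {F F' : GCenter 𝒞 ⥤ GCenter 𝒞} [F.Monoidal] [F'.Monoidal]
    (T : Transport α F') (e : F ≅ F') (he : NatTrans.IsMonoidal e.hom) : Transport α F where
  transfer A := (T.transfer A).ofIso (e.app A)
  map {A B} f := Transfer.Intertwines.of_comp (e := e.app B) (Transfer.ofIso_intertwines _ _)
    (congrArg RelCenter.Hom.f (e.hom.naturality f))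
    (((T.transfer A).ofIso_intertwines (e.app A)).id_comp (T.map f))
  tensor A B := Transfer.Intertwines.of_comp (e := e.app (A ⊗ B))
      (Transfer.ofIso_intertwines _ _) (congrArg RelCenter.Hom.f (he.tensor A B)) <| by
    have h1 := ((T.transfer A).ofIso_intertwines (e.app A)).tensor
      ((T.transfer B).ofIso_intertwines (e.app B))
    rw [id_tensorHom_id] at h1
    exact h1.id_comp (T.tensor A B)
  unit := Transfer.Intertwines.of_comp (e := e.app (𝟙_ _)) (Transfer.ofIso_intertwines _ _)
    (congrArg RelCenter.Hom.f he.unit) T.unit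

variable [Preadditive C] {h : IsPivotalGGraded P 𝒞} (hns : IsNonsingular P 𝒞)

/-- A chosen homogeneous object of invertible dimension. -/
noncomputable def IsNonsingular.invObj (hns : IsNonsingular P 𝒞) (α : G) : InvObj P 𝒞 α :=
  Classical.choice (hns.nonempty_invObj α)

/-- The transport system given by the functors `φ_V` for a chosen `V` in each degree. -/
noncomputable def SplittingSystem.transportSystem (Φ : SplittingSystem h) : TransportSystem 𝒞 where
  F α := (Φ α (hns.invObj α)).functor
  monoidal α := (Φ α (hns.invObj α)).monoidal
  transport α := (Φ α (hns.invObj α)).transport hns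
  mem α := (Φ α (hns.invObj α)).mem

theorem comparison_app_f_eq_deltaMor {α : G} {U V : InvObj P 𝒞 α} (ΦU : SplittingFunctor h U)
    (ΦV : SplittingFunctor h V) (A : GCenter 𝒞) :
    ((Transport.comparison h hns (ΦV.transport hns) (ΦU.transport hns)).hom.app A).f =
      deltaMor ΦU ΦV A :=
  Transfer.Intertwines.ext hns (Transport.comparison_intertwines h hns _ _ A)
    (deltaMor_intertwines hns ΦU ΦV A)

theorem deltaMor_self (hns : IsNonsingular P 𝒞) {α : G} {V : InvObj P 𝒞 α}
    (ΦV : SplittingFunctor h V) (A : GCenter 𝒞) : deltaMor ΦV ΦV A = 𝟙 _ :=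
  Transfer.Intertwines.ext hns (deltaMor_intertwines hns ΦV ΦV A) (.id _)

variable [MonoidalPreadditive C] {k : Type*} [CommRing k] [Linear k C] [MonoidalLinear k C]

variable (k) in
/-- The canonical `G`-braided structure of the `G`-center. -/
noncomputable def canonicalGBraiding (Φ : SplittingSystem h) : CanonicalGBraiding k Φ where
  crossing := (SplittingSystem.transportSystem hns Φ).crossing h hns k
  braiding := (SplittingSystem.transportSystem hns Φ).braiding h hns k
  -- With $\varphi_\alpha=\varphi_{V_0}$ for the chosen $V_0$, this is $\delta^{V,V_0}$.
  ι α V := Transport.comparison h hns ((Φ α (hns.invObj α)).transport hns)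
    ((Φ α V).transport hns)
  ι_monoidal α V := Transport.comparison_isMonoidal h hns _ _
  ι_delta α U V A := Transfer.Intertwines.ext hns
    ((Transport.comparison_intertwines h hns _ _ A).id_comp
      (deltaMor_intertwines hns (Φ α U) (Φ α V) A))
    (Transport.comparison_intertwines h hns _ _ A)
  isLimit α F _ κ hκ H := by
    -- A cone is determined by its component at $V_0$: the others are obtained from it by
    -- $\delta^{V,V_0}$, and $\delta^{V_0,V_0}$ is the identity.
    refine ⟨κ (hns.invObj α), ⟨hκ _, fun V => NatTrans.ext (funext fun A => RelCenter.hom_ext _ _ ?_)⟩,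
      fun u hu => NatTrans.ext (funext fun A => RelCenter.hom_ext _ _ ?_)⟩
    · exact (congrArg (fun z => ((κ (hns.invObj α)).app A).f ≫ z)
        (comparison_app_f_eq_deltaMor hns (Φ α V) (Φ α (hns.invObj α)) A)).trans (H V _ A)
    · have e := congrArg (fun t => RelCenter.Hom.f (NatTrans.app t A)) (hu.2 (hns.invObj α))
      refine Eq.trans ?_ e
      refine (Category.comp_id _).symm.trans (congrArg (fun z => (u.app A).f ≫ z) ?_)
      exact ((comparison_app_f_eq_deltaMor hns _ _ A).trans (deltaMor_self hns _ A)).symm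
  φ₂_zeta α β U V W A := by
    have := Transfer.Composes.naturality h hns
      ((SplittingSystem.transportSystem hns Φ).φ₂_composes h hns α β A)
      (zetaMor_composes hns (Φ α U) (Φ β V) (Φ (β * α) W) A)
      (Transport.comparison_intertwines h hns _ ((Φ β V).transport hns) A)
      ((Transport.comparison_intertwines h hns _ ((Φ α U).transport hns) _).id_comp
        (((Φ α U).transport hns).map _))
      (Transport.comparison_intertwines h hns _ ((Φ (β * α) W).transport hns) A)
    exact this.symm.trans (Category.assoc _ _ _)
  φ₀_eta U A := Transfer.Intertwines.ext hns
    (((SplittingSystem.transportSystem hns Φ).φ₀_intertwines h hns A).id_comp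
      (Transport.comparison_intertwines h hns _ ((Φ 1 U).transport hns) A))
    (etaMor_intertwines hns (Φ 1 U) A)
  τ_gamma A β B hB V := by
    have := Transport.comparison_intertwines h hns ((Φ β (hns.invObj β)).transport hns)
      ((Φ β V).transport hns) A B.X hB
    rw [RelCenter.id_f, id_whiskerRight, Category.id_comp] at this
    exact this

namespace CanonicalGBraiding

variable {Φ : SplittingSystem h} (B : CanonicalGBraiding k Φ)

/-- The transports of the crossing of a canonical `G`-braided structure. -/
noncomputable def transport (α : G) : Transport α (B.crossing.φ α) :=
  ((Φ α (hns.invObj α)).transport hns).ofIso (B.ι α _) (B.ι_monoidal α _)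

/-- The transports are pulled back along $\iota_{V_0}$ only; the cone relation with $\delta^{V,V_0}$
extends the property to all $V$. -/
theorem ι_intertwines (α : G) (V : InvObj P 𝒞 α) (A : GCenter 𝒞) :
    ((B.transport hns α).transfer A).Intertwines (((Φ α V).transport hns).transfer A) (𝟙 A)
      ((B.ι α V).hom.app A).f := by
  rw [← B.ι_delta α V (hns.invObj α) A]
  exact (Transfer.ofIso_intertwines _ _).id_comp (deltaMor_intertwines hns _ _ A)

theorem isIso_ι_f (α : G) (V : InvObj P 𝒞 α) (A : GCenter 𝒞) :
    IsIso ((B.ι α V).hom.app A).f :=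
  ⟨((B.ι α V).inv.app A).f, congrArg RelCenter.Hom.f ((B.ι α V).hom_inv_id_app A),
    congrArg RelCenter.Hom.f ((B.ι α V).inv_hom_id_app A)⟩

/-- The relation with $\zeta$ forces $\varphi_2$: the isomorphism obtained by descent satisfies the
same relation, and $\iota$ can be cancelled. The relations with $\eta$ and $\Gamma$ determine
$\varphi_0$ and $\tau$ in the same way. -/
theorem φ₂_composes (α β : G) (A : GCenter 𝒞) :
    ((B.transport hns β).transfer A).Composes
      ((B.transport hns α).transfer ((B.crossing.φ β).obj A))
      ((B.transport hns (β * α)).transfer A) ((B.crossing.φ₂ α β).hom.app A).f := by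
  obtain ⟨g, hg⟩ := Transfer.exists_composes h hns ((B.transport hns β).transfer A)
    ((B.transport hns α).transfer ((B.crossing.φ β).obj A)) ((B.transport hns (β * α)).transfer A)
  suffices g.hom.f = ((B.crossing.φ₂ α β).hom.app A).f from this ▸ hg
  have := B.isIso_ι_f (β * α) (hns.invObj _) A
  refine (cancel_mono ((B.ι (β * α) (hns.invObj _)).hom.app A).f).1 ?_
  have e := Transfer.Composes.naturality h hns hg
    (zetaMor_composes hns (Φ α (hns.invObj _)) (Φ β (hns.invObj _)) (Φ (β * α) (hns.invObj _)) A)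
    (B.ι_intertwines hns β (hns.invObj _) A)
    ((B.ι_intertwines hns α (hns.invObj _) _).id_comp
      (((Φ α (hns.invObj _)).transport hns).map ((B.ι β (hns.invObj _)).hom.app A)))
    (B.ι_intertwines hns (β * α) (hns.invObj _) A)
  exact e.symm.trans ((Category.assoc _ _ _).trans (B.φ₂_zeta α β _ _ _ A).symm)

theorem φ₀_intertwines (A : GCenter 𝒞) :
    (Transfer.ofHalfBraiding A).Intertwines ((B.transport hns 1).transfer A) (𝟙 A)
      (B.crossing.φ₀.hom.app A).f :=
  Transfer.Intertwines.of_comp (e := (B.ι 1 (hns.invObj 1)).app A)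
    (B.ι_intertwines hns 1 (hns.invObj 1) A) (B.φ₀_eta (hns.invObj 1) A)
    (etaMor_intertwines hns (Φ 1 (hns.invObj 1)) A)

theorem τ_hom_f (A : GCenter 𝒞) {β : G} (D : GCenter 𝒞) (hD : GCenter.grading 𝒞 β D) :
    (B.braiding.τ A D hD).hom.f = (((B.transport hns β).transfer A).Γ D.X hD).hom := by
  have := B.isIso_ι_f β (hns.invObj β) A
  refine (cancel_mono (D.X ◁ ((B.ι β (hns.invObj _)).hom.app A).f)).1 ?_
  refine (B.τ_gamma A D hD _).trans ?_
  have := B.ι_intertwines hns β (hns.invObj β) A D.X hD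
  rw [RelCenter.id_f, id_whiskerRight, Category.id_comp] at this
  exact this.symm

/-- The right side does not involve the splitting. Hence the composite $q\,\iota$ into $V^*\otimes
A\otimes V$ can be compared between different choices. -/
theorem Γ_comp_ι_q (hns : IsNonsingular P 𝒞) (α : G) (V : InvObj P 𝒞 α) (A : GCenter 𝒞) (X : C)
    (hX : 𝒞 α X) :
    (((B.transport hns α).transfer A).Γ X hX).hom ≫ X ◁ (((B.ι α V).hom.app A).f ≫ (Φ α V).q A) =
      crossOver P A X V.obj (h.mem_one hX V.mem) := by
  have := B.ι_intertwines hns α V A X hX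
  rw [RelCenter.id_f, id_whiskerRight, Category.id_comp] at this
  rw [MonoidalCategory.whiskerLeft_comp, reassoc_of% this, SplittingFunctor.transport_Γ_hom,
    (Φ α V).gammaMor_q hns]

variable {Φ' : SplittingSystem h} (B' : CanonicalGBraiding k Φ')

/-- The comparison between two canonical `G`-braided structures. -/
noncomputable def comparison (α : G) : B.crossing.φ α ≅ B'.crossing.φ α :=
  Transport.comparison h hns (B.transport hns α) (B'.transport hns α)

theorem comparison_intertwines (α : G) (A : GCenter 𝒞) :
    ((B.transport hns α).transfer A).Intertwines ((B'.transport hns α).transfer A) (𝟙 A)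
      ((comparison hns B B' α).hom.app A).f :=
  Transport.comparison_intertwines h hns _ _ A

theorem comparison_isGBraidedIso :
    IsGBraidedIso B.braiding B'.braiding (comparison hns B B') where
  monoidal α := Transport.comparison_isMonoidal h hns _ _
  φ₂ α β A := RelCenter.hom_ext _ _ <| by
    have := Transfer.Composes.naturality h hns (B.φ₂_composes hns α β A)
      (B'.φ₂_composes hns α β A) (comparison_intertwines hns B B' β A)
      ((comparison_intertwines hns B B' α _).id_comp
        ((B'.transport hns α).map ((comparison hns B B' β).hom.app A)))
      (comparison_intertwines hns B B' (β * α) A)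
    exact this.symm.trans (Category.assoc _ _ _)
  φ₀ A := RelCenter.hom_ext _ _ <| Transfer.Intertwines.ext hns
    ((B.φ₀_intertwines hns A).id_comp (comparison_intertwines hns B B' 1 A))
    (B'.φ₀_intertwines hns A)
  τ A β D hD := RelCenter.hom_ext _ _ <| by
    have := comparison_intertwines hns B B' β A D.X hD
    rw [RelCenter.id_f, id_whiskerRight, Category.id_comp] at this
    exact (congrArg (fun z => z ≫ D.X ◁ ((comparison hns B B' β).hom.app A).f)
      (B.τ_hom_f hns A D hD)).trans (this.trans (B'.τ_hom_f hns A D hD).symm)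

theorem comparison_q (α : G) (V : InvObj P 𝒞 α) (A : GCenter 𝒞) :
    ((comparison hns B B' α).hom.app A).f ≫ ((B'.ι α V).hom.app A).f ≫ (Φ' α V).q A =
      ((B.ι α V).hom.app A).f ≫ (Φ α V).q A :=
  hns.whiskerLeft_ext α fun X hX => by
    have := comparison_intertwines hns B B' α A X hX
    rw [RelCenter.id_f, id_whiskerRight, Category.id_comp] at this
    rw [← cancel_epi (((B.transport hns α).transfer A).Γ X hX).hom, B.Γ_comp_ι_q hns,
      MonoidalCategory.whiskerLeft_comp, reassoc_of% this, B'.Γ_comp_ι_q hns]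

/-- Composing with $p$ removes $q$, and $\iota$ is invertible; a single $V$ in each degree suffices.
-/
theorem eq_of_comp_q (hns : IsNonsingular P 𝒞) {θ θ' : ∀ α : G, B.crossing.φ α ≅ B'.crossing.φ α}
    (H : ∀ (α : G) (V : InvObj P 𝒞 α) (A : GCenter 𝒞),
      ((θ α).hom.app A).f ≫ ((B'.ι α V).hom.app A).f ≫ (Φ' α V).q A =
        ((θ' α).hom.app A).f ≫ ((B'.ι α V).hom.app A).f ≫ (Φ' α V).q A) : θ = θ' := by
  funext α
  refine Iso.ext (NatTrans.ext (funext fun A => RelCenter.hom_ext _ _ ?_))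
  have e := congrArg (· ≫ (Φ' α (hns.invObj α)).p A) (H α (hns.invObj α) A)
  simp only [Category.assoc, (Φ' α (hns.invObj α)).q_p, Category.comp_id] at e
  have := B'.isIso_ι_f α (hns.invObj α) A
  exact (cancel_mono _).1 e

end CanonicalGBraiding

end Canonical

/-! ### Duality calculus and rotations -/

namespace PivotalStructure

variable {C : Type u} [Category.{v} C] [MonoidalCategory C] (P : PivotalStructure C)

section Pairing

variable {W Z B : C}

/-- Bending the strand $B^*$ is one of the adjunction bijections of duality; the following lemmas
are its variants for the other sides and for right duality. -/
theorem ev_hom_ext {f g : W ⟶ Z ⊗ P.dual B}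
    (H : f ▷ B ⊗≫ Z ◁ P.ev B ⊗≫ 𝟙 Z = g ▷ B ⊗≫ Z ◁ P.ev B ⊗≫ 𝟙 Z) : f = g := by
  let _ := P.left B
  apply (tensorRightHomEquiv W B (P.dual B) Z).symm.injective
  change f ▷ B ≫ (α_ _ _ _).hom ≫ Z ◁ P.ev B ≫ (ρ_ _).hom =
    g ▷ B ≫ (α_ _ _ _).hom ≫ Z ◁ P.ev B ≫ (ρ_ _).hom
  calc
    _ = f ▷ B ⊗≫ Z ◁ P.ev B ⊗≫ 𝟙 Z := by monoidal
    _ = _ := by rw [H]; monoidal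

theorem ev_hom_ext_unit {f g : W ⟶ P.dual B} (H : f ▷ B ≫ P.ev B = g ▷ B ≫ P.ev B) : f = g := by
  rw [← cancel_mono (λ_ _).inv]
  apply P.ev_hom_ext
  calc
    _ = (f ▷ B ≫ P.ev B) ⊗≫ 𝟙 _ := by monoidal
    _ = _ := by rw [H]; monoidal

theorem exists_ev (f : W ⊗ B ⟶ Z) :
    ∃ g : W ⟶ Z ⊗ P.dual B, g ▷ B ⊗≫ Z ◁ P.ev B ⊗≫ 𝟙 Z = f := by
  let _ := P.left B
  refine ⟨tensorRightHomEquiv W B (P.dual B) Z f, ?_⟩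
  rw [← (tensorRightHomEquiv W B (P.dual B) Z).symm_apply_apply f]
  generalize tensorRightHomEquiv W B (P.dual B) Z f = g
  rw [Equiv.apply_symm_apply]
  change _ = g ▷ B ≫ (α_ _ _ _).hom ≫ Z ◁ P.ev B ≫ (ρ_ _).hom
  monoidal

theorem exists_ev_unit (f : W ⊗ B ⟶ 𝟙_ C) : ∃ g : W ⟶ P.dual B, g ▷ B ≫ P.ev B = f := by
  obtain ⟨g, rfl⟩ := P.exists_ev f
  exact ⟨g ≫ (λ_ _).hom, by monoidal⟩

theorem ev_hom_ext_left {f g : W ⟶ B ⊗ Z}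
    (H : P.dual B ◁ f ⊗≫ P.ev B ▷ Z ⊗≫ 𝟙 Z = P.dual B ◁ g ⊗≫ P.ev B ▷ Z ⊗≫ 𝟙 Z) : f = g := by
  let _ := P.left B
  apply (tensorLeftHomEquiv W B (P.dual B) Z).symm.injective
  change P.dual B ◁ f ≫ (α_ _ _ _).inv ≫ P.ev B ▷ Z ≫ (λ_ _).hom =
    P.dual B ◁ g ≫ (α_ _ _ _).inv ≫ P.ev B ▷ Z ≫ (λ_ _).hom
  calc
    _ = P.dual B ◁ f ⊗≫ P.ev B ▷ Z ⊗≫ 𝟙 Z := by monoidal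
    _ = _ := by rw [H]; monoidal

theorem ev_hom_ext_left_unit {f g : W ⟶ B} (H : P.dual B ◁ f ≫ P.ev B = P.dual B ◁ g ≫ P.ev B) :
    f = g := by
  rw [← cancel_mono (ρ_ _).inv]
  apply P.ev_hom_ext_left
  calc
    _ = (P.dual B ◁ f ≫ P.ev B) ⊗≫ 𝟙 _ := by monoidal
    _ = _ := by rw [H]; monoidal

theorem ev'_hom_ext_left {f g : W ⟶ P.dual B ⊗ Z}
    (H : B ◁ f ⊗≫ P.ev' B ▷ Z ⊗≫ 𝟙 Z = B ◁ g ⊗≫ P.ev' B ▷ Z ⊗≫ 𝟙 Z) : f = g := by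
  let _ := P.right B
  apply (tensorLeftHomEquiv W (P.dual B) B Z).symm.injective
  change B ◁ f ≫ (α_ _ _ _).inv ≫ P.ev' B ▷ Z ≫ (λ_ _).hom =
    B ◁ g ≫ (α_ _ _ _).inv ≫ P.ev' B ▷ Z ≫ (λ_ _).hom
  calc
    _ = B ◁ f ⊗≫ P.ev' B ▷ Z ⊗≫ 𝟙 Z := by monoidal
    _ = _ := by rw [H]; monoidal

theorem ev'_hom_ext_left_unit {f g : W ⟶ P.dual B} (H : B ◁ f ≫ P.ev' B = B ◁ g ≫ P.ev' B) :
    f = g := by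
  rw [← cancel_mono (ρ_ _).inv]
  apply P.ev'_hom_ext_left
  calc
    _ = (B ◁ f ≫ P.ev' B) ⊗≫ 𝟙 _ := by monoidal
    _ = _ := by rw [H]; monoidal

theorem ev'_hom_ext {f g : W ⟶ Z ⊗ B}
    (H : f ▷ P.dual B ⊗≫ Z ◁ P.ev' B ⊗≫ 𝟙 Z = g ▷ P.dual B ⊗≫ Z ◁ P.ev' B ⊗≫ 𝟙 Z) : f = g := by
  let _ := P.right B
  apply (tensorRightHomEquiv W (P.dual B) B Z).symm.injective
  change f ▷ P.dual B ≫ (α_ _ _ _).hom ≫ Z ◁ P.ev' B ≫ (ρ_ _).hom =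
    g ▷ P.dual B ≫ (α_ _ _ _).hom ≫ Z ◁ P.ev' B ≫ (ρ_ _).hom
  calc
    _ = f ▷ P.dual B ⊗≫ Z ◁ P.ev' B ⊗≫ 𝟙 Z := by monoidal
    _ = _ := by rw [H]; monoidal

theorem ev'_hom_ext_unit {f g : W ⟶ B} (H : f ▷ P.dual B ≫ P.ev' B = g ▷ P.dual B ≫ P.ev' B) :
    f = g := by
  rw [← cancel_mono (λ_ _).inv]
  apply P.ev'_hom_ext
  calc
    _ = (f ▷ P.dual B ≫ P.ev' B) ⊗≫ 𝟙 _ := by monoidal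
    _ = _ := by rw [H]; monoidal

end Pairing

section Mates

variable {A B X Y : C}

/-- The pairing of `X* ⊗ Y*` with `Y ⊗ X` by left evaluations. -/
def ev₂ (X Y : C) : (P.dual X ⊗ P.dual Y) ⊗ (Y ⊗ X) ⟶ 𝟙_ C :=
  𝟙 _ ⊗≫ P.dual X ◁ P.ev Y ▷ X ⊗≫ P.ev X

/-- The pairing of `Y ⊗ X` with `X* ⊗ Y*` by right evaluations. -/
def ev₂' (X Y : C) : (Y ⊗ X) ⊗ (P.dual X ⊗ P.dual Y) ⟶ 𝟙_ C :=
  𝟙 _ ⊗≫ Y ◁ P.ev' X ▷ P.dual Y ⊗≫ P.ev' Y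

/-- The dual of a morphism. -/
def dualMap (f : X ⟶ Y) : P.dual Y ⟶ P.dual X :=
  (ρ_ (P.dual Y)).inv ≫ P.dual Y ◁ P.coev X ≫ P.dual Y ◁ (f ▷ P.dual X) ≫
        (α_ _ _ _).inv ≫ P.ev Y ▷ P.dual X ≫ (λ_ (P.dual X)).hom

theorem dualMap_ev (f : X ⟶ Y) : P.dualMap f ▷ X ≫ P.ev X = P.dual Y ◁ f ≫ P.ev Y := by
  rw [dualMap]
  calc
    _ = 𝟙 _ ⊗≫ P.dual Y ◁ P.coev X ▷ X ⊗≫ P.dual Y ◁ f ▷ (P.dual X ⊗ X) ⊗≫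
        (P.ev Y ▷ (P.dual X ⊗ X) ≫ 𝟙_ C ◁ P.ev X) ⊗≫ 𝟙 _ := by monoidal
    _ = 𝟙 _ ⊗≫ P.dual Y ◁ P.coev X ▷ X ⊗≫ P.dual Y ◁ (f ▷ (P.dual X ⊗ X) ≫ Y ◁ P.ev X) ⊗≫
        P.ev Y ⊗≫ 𝟙 _ := by rw [← whisker_exchange]; monoidal
    _ = 𝟙 _ ⊗≫ P.dual Y ◁ (𝟙 X ⊗≫ P.coev X ▷ X ⊗≫ X ◁ P.ev X ⊗≫ 𝟙 X) ⊗≫ P.dual Y ◁ f ⊗≫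
        P.ev Y ⊗≫ 𝟙 _ := by rw [← whisker_exchange]; monoidal
    _ = _ := by rw [ev_zigzag P]; monoidal

/-- Pivotality enters here: $f^*$ is defined by left duality, and `dual_map` rewrites it by right
duality. -/
theorem dualMap_ev' (f : X ⟶ Y) : X ◁ P.dualMap f ≫ P.ev' X = f ▷ P.dual Y ≫ P.ev' Y := by
  have : P.dualMap f = (λ_ (P.dual Y)).inv ≫ P.coev' X ▷ P.dual Y ≫ (P.dual X ◁ f) ▷ P.dual Y ≫
        (α_ _ _ _).hom ≫ P.dual X ◁ P.ev' Y ≫ (ρ_ (P.dual X)).hom := P.dual_map f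
  rw [this]
  calc
    _ = 𝟙 _ ⊗≫ X ◁ P.coev' X ▷ P.dual Y ⊗≫ X ◁ P.dual X ◁ f ▷ P.dual Y ⊗≫
        ((X ⊗ P.dual X) ◁ P.ev' Y ≫ P.ev' X ▷ 𝟙_ C) ⊗≫ 𝟙 _ := by monoidal
    _ = 𝟙 _ ⊗≫ X ◁ P.coev' X ▷ P.dual Y ⊗≫ ((X ⊗ P.dual X) ◁ f ≫ P.ev' X ▷ Y) ▷ P.dual Y ⊗≫
        P.ev' Y ⊗≫ 𝟙 _ := by rw [whisker_exchange]; monoidal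
    _ = 𝟙 _ ⊗≫ (𝟙 X ⊗≫ X ◁ P.coev' X ⊗≫ P.ev' X ▷ X ⊗≫ 𝟙 X) ▷ P.dual Y ⊗≫ f ▷ P.dual Y ⊗≫
        P.ev' Y ⊗≫ 𝟙 _ := by rw [whisker_exchange]; monoidal
    _ = _ := by rw [ev'_zigzag' P]; monoidal

/-- The comparison `X* ⊗ Y* ⟶ (Y ⊗ X)*`. -/
def dualTensor (X Y : C) : P.dual X ⊗ P.dual Y ⟶ P.dual (Y ⊗ X) :=
  𝟙 (P.dual X ⊗ P.dual Y) ⊗≫ (P.dual X ⊗ P.dual Y) ◁ P.coev (Y ⊗ X) ⊗≫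
    P.dual X ◁ (P.ev Y ▷ (X ⊗ P.dual (Y ⊗ X))) ⊗≫
    P.ev X ▷ P.dual (Y ⊗ X) ⊗≫ 𝟙 (P.dual (Y ⊗ X))

theorem transpose_ev {W Z : C} (e : W ⊗ Z ⟶ 𝟙_ C) :
    (𝟙 W ⊗≫ W ◁ P.coev Z ⊗≫ e ▷ P.dual Z ⊗≫ 𝟙 (P.dual Z)) ▷ Z ≫ P.ev Z = e := by
  calc
    _ = 𝟙 _ ⊗≫ W ◁ P.coev Z ▷ Z ⊗≫ (e ▷ (P.dual Z ⊗ Z) ≫ 𝟙_ C ◁ P.ev Z) ⊗≫ 𝟙 _ := by monoidal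
    _ = 𝟙 _ ⊗≫ W ◁ (𝟙 Z ⊗≫ P.coev Z ▷ Z ⊗≫ Z ◁ P.ev Z ⊗≫ 𝟙 Z) ⊗≫ e ⊗≫ 𝟙 _ := by
        rw [← whisker_exchange]; monoidal
    _ = _ := by rw [ev_zigzag P]; monoidal

theorem transpose_ev' {W Z : C} (e : Z ⊗ W ⟶ 𝟙_ C) :
    Z ◁ (𝟙 W ⊗≫ P.coev' Z ▷ W ⊗≫ P.dual Z ◁ e ⊗≫ 𝟙 (P.dual Z)) ≫ P.ev' Z = e := by
  calc
    _ = 𝟙 _ ⊗≫ Z ◁ P.coev' Z ▷ W ⊗≫ ((Z ⊗ P.dual Z) ◁ e ≫ P.ev' Z ▷ 𝟙_ C) ⊗≫ 𝟙 _ := by monoidal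
    _ = 𝟙 _ ⊗≫ (𝟙 Z ⊗≫ Z ◁ P.coev' Z ⊗≫ P.ev' Z ▷ Z ⊗≫ 𝟙 Z) ▷ W ⊗≫ e ⊗≫ 𝟙 _ := by
        rw [whisker_exchange]; monoidal
    _ = _ := by rw [ev'_zigzag' P]; monoidal

theorem dualTensor_ev (X Y : C) : P.dualTensor X Y ▷ (Y ⊗ X) ≫ P.ev (Y ⊗ X) = P.ev₂ X Y := by
  rw [← P.transpose_ev (P.ev₂ X Y)]
  congr 2
  rw [dualTensor, ev₂]
  monoidal

/-- As for morphisms, `dual_tensor` replaces the left-dual form of the comparison by the right-dual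
one. -/
theorem dualTensor_ev' (X Y : C) : (Y ⊗ X) ◁ P.dualTensor X Y ≫ P.ev' (Y ⊗ X) = P.ev₂' X Y := by
  have : P.dualTensor X Y = 𝟙 (P.dual X ⊗ P.dual Y) ⊗≫ P.coev' (Y ⊗ X) ▷ (P.dual X ⊗ P.dual Y) ⊗≫
        ((P.dual (Y ⊗ X) ⊗ Y) ◁ P.ev' X) ▷ P.dual Y ⊗≫
        P.dual (Y ⊗ X) ◁ P.ev' Y ⊗≫ 𝟙 (P.dual (Y ⊗ X)) := P.dual_tensor X Y
  rw [← P.transpose_ev' (P.ev₂' X Y), this]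
  congr 2
  rw [ev₂']
  monoidal

/-- The section comes from bending $\mathrm{ev}_{Y\otimes X}$ first along $X$, then along $Y$. A
one-sided inverse is all that rotations need. -/
theorem exists_comp_dualTensor_eq_id (X Y : C) :
    ∃ K : P.dual (Y ⊗ X) ⟶ P.dual X ⊗ P.dual Y, K ≫ P.dualTensor X Y = 𝟙 _ := by
  obtain ⟨K₁, h₁⟩ := P.exists_ev_unit ((α_ (P.dual (Y ⊗ X)) Y X).hom ≫ P.ev (Y ⊗ X))
  obtain ⟨K, h₂⟩ := P.exists_ev K₁
  refine ⟨K, P.ev_hom_ext_unit ?_⟩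
  rw [comp_whiskerRight, Category.assoc, dualTensor_ev, ev₂, id_whiskerRight, Category.id_comp]
  calc
    _ = 𝟙 _ ⊗≫ (K ▷ Y ⊗≫ P.dual X ◁ P.ev Y ⊗≫ 𝟙 (P.dual X)) ▷ X ⊗≫ P.ev X := by monoidal
    _ = (α_ _ _ _).inv ≫ K₁ ▷ X ≫ P.ev X := by rw [h₂]; monoidal
    _ = _ := by rw [h₁]; simp

/-- The left and the right rotation of a morphism `A ⊗ X ⟶ Y ⊗ B` by half a turn agree. -/
theorem exists_rotation (f : A ⊗ X ⟶ Y ⊗ B) :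
    ∃ N : P.dual B ⊗ P.dual Y ⟶ P.dual X ⊗ P.dual A,
      N ▷ (A ⊗ X) ≫ P.ev₂ X A = (P.dual B ⊗ P.dual Y) ◁ f ≫ P.ev₂ B Y ∧
      (A ⊗ X) ◁ N ≫ P.ev₂' X A = f ▷ (P.dual B ⊗ P.dual Y) ≫ P.ev₂' B Y := by
  obtain ⟨K, hK⟩ := P.exists_comp_dualTensor_eq_id X A
  -- The rotation is the dual of $f$, conjugated by the comparisons of duals of products; both
  -- evaluations see the same dual morphism.
  refine ⟨P.dualTensor B Y ≫ P.dualMap f ≫ K, ?_, ?_⟩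
  · rw [← dualTensor_ev, ← dualTensor_ev, ← comp_whiskerRight_assoc, Category.assoc, Category.assoc,
      hK, Category.comp_id, comp_whiskerRight, Category.assoc, dualMap_ev, ← whisker_exchange_assoc]
  · rw [← dualTensor_ev', ← dualTensor_ev', ← MonoidalCategory.whiskerLeft_comp_assoc,
      Category.assoc, Category.assoc, hK, Category.comp_id, MonoidalCategory.whiskerLeft_comp,
      Category.assoc, dualMap_ev', whisker_exchange_assoc]

end Mates

end PivotalStructure

/-! ### Invertibility of mates -/

namespace PivotalStructure

variable {C : Type u} [Category.{v} C] [MonoidalCategory C] (P : PivotalStructure C) {A E X : C}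

/-- The mate `A* ⊗ X ⟶ X ⊗ E*` of the inverse of `a : A ⊗ X ≅ X ⊗ E` by left duality. -/
def mateLeft (a : A ⊗ X ≅ X ⊗ E) : P.dual A ⊗ X ⟶ X ⊗ P.dual E :=
  𝟙 (P.dual A ⊗ X) ⊗≫ (P.dual A ⊗ X) ◁ P.coev E ⊗≫ P.dual A ◁ (a.inv ▷ P.dual E) ⊗≫
    P.ev A ▷ (X ⊗ P.dual E) ⊗≫ 𝟙 (X ⊗ P.dual E)

/-- The mate `X ⊗ E* ⟶ A* ⊗ X` of `a : A ⊗ X ≅ X ⊗ E` by right duality. -/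
def mateRight (a : A ⊗ X ≅ X ⊗ E) : X ⊗ P.dual E ⟶ P.dual A ⊗ X :=
  𝟙 (X ⊗ P.dual E) ⊗≫ P.coev' A ▷ (X ⊗ P.dual E) ⊗≫ P.dual A ◁ (a.hom ▷ P.dual E) ⊗≫
    (P.dual A ⊗ X) ◁ P.ev' E ⊗≫ 𝟙 (P.dual A ⊗ X)

theorem mateLeft_ev (a : A ⊗ X ≅ X ⊗ E) :
    P.mateLeft a ▷ E ⊗≫ X ◁ P.ev E ⊗≫ 𝟙 X =
      𝟙 ((P.dual A ⊗ X) ⊗ E) ⊗≫ P.dual A ◁ a.inv ⊗≫ P.ev A ▷ X ⊗≫ 𝟙 X := by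
  rw [mateLeft]
  calc
    _ = 𝟙 _ ⊗≫ (P.dual A ⊗ X) ◁ P.coev E ▷ E ⊗≫ P.dual A ◁ (a.inv ▷ (P.dual E ⊗ E)) ⊗≫
      (P.ev A ▷ (X ⊗ (P.dual E ⊗ E)) ≫ 𝟙_ C ◁ (X ◁ P.ev E)) ⊗≫ 𝟙 X := by monoidal
    _ = 𝟙 _ ⊗≫ (P.dual A ⊗ X) ◁ P.coev E ▷ E ⊗≫
      P.dual A ◁ (a.inv ▷ (P.dual E ⊗ E) ≫ (A ⊗ X) ◁ P.ev E) ⊗≫ P.ev A ▷ X ⊗≫ 𝟙 X := by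
      rw [← whisker_exchange]; monoidal
    _ = 𝟙 _ ⊗≫ (P.dual A ⊗ X) ◁ (𝟙 E ⊗≫ P.coev E ▷ E ⊗≫ E ◁ P.ev E ⊗≫ 𝟙 E) ⊗≫
      P.dual A ◁ a.inv ⊗≫ P.ev A ▷ X ⊗≫ 𝟙 X := by rw [← whisker_exchange]; monoidal
    _ = _ := by rw [ev_zigzag P]; monoidal

theorem mateRight_ev' (a : A ⊗ X ≅ X ⊗ E) :
    A ◁ P.mateRight a ⊗≫ P.ev' A ▷ X ⊗≫ 𝟙 X =
      𝟙 (A ⊗ (X ⊗ P.dual E)) ⊗≫ a.hom ▷ P.dual E ⊗≫ X ◁ P.ev' E ⊗≫ 𝟙 X := by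
  rw [mateRight]
  calc
    _ = 𝟙 _ ⊗≫ A ◁ P.coev' A ▷ (X ⊗ P.dual E) ⊗≫ (A ⊗ P.dual A) ◁ (a.hom ▷ P.dual E) ⊗≫
      ((A ⊗ P.dual A) ◁ (X ◁ P.ev' E) ≫ P.ev' A ▷ (X ⊗ 𝟙_ C)) ⊗≫ 𝟙 X := by monoidal
    _ = 𝟙 _ ⊗≫ A ◁ P.coev' A ▷ (X ⊗ P.dual E) ⊗≫
      ((A ⊗ P.dual A) ◁ a.hom ≫ P.ev' A ▷ (X ⊗ E)) ▷ P.dual E ⊗≫ X ◁ P.ev' E ⊗≫ 𝟙 X := by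
      rw [whisker_exchange]; monoidal
    _ = 𝟙 _ ⊗≫ (𝟙 A ⊗≫ A ◁ P.coev' A ⊗≫ P.ev' A ▷ A ⊗≫ 𝟙 A) ▷ (X ⊗ P.dual E) ⊗≫
      a.hom ▷ P.dual E ⊗≫ X ◁ P.ev' E ⊗≫ 𝟙 X := by rw [whisker_exchange]; monoidal
    _ = _ := by rw [ev'_zigzag' P]; monoidal

section Inverse

variable {P} {a : A ⊗ X ≅ X ⊗ E} {b : E ⊗ P.dual X ≅ P.dual X ⊗ A}

theorem inv_ev'_of_hom
    (hs : a.hom ▷ P.dual X ⊗≫ X ◁ b.hom ⊗≫ P.ev' X ▷ A ⊗≫ 𝟙 A = 𝟙 _ ⊗≫ A ◁ P.ev' X ⊗≫ 𝟙 A) :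
    a.inv ▷ P.dual X ⊗≫ A ◁ P.ev' X ⊗≫ 𝟙 A =
      𝟙 ((X ⊗ E) ⊗ P.dual X) ⊗≫ X ◁ b.hom ⊗≫ P.ev' X ▷ A ⊗≫ 𝟙 A := by
  calc
    _ = a.inv ▷ P.dual X ≫ (𝟙 _ ⊗≫ A ◁ P.ev' X ⊗≫ 𝟙 A) := by monoidal
    _ = (a.inv ≫ a.hom) ▷ P.dual X ⊗≫ X ◁ b.hom ⊗≫ P.ev' X ▷ A ⊗≫ 𝟙 A := by rw [← hs]; monoidal
    _ = _ := by rw [a.inv_hom_id]; monoidal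

theorem inv_ev_of_hom
    (ht : b.hom ▷ X ⊗≫ P.dual X ◁ a.hom ⊗≫ P.ev X ▷ E ⊗≫ 𝟙 E = 𝟙 _ ⊗≫ E ◁ P.ev X ⊗≫ 𝟙 E) :
    b.inv ▷ X ⊗≫ E ◁ P.ev X ⊗≫ 𝟙 E =
      𝟙 ((P.dual X ⊗ A) ⊗ X) ⊗≫ P.dual X ◁ a.hom ⊗≫ P.ev X ▷ E ⊗≫ 𝟙 E := by
  calc
    _ = b.inv ▷ X ≫ (𝟙 _ ⊗≫ E ◁ P.ev X ⊗≫ 𝟙 E) := by monoidal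
    _ = (b.inv ≫ b.hom) ▷ X ⊗≫ P.dual X ◁ a.hom ⊗≫ P.ev X ▷ E ⊗≫ 𝟙 E := by rw [← ht]; monoidal
    _ = _ := by rw [b.inv_hom_id]; monoidal

/-- The half turn of $a$ has two readings: through $\widetilde{\mathrm{ev}}$ it is the partly
rotated right mate of $a$, through $\mathrm{ev}$ it is the partly rotated $b^{-1}$. -/
theorem exists_rotation_mateRight
    (ht : b.hom ▷ X ⊗≫ P.dual X ◁ a.hom ⊗≫ P.ev X ▷ E ⊗≫ 𝟙 E = 𝟙 _ ⊗≫ E ◁ P.ev X ⊗≫ 𝟙 E) :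
    ∃ N : P.dual E ⊗ P.dual X ⟶ P.dual X ⊗ P.dual A,
      X ◁ N ⊗≫ P.ev' X ▷ P.dual A ⊗≫ 𝟙 (P.dual A) =
        𝟙 _ ⊗≫ P.mateRight a ▷ P.dual X ⊗≫ P.dual A ◁ P.ev' X ⊗≫ 𝟙 (P.dual A) ∧
      N ▷ A ⊗≫ P.dual X ◁ P.ev A ⊗≫ 𝟙 (P.dual X) =
        𝟙 _ ⊗≫ P.dual E ◁ b.inv ⊗≫ P.ev E ▷ P.dual X ⊗≫ 𝟙 (P.dual X) := by
  obtain ⟨N, h₁, h₂⟩ := P.exists_rotation a.hom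
  refine ⟨N, P.ev'_hom_ext_left_unit ?_, P.ev_hom_ext_unit ?_⟩
  · calc
      _ = (α_ _ _ _).inv ≫ (A ⊗ X) ◁ N ≫ P.ev₂' X A := by rw [ev₂']; monoidal
      _ = 𝟙 _ ⊗≫ (𝟙 (A ⊗ (X ⊗ P.dual E)) ⊗≫ a.hom ▷ P.dual E ⊗≫ X ◁ P.ev' E ⊗≫ 𝟙 X) ▷ P.dual X ⊗≫
          P.ev' X := by rw [h₂, ev₂']; monoidal
      _ = 𝟙 _ ⊗≫ A ◁ P.mateRight a ▷ P.dual X ⊗≫ (P.ev' A ▷ (X ⊗ P.dual X) ≫ 𝟙_ C ◁ P.ev' X) ⊗≫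
          𝟙 _ := by rw [← mateRight_ev']; monoidal
      _ = _ := by rw [← whisker_exchange]; monoidal
  · calc
      _ = (α_ _ _ _).hom ≫ N ▷ (A ⊗ X) ≫ P.ev₂ X A := by rw [ev₂]; monoidal
      _ = 𝟙 _ ⊗≫ P.dual E ◁ (𝟙 ((P.dual X ⊗ A) ⊗ X) ⊗≫ P.dual X ◁ a.hom ⊗≫ P.ev X ▷ E ⊗≫ 𝟙 E) ⊗≫
          P.ev E := by
        rw [h₁, ev₂]; monoidal
      _ = 𝟙 _ ⊗≫ P.dual E ◁ b.inv ▷ X ⊗≫ ((P.dual E ⊗ E) ◁ P.ev X ≫ P.ev E ▷ 𝟙_ C) ⊗≫ 𝟙 _ := by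
        rw [← inv_ev_of_hom ht]; monoidal
      _ = _ := by rw [whisker_exchange]; monoidal

/-- The counterpart for $a^{-1}$, whose half turn reads as the left mate of $a$ and as $b$. -/
theorem exists_rotation_mateLeft
    (hs : a.hom ▷ P.dual X ⊗≫ X ◁ b.hom ⊗≫ P.ev' X ▷ A ⊗≫ 𝟙 A = 𝟙 _ ⊗≫ A ◁ P.ev' X ⊗≫ 𝟙 A) :
    ∃ N : P.dual X ⊗ P.dual A ⟶ P.dual E ⊗ P.dual X,
      N ▷ X ⊗≫ P.dual E ◁ P.ev X ⊗≫ 𝟙 (P.dual E) =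
        𝟙 _ ⊗≫ P.dual X ◁ P.mateLeft a ⊗≫ P.ev X ▷ P.dual E ⊗≫ 𝟙 (P.dual E) ∧
      E ◁ N ⊗≫ P.ev' E ▷ P.dual X ⊗≫ 𝟙 (P.dual X) =
        𝟙 _ ⊗≫ b.hom ▷ P.dual A ⊗≫ P.dual X ◁ P.ev' A ⊗≫ 𝟙 (P.dual X) := by
  obtain ⟨N, h₁, h₂⟩ := P.exists_rotation a.inv
  refine ⟨N, P.ev_hom_ext_unit ?_, P.ev'_hom_ext_left_unit ?_⟩
  · calc
      _ = (α_ _ _ _).hom ≫ N ▷ (X ⊗ E) ≫ P.ev₂ E X := by rw [ev₂]; monoidal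
      _ = 𝟙 _ ⊗≫ P.dual X ◁ (𝟙 ((P.dual A ⊗ X) ⊗ E) ⊗≫ P.dual A ◁ a.inv ⊗≫ P.ev A ▷ X ⊗≫ 𝟙 X) ⊗≫
          P.ev X := by rw [h₁, ev₂]; monoidal
      _ = 𝟙 _ ⊗≫ P.dual X ◁ P.mateLeft a ▷ E ⊗≫ ((P.dual X ⊗ X) ◁ P.ev E ≫ P.ev X ▷ 𝟙_ C) ⊗≫
          𝟙 _ := by rw [← mateLeft_ev]; monoidal
      _ = _ := by rw [whisker_exchange]; monoidal
  · calc
      _ = (α_ _ _ _).inv ≫ (X ⊗ E) ◁ N ≫ P.ev₂' E X := by rw [ev₂']; monoidal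
      _ = 𝟙 _ ⊗≫ (a.inv ▷ P.dual X ⊗≫ A ◁ P.ev' X ⊗≫ 𝟙 A) ▷ P.dual A ⊗≫ P.ev' A := by
        rw [h₂, ev₂']; monoidal
      _ = 𝟙 _ ⊗≫ X ◁ b.hom ▷ P.dual A ⊗≫ (P.ev' X ▷ (A ⊗ P.dual A) ≫ 𝟙_ C ◁ P.ev' A) ⊗≫ 𝟙 _ := by
        rw [inv_ev'_of_hom hs]; monoidal
      _ = _ := by rw [← whisker_exchange]; monoidal

/-- Paired with $E$ and $X^*$, the left mate contributes $a^{-1}$, which can be traded for $b$; the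
rotation $N$ trades the right mate for $b^{-1}$, and the two cancel. -/
theorem mateRight_mateLeft
    (hs : a.hom ▷ P.dual X ⊗≫ X ◁ b.hom ⊗≫ P.ev' X ▷ A ⊗≫ 𝟙 A = 𝟙 _ ⊗≫ A ◁ P.ev' X ⊗≫ 𝟙 A)
    (ht : b.hom ▷ X ⊗≫ P.dual X ◁ a.hom ⊗≫ P.ev X ▷ E ⊗≫ 𝟙 E = 𝟙 _ ⊗≫ E ◁ P.ev X ⊗≫ 𝟙 E) :
    P.mateRight a ≫ P.mateLeft a = 𝟙 _ := by
  obtain ⟨N, h₁, h₂⟩ := exists_rotation_mateRight ht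
  apply P.ev_hom_ext
  calc
    _ = P.mateRight a ▷ E ≫ (P.mateLeft a ▷ E ⊗≫ X ◁ P.ev E ⊗≫ 𝟙 X) := by monoidal
    _ = 𝟙 _ ⊗≫ X ◁ P.ev E ⊗≫ 𝟙 X := by
      rw [mateLeft_ev]
      apply P.ev'_hom_ext_unit
      calc
        _ = P.mateRight a ▷ E ▷ P.dual X ⊗≫ P.dual A ◁ a.inv ▷ P.dual X ⊗≫
            (P.ev A ▷ (X ⊗ P.dual X) ≫ 𝟙_ C ◁ P.ev' X) ⊗≫ 𝟙 _ := by monoidal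
        _ = P.mateRight a ▷ E ▷ P.dual X ⊗≫ P.dual A ◁ (a.inv ▷ P.dual X ⊗≫ A ◁ P.ev' X ⊗≫ 𝟙 A) ⊗≫
            P.ev A ⊗≫ 𝟙 _ := by rw [← whisker_exchange]; monoidal
        _ = 𝟙 _ ⊗≫ (P.mateRight a ▷ (E ⊗ P.dual X) ≫ (P.dual A ⊗ X) ◁ b.hom) ⊗≫
            P.dual A ◁ P.ev' X ▷ A ⊗≫ P.ev A ⊗≫ 𝟙 _ := by rw [inv_ev'_of_hom hs]; monoidal
        _ = 𝟙 _ ⊗≫ (X ⊗ P.dual E) ◁ b.hom ⊗≫ (𝟙 (X ⊗ P.dual E ⊗ P.dual X) ⊗≫ P.mateRight a ▷ P.dual X ⊗≫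
              P.dual A ◁ P.ev' X ⊗≫ 𝟙 (P.dual A)) ▷ A ⊗≫ P.ev A ⊗≫ 𝟙 _ := by
            rw [← whisker_exchange]; monoidal
        _ = 𝟙 _ ⊗≫ (X ⊗ P.dual E) ◁ b.hom ⊗≫ X ◁ N ▷ A ⊗≫
              (P.ev' X ▷ (P.dual A ⊗ A) ≫ 𝟙_ C ◁ P.ev A) ⊗≫ 𝟙 _ := by rw [← h₁]; monoidal
        _ = 𝟙 _ ⊗≫ (X ⊗ P.dual E) ◁ b.hom ⊗≫ X ◁ (N ▷ A ⊗≫ P.dual X ◁ P.ev A ⊗≫ 𝟙 (P.dual X)) ⊗≫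
              P.ev' X ⊗≫ 𝟙 _ := by rw [← whisker_exchange]; monoidal
        _ = 𝟙 _ ⊗≫ (X ⊗ P.dual E) ◁ (b.hom ≫ b.inv) ⊗≫ X ◁ P.ev E ▷ P.dual X ⊗≫
              P.ev' X ⊗≫ 𝟙 _ := by rw [h₂]; monoidal
        _ = _ := by rw [b.hom_inv_id]; monoidal
    _ = _ := by monoidal

theorem mateLeft_mateRight
    (hs : a.hom ▷ P.dual X ⊗≫ X ◁ b.hom ⊗≫ P.ev' X ▷ A ⊗≫ 𝟙 A = 𝟙 _ ⊗≫ A ◁ P.ev' X ⊗≫ 𝟙 A)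
    (ht : b.hom ▷ X ⊗≫ P.dual X ◁ a.hom ⊗≫ P.ev X ▷ E ⊗≫ 𝟙 E = 𝟙 _ ⊗≫ E ◁ P.ev X ⊗≫ 𝟙 E) :
    P.mateLeft a ≫ P.mateRight a = 𝟙 _ := by
  obtain ⟨N, h₁, h₂⟩ := exists_rotation_mateLeft hs
  apply P.ev'_hom_ext_left
  calc
    _ = A ◁ P.mateLeft a ≫ (A ◁ P.mateRight a ⊗≫ P.ev' A ▷ X ⊗≫ 𝟙 X) := by monoidal
    _ = 𝟙 _ ⊗≫ P.ev' A ▷ X ⊗≫ 𝟙 X := by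
      rw [mateRight_ev']
      apply P.ev_hom_ext_left_unit
      calc
        _ = P.dual X ◁ A ◁ P.mateLeft a ⊗≫ P.dual X ◁ a.hom ▷ P.dual E ⊗≫
            ((P.dual X ⊗ X) ◁ P.ev' E ≫ P.ev X ▷ 𝟙_ C) ⊗≫ 𝟙 _ := by monoidal
        _ = P.dual X ◁ A ◁ P.mateLeft a ⊗≫ (𝟙 ((P.dual X ⊗ A) ⊗ X) ⊗≫ P.dual X ◁ a.hom ⊗≫ P.ev X ▷ E ⊗≫ 𝟙 E) ▷
            P.dual E ⊗≫ P.ev' E ⊗≫ 𝟙 _ := by rw [whisker_exchange]; monoidal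
        _ = 𝟙 _ ⊗≫ ((P.dual X ⊗ A) ◁ P.mateLeft a ≫ b.inv ▷ (X ⊗ P.dual E)) ⊗≫
            E ◁ P.ev X ▷ P.dual E ⊗≫ P.ev' E ⊗≫ 𝟙 _ := by rw [← inv_ev_of_hom ht]; monoidal
        _ = 𝟙 _ ⊗≫ b.inv ▷ (P.dual A ⊗ X) ⊗≫ E ◁ (𝟙 ((P.dual X ⊗ P.dual A) ⊗ X) ⊗≫ P.dual X ◁ P.mateLeft a ⊗≫
              P.ev X ▷ P.dual E ⊗≫ 𝟙 (P.dual E)) ⊗≫ P.ev' E ⊗≫ 𝟙 _ := by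
            rw [whisker_exchange]; monoidal
        _ = 𝟙 _ ⊗≫ b.inv ▷ (P.dual A ⊗ X) ⊗≫ E ◁ N ▷ X ⊗≫
              ((E ⊗ P.dual E) ◁ P.ev X ≫ P.ev' E ▷ 𝟙_ C) ⊗≫ 𝟙 _ := by rw [← h₁]; monoidal
        _ = 𝟙 _ ⊗≫ b.inv ▷ (P.dual A ⊗ X) ⊗≫ (E ◁ N ⊗≫ P.ev' E ▷ P.dual X ⊗≫ 𝟙 (P.dual X)) ▷ X ⊗≫
              P.ev X ⊗≫ 𝟙 _ := by rw [whisker_exchange]; monoidal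
        _ = 𝟙 _ ⊗≫ (b.inv ≫ b.hom) ▷ (P.dual A ⊗ X) ⊗≫ P.dual X ◁ P.ev' A ▷ X ⊗≫
              P.ev X ⊗≫ 𝟙 _ := by rw [h₂]; monoidal
        _ = _ := by rw [b.inv_hom_id]; monoidal
    _ = _ := by monoidal

end Inverse

end PivotalStructure

/-! ### The dual half braiding and the pivotal structure of the center -/

section Dagger

variable {C : Type u} [Category.{v} C] [MonoidalCategory C] {P : PivotalStructure C}

namespace RelHalfBraiding

variable {D : ObjectProperty C} {A : C} (s : RelHalfBraiding D A)

theorem monoidal_inv (U U' : C) (hU : D U) (hU' : D U') (h : D (U ⊗ U')) :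
    (s.β (U ⊗ U') h).inv = (α_ _ _ _).hom ≫ U ◁ (s.β U' hU').inv ≫ (α_ _ _ _).inv ≫
      (s.β U hU).inv ▷ U' ≫ (α_ _ _ _).hom := by
  rw [← cancel_epi (s.β (U ⊗ U') h).hom, Iso.hom_inv_id, s.monoidal U U' hU hU' h]
  simp

theorem naturality_inv {U U' : C} (hU : D U) (hU' : D U') (f : U ⟶ U') :
    f ▷ A ≫ (s.β U' hU').inv = (s.β U hU).inv ≫ A ◁ f := by
  rw [Iso.comp_inv_eq, Category.assoc, s.naturality hU hU' f, Iso.inv_hom_id_assoc]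

/-- Naturality along $e$ together with triviality of $\sigma$ at the unit. For $e$ an evaluation it
says that $\sigma_{U^*}$ is a reverse of $\sigma_U$. -/
theorem comp_unit {U U' : C} (hU : D U) (hU' : D U') (h : D (U ⊗ U')) (h₁ : D (𝟙_ C))
    (h₂ : D (𝟙_ C ⊗ 𝟙_ C)) (e : U ⊗ U' ⟶ 𝟙_ C) :
    (s.β U hU).hom ▷ U' ⊗≫ U ◁ (s.β U' hU').hom ⊗≫ e ▷ A ⊗≫ 𝟙 A = 𝟙 _ ⊗≫ A ◁ e ⊗≫ 𝟙 A := by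
  have e₁ := s.naturality h h₁ e
  rw [s.monoidal U U' hU hU' h, s.unit h₁ h₂] at e₁
  calc
    _ = 𝟙 _ ⊗≫ (((α_ _ _ _).inv ≫ (s.β U hU).hom ▷ U' ≫ (α_ _ _ _).hom ≫
      U ◁ (s.β U' hU').hom ≫ (α_ _ _ _).inv) ≫ e ▷ A) ⊗≫ 𝟙 A := by monoidal
    _ = _ := by rw [← e₁]; monoidal

section Mates

variable {U : C} (hU : D U)

theorem mateLeft_monoidal (U U' : C) (hU : D U) (hU' : D U') (h : D (U ⊗ U')) :
    P.mateLeft (s.β (U ⊗ U') h) = (α_ _ _ _).inv ≫ P.mateLeft (s.β U hU) ▷ U' ≫ (α_ _ _ _).hom ≫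
      U ◁ P.mateLeft (s.β U' hU') ≫ (α_ _ _ _).inv := by
  apply P.ev_hom_ext
  refine (P.mateLeft_ev _).trans ?_
  rw [s.monoidal_inv U U' hU hU' h]
  symm
  calc
    _ = 𝟙 _ ⊗≫ P.mateLeft (s.β U hU) ▷ (U' ⊗ A) ⊗≫
        U ◁ (P.mateLeft (s.β U' hU') ▷ A ⊗≫ U' ◁ P.ev A ⊗≫ 𝟙 U') ⊗≫ 𝟙 _ := by monoidal
    _ = 𝟙 _ ⊗≫ (P.mateLeft (s.β U hU) ▷ (U' ⊗ A) ≫ (U ⊗ P.dual A) ◁ (s.β U' hU').inv) ⊗≫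
        U ◁ P.ev A ▷ U' ⊗≫ 𝟙 _ := by rw [P.mateLeft_ev]; monoidal
    _ = 𝟙 _ ⊗≫ (P.dual A ⊗ U) ◁ (s.β U' hU').inv ⊗≫
        (P.mateLeft (s.β U hU) ▷ A ⊗≫ U ◁ P.ev A ⊗≫ 𝟙 U) ▷ U' ⊗≫ 𝟙 _ := by
        rw [← whisker_exchange]; monoidal
    _ = _ := by rw [P.mateLeft_ev]; monoidal

theorem mateLeft_naturality {U U' : C} (hU : D U) (hU' : D U') (f : U ⟶ U') :
    P.dual A ◁ f ≫ P.mateLeft (s.β U' hU') = P.mateLeft (s.β U hU) ≫ f ▷ P.dual A := by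
  apply P.ev_hom_ext
  calc
    _ = (P.dual A ◁ f) ▷ A ≫ (P.mateLeft (s.β U' hU') ▷ A ⊗≫ U' ◁ P.ev A ⊗≫ 𝟙 U') := by monoidal
    _ = 𝟙 _ ⊗≫ P.dual A ◁ (f ▷ A ≫ (s.β U' hU').inv) ⊗≫ P.ev A ▷ U' ⊗≫ 𝟙 _ := by
      rw [P.mateLeft_ev]; monoidal
    _ = 𝟙 _ ⊗≫ P.dual A ◁ (s.β U hU).inv ⊗≫ ((P.dual A ⊗ A) ◁ f ≫ P.ev A ▷ U') ⊗≫ 𝟙 _ := by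
      rw [s.naturality_inv hU hU' f]; monoidal
    _ = (𝟙 ((P.dual A ⊗ U) ⊗ A) ⊗≫ P.dual A ◁ (s.β U hU).inv ⊗≫ P.ev A ▷ U ⊗≫ 𝟙 U) ≫ f := by
      rw [whisker_exchange]; monoidal
    _ = P.mateLeft (s.β U hU) ▷ A ⊗≫ (U ◁ P.ev A ≫ f ▷ 𝟙_ C) ⊗≫ 𝟙 _ := by
      rw [← P.mateLeft_ev]; monoidal
    _ = _ := by rw [whisker_exchange]; monoidal

theorem ev_comm : P.ev A ▷ U ≫ (λ_ U).hom ≫ (ρ_ U).inv =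
    ((α_ _ _ _).hom ≫ P.dual A ◁ (s.β U hU).hom ≫ (α_ _ _ _).inv ≫ P.mateLeft (s.β U hU) ▷ A ≫
      (α_ _ _ _).hom) ≫ U ◁ P.ev A := by
  symm
  calc
    _ = 𝟙 _ ⊗≫ P.dual A ◁ (s.β U hU).hom ⊗≫
        (P.mateLeft (s.β U hU) ▷ A ⊗≫ U ◁ P.ev A ⊗≫ 𝟙 U) ⊗≫ 𝟙 _ := by monoidal
    _ = 𝟙 _ ⊗≫ P.dual A ◁ ((s.β U hU).hom ≫ (s.β U hU).inv) ⊗≫ P.ev A ▷ U ⊗≫ 𝟙 _ := by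
      rw [P.mateLeft_ev]; monoidal
    _ = _ := by rw [Iso.hom_inv_id]; monoidal

theorem coev_comm : P.coev A ▷ U ≫ ((α_ _ _ _).hom ≫ A ◁ P.mateLeft (s.β U hU) ≫ (α_ _ _ _).inv ≫
      (s.β U hU).hom ▷ P.dual A ≫ (α_ _ _ _).hom) =
    ((λ_ U).hom ≫ (ρ_ U).inv) ≫ U ◁ P.coev A := by
  rw [← cancel_mono (α_ _ _ _).inv]
  apply P.ev_hom_ext
  calc
    _ = 𝟙 _ ⊗≫ P.coev A ▷ (U ⊗ A) ⊗≫ A ◁ P.mateLeft (s.β U hU) ▷ A ⊗≫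
        ((s.β U hU).hom ▷ (P.dual A ⊗ A) ≫ (U ⊗ A) ◁ P.ev A) ⊗≫ 𝟙 _ := by monoidal
    _ = 𝟙 _ ⊗≫ P.coev A ▷ (U ⊗ A) ⊗≫ A ◁ (P.mateLeft (s.β U hU) ▷ A ⊗≫ U ◁ P.ev A ⊗≫ 𝟙 U) ⊗≫
        (s.β U hU).hom ⊗≫ 𝟙 _ := by rw [← whisker_exchange]; monoidal
    _ = 𝟙 _ ⊗≫ (P.coev A ▷ (U ⊗ A) ≫ (A ⊗ P.dual A) ◁ (s.β U hU).inv) ⊗≫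
        A ◁ P.ev A ▷ U ⊗≫ (s.β U hU).hom ⊗≫ 𝟙 _ := by rw [P.mateLeft_ev]; monoidal
    _ = 𝟙 _ ⊗≫ (s.β U hU).inv ⊗≫ (𝟙 A ⊗≫ P.coev A ▷ A ⊗≫ A ◁ P.ev A ⊗≫ 𝟙 A) ▷ U ⊗≫
        (s.β U hU).hom ⊗≫ 𝟙 _ := by rw [← whisker_exchange]; monoidal
    _ = 𝟙 _ ⊗≫ ((s.β U hU).inv ≫ (s.β U hU).hom) ⊗≫ 𝟙 _ := by rw [ev_zigzag P]; monoidal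
    _ = 𝟙 _ ⊗≫ U ◁ (𝟙 A ⊗≫ P.coev A ▷ A ⊗≫ A ◁ P.ev A ⊗≫ 𝟙 A) ⊗≫ 𝟙 _ := by
      rw [Iso.inv_hom_id, ev_zigzag P]; monoidal
    _ = _ := by monoidal

/-- Unlike $\mathrm{ev}$ and $\mathrm{coev}$, the right evaluation and coevaluation commute with the
half braidings only because the left mate is inverse to the right mate. -/
theorem ev'_comm (H : P.mateLeft (s.β U hU) ≫ P.mateRight (s.β U hU) = 𝟙 _) :
    P.ev' A ▷ U ≫ (λ_ U).hom ≫ (ρ_ U).inv =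
    ((α_ _ _ _).hom ≫ A ◁ P.mateLeft (s.β U hU) ≫ (α_ _ _ _).inv ≫
      (s.β U hU).hom ▷ P.dual A ≫ (α_ _ _ _).hom) ≫ U ◁ P.ev' A := by
  symm
  calc
    _ = 𝟙 _ ⊗≫ A ◁ P.mateLeft (s.β U hU) ⊗≫ (𝟙 (A ⊗ (U ⊗ P.dual A)) ⊗≫
        (s.β U hU).hom ▷ P.dual A ⊗≫ U ◁ P.ev' A ⊗≫ 𝟙 U) ⊗≫ 𝟙 _ := by monoidal
    _ = 𝟙 _ ⊗≫ A ◁ (P.mateLeft (s.β U hU) ≫ P.mateRight (s.β U hU)) ⊗≫ P.ev' A ▷ U ⊗≫ 𝟙 _ := by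
      rw [← P.mateRight_ev']; monoidal
    _ = _ := by rw [H]; monoidal

theorem coev'_comm (H : P.mateRight (s.β U hU) ≫ P.mateLeft (s.β U hU) = 𝟙 _) :
    P.coev' A ▷ U ≫ ((α_ _ _ _).hom ≫ P.dual A ◁ (s.β U hU).hom ≫ (α_ _ _ _).inv ≫
      P.mateLeft (s.β U hU) ▷ A ≫ (α_ _ _ _).hom) =
    ((λ_ U).hom ≫ (ρ_ U).inv) ≫ U ◁ P.coev' A := by
  have key : P.coev' A ▷ U ⊗≫ P.dual A ◁ (s.β U hU).hom =
      𝟙 (𝟙_ C ⊗ U) ⊗≫ U ◁ P.coev' A ⊗≫ P.mateRight (s.β U hU) ▷ A ⊗≫ 𝟙 (P.dual A ⊗ (U ⊗ A)) := by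
    apply P.ev'_hom_ext_left
    calc
      _ = 𝟙 _ ⊗≫ A ◁ P.coev' A ▷ U ⊗≫
          ((A ⊗ P.dual A) ◁ (s.β U hU).hom ≫ P.ev' A ▷ (U ⊗ A)) ⊗≫ 𝟙 _ := by monoidal
      _ = 𝟙 _ ⊗≫ (𝟙 A ⊗≫ A ◁ P.coev' A ⊗≫ P.ev' A ▷ A ⊗≫ 𝟙 A) ▷ U ⊗≫ (s.β U hU).hom ⊗≫ 𝟙 _ := by
        rw [whisker_exchange]; monoidal
      _ = 𝟙 _ ⊗≫ (s.β U hU).hom ⊗≫ U ◁ (𝟙 A ⊗≫ A ◁ P.coev' A ⊗≫ P.ev' A ▷ A ⊗≫ 𝟙 A) ⊗≫ 𝟙 _ := by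
        rw [ev'_zigzag' P]; monoidal
      _ = 𝟙 _ ⊗≫ ((s.β U hU).hom ▷ 𝟙_ C ≫ (U ⊗ A) ◁ P.coev' A) ⊗≫ U ◁ P.ev' A ▷ A ⊗≫ 𝟙 _ := by
        monoidal
      _ = 𝟙 _ ⊗≫ (A ⊗ U) ◁ P.coev' A ⊗≫ (𝟙 (A ⊗ (U ⊗ P.dual A)) ⊗≫
        (s.β U hU).hom ▷ P.dual A ⊗≫ U ◁ P.ev' A ⊗≫ 𝟙 U) ▷ A ⊗≫ 𝟙 _ := by
        rw [← whisker_exchange]; monoidal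
      _ = _ := by rw [← P.mateRight_ev']; monoidal
  calc
    _ = (P.coev' A ▷ U ⊗≫ P.dual A ◁ (s.β U hU).hom) ⊗≫ P.mateLeft (s.β U hU) ▷ A ⊗≫ 𝟙 _ := by
      monoidal
    _ = 𝟙 _ ⊗≫ U ◁ P.coev' A ⊗≫ (P.mateRight (s.β U hU) ≫ P.mateLeft (s.β U hU)) ▷ A ⊗≫ 𝟙 _ := by
      rw [key]; monoidal
    _ = _ := by rw [H]; monoidal

end Mates

end RelHalfBraiding

variable {G : Type w} [Group G] [Preadditive C] {𝒞 : G → ObjectProperty C}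

theorem IsPivotalGGraded.one_mem_tensor (h : IsPivotalGGraded P 𝒞) {U U' : C} (hU : 𝒞 1 U)
    (hU' : 𝒞 1 U') : 𝒞 1 (U ⊗ U') := by
  have := h.tensor_mem hU hU'
  rwa [mul_one] at this

/-- The half braiding `σ†` on `A*`. -/
def RelHalfBraiding.dagger (h : IsPivotalGGraded P 𝒞) {A : C} (s : RelHalfBraiding (𝒞 1) A) :
    RelHalfBraiding (𝒞 1) (P.dual A) where
  β U hU :=
    have hd := h.dual_mem_one hU
    -- The relations `hs` and `ht` are those of a reverse $b=\sigma_{U^*}$ of $a=\sigma_U$.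
    have hs := s.comp_unit hU hd (h.one_mem_tensor hU hd) h.unit_mem
      (h.one_mem_tensor h.unit_mem h.unit_mem) (P.ev' U)
    have ht := s.comp_unit hd hU (h.one_mem_tensor hd hU) h.unit_mem
      (h.one_mem_tensor h.unit_mem h.unit_mem) (P.ev U)
    { hom := P.mateLeft (s.β U hU)
      inv := P.mateRight (s.β U hU)
      hom_inv_id := PivotalStructure.mateLeft_mateRight hs ht
      inv_hom_id := PivotalStructure.mateRight_mateLeft hs ht }
  monoidal U U' hU hU' hUU' := s.mateLeft_monoidal U U' hU hU' hUU'
  naturality hU hU' f := s.mateLeft_naturality hU hU' f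

/-- The pivotal structure of the `G`-center. -/
def centerPivotal (h : IsPivotalGGraded P 𝒞) : CenterPivotal (𝒞 1) P where
  dagger A := A.hb.dagger h
  dagger_hom _ _ _ := rfl
  ev_isHom A U hU := (A.hb.ev_comm hU).trans
    (congrArg (fun z => z ≫ U ◁ P.ev A.X)
      (RelCenter.tensorObj'_σ_hom ⟨P.dual A.X, A.hb.dagger h⟩ A U hU).symm)
  coev_isHom A U hU := (congrArg (fun z => P.coev A.X ▷ U ≫ z)
    (RelCenter.tensorObj'_σ_hom A ⟨P.dual A.X, A.hb.dagger h⟩ U hU)).trans (A.hb.coev_comm hU)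
  ev'_isHom A U hU := (A.hb.ev'_comm hU ((A.hb.dagger h).β U hU).hom_inv_id).trans
    (congrArg (fun z => z ≫ U ◁ P.ev' A.X)
      (RelCenter.tensorObj'_σ_hom A ⟨P.dual A.X, A.hb.dagger h⟩ U hU).symm)
  coev'_isHom A U hU := (congrArg (fun z => P.coev' A.X ▷ U ≫ z)
    (RelCenter.tensorObj'_σ_hom ⟨P.dual A.X, A.hb.dagger h⟩ A U hU)).trans
      (A.hb.coev'_comm hU ((A.hb.dagger h).β U hU).inv_hom_id)

end Dagger

/-! ### Pivotality of the crossing -/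

section PivotalCrossing

open Functor.LaxMonoidal Functor.OplaxMonoidal

variable {C : Type u} [Category.{v} C] [MonoidalCategory C] {P : PivotalStructure C}

theorem PivotalStructure.transpose_comp_ev (P : PivotalStructure C) {W Z : C}
    (e : W ⊗ Z ⟶ 𝟙_ C) :
    ((ρ_ W).inv ≫ W ◁ P.coev Z ≫ (α_ _ _ _).inv ≫ e ▷ P.dual Z ≫ (λ_ _).hom) ▷ Z ≫ P.ev Z = e := by
  rw [← P.transpose_ev e]
  congr 2
  rw [P.transpose_ev]
  monoidal

theorem PivotalStructure.transpose_comp_ev' (P : PivotalStructure C) {W Z : C}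
    (e : Z ⊗ W ⟶ 𝟙_ C) :
    Z ◁ ((λ_ W).inv ≫ P.coev' Z ▷ W ≫ (α_ _ _ _).hom ≫ P.dual Z ◁ e ≫ (ρ_ _).hom) ≫ P.ev' Z =
      e := by
  rw [← P.transpose_ev' e]
  congr 2
  rw [P.transpose_ev']
  monoidal

/-- With $t$ the transfer of $A^*$ and $m$ the image of $\mathrm{ev}_A$, the comparison built from
left duality turns $t$ into the left mate of the transfer $a$ of $A$. -/
theorem PivotalStructure.comp_whiskerLeft_eq_mateLeft {A E E' X : C} (a : A ⊗ X ≅ X ⊗ E)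
    (t : P.dual A ⊗ X ⟶ X ⊗ E') {m : E' ⊗ E ⟶ 𝟙_ C} {l : E' ⟶ P.dual E}
    (hl : l ▷ E ≫ P.ev E = m)
    (hm : ((α_ _ _ _).hom ≫ P.dual A ◁ a.hom ≫ (α_ _ _ _).inv ≫ t ▷ E ≫ (α_ _ _ _).hom) ≫ X ◁ m =
      P.ev A ▷ X ≫ (λ_ X).hom ≫ (ρ_ X).inv) :
    t ≫ X ◁ l = P.mateLeft a := by
  apply P.ev_hom_ext
  rw [P.mateLeft_ev]
  have hm' : P.dual A ◁ a.hom ⊗≫ t ▷ E ⊗≫ X ◁ m ⊗≫ 𝟙 X = 𝟙 _ ⊗≫ P.ev A ▷ X ⊗≫ 𝟙 X := by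
    calc
      _ = 𝟙 _ ⊗≫ (((α_ _ _ _).hom ≫ P.dual A ◁ a.hom ≫ (α_ _ _ _).inv ≫ t ▷ E ≫ (α_ _ _ _).hom) ≫
        X ◁ m) ⊗≫ 𝟙 _ := by monoidal
      _ = _ := by rw [hm]; monoidal
  calc
    _ = t ▷ E ⊗≫ X ◁ (l ▷ E ≫ P.ev E) ⊗≫ 𝟙 _ := by monoidal
    _ = 𝟙 _ ⊗≫ P.dual A ◁ (a.inv ≫ a.hom) ⊗≫ t ▷ E ⊗≫ X ◁ m ⊗≫ 𝟙 _ := by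
      rw [hl, a.inv_hom_id]; monoidal
    _ = 𝟙 _ ⊗≫ P.dual A ◁ a.inv ⊗≫ (P.dual A ◁ a.hom ⊗≫ t ▷ E ⊗≫ X ◁ m ⊗≫ 𝟙 X) := by monoidal
    _ = _ := by rw [hm']; monoidal

/-- For right duality the same input only gives a right inverse of $t$ followed by the comparison,
namely the right mate. -/
theorem PivotalStructure.comp_whiskerLeft_comp_mateRight {A E E' X : C} (a : A ⊗ X ≅ X ⊗ E)
    (t : P.dual A ⊗ X ⟶ X ⊗ E') {m : E ⊗ E' ⟶ 𝟙_ C} {r : E' ⟶ P.dual E}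
    (hr : E ◁ r ≫ P.ev' E = m)
    (hm : ((α_ _ _ _).hom ≫ A ◁ t ≫ (α_ _ _ _).inv ≫ a.hom ▷ E' ≫ (α_ _ _ _).hom) ≫ X ◁ m =
      P.ev' A ▷ X ≫ (λ_ X).hom ≫ (ρ_ X).inv) :
    (t ≫ X ◁ r) ≫ P.mateRight a = 𝟙 _ := by
  apply P.ev'_hom_ext_left
  calc
    _ = A ◁ t ⊗≫ A ◁ X ◁ r ⊗≫ (A ◁ P.mateRight a ⊗≫ P.ev' A ▷ X ⊗≫ 𝟙 X) := by monoidal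
    _ = A ◁ t ⊗≫ ((A ⊗ X) ◁ r ≫ a.hom ▷ P.dual E) ⊗≫ X ◁ P.ev' E ⊗≫ 𝟙 X := by
      rw [P.mateRight_ev']; monoidal
    _ = A ◁ t ⊗≫ a.hom ▷ E' ⊗≫ X ◁ (E ◁ r ≫ P.ev' E) ⊗≫ 𝟙 X := by
      rw [whisker_exchange]; monoidal
    _ = 𝟙 _ ⊗≫ (((α_ _ _ _).hom ≫ A ◁ t ≫ (α_ _ _ _).inv ≫ a.hom ▷ E' ≫ (α_ _ _ _).hom) ≫
        X ◁ m) ⊗≫ 𝟙 _ := by rw [hr]; monoidal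
    _ = _ := by rw [hm]; monoidal

variable {G : Type w} [Group G] {𝒞 : G → ObjectProperty C}

theorem Transport.tensor_unit_intertwines {α : G} {F : GCenter 𝒞 ⥤ GCenter 𝒞} [F.Monoidal]
    (T : Transport α F) {A B : GCenter 𝒞} (e : A ⊗ B ⟶ 𝟙_ (GCenter 𝒞)) :
    ((T.transfer A).tensor (T.transfer B)).Intertwines (Transfer.unit α) e
      (μ F A B ≫ F.map e ≫ η F).f := by
  have hu := Transfer.Intertwines.inv (f := Iso.refl _)
    (g := ⟨(ε F).f, (η F).f, congrArg RelCenter.Hom.f (Functor.Monoidal.ε_η F),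
      congrArg RelCenter.Hom.f (Functor.Monoidal.η_ε F)⟩) T.unit
  exact (T.tensor A B).id_comp ((T.map e).comp_id hu)

variable [Preadditive C]

/-- Composing $t$ with a transfer of degree $\alpha^{-1}$ gives degree $1$, where descent compares
with the half braiding of $A$. The reverse of $\Gamma_V$ is that second transfer followed by this
comparison. -/
theorem Transfer.exists_reverse (h : IsPivotalGGraded P 𝒞) (hns : IsNonsingular P 𝒞) {α : G}
    {A E K : GCenter 𝒞} (t : Transfer α A E) (t' : Transfer α⁻¹ E K) (V : InvObj P 𝒞 α) :
    ∃ b : E.X ⊗ P.dual V.obj ≅ P.dual V.obj ⊗ A.X,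
      (t.Γ V.obj V.mem).hom ▷ P.dual V.obj ≫ (α_ _ _ _).hom ≫ V.obj ◁ b.hom =
        (α_ _ _ _).hom ≫ (A.hb.β _ (h.mem_one V.mem V.mem)).hom ≫ (α_ _ _ _).hom := by
  obtain ⟨g, hg⟩ := Transfer.exists_composes h hns t t'
    ((Transfer.ofHalfBraiding A).cast (mul_inv_cancel α).symm)
  have e := hg V.obj (P.dual V.obj) V.mem (h.dual_mem V.mem)
    (h.tensor_mem V.mem (h.dual_mem V.mem))
  rw [cast_Γ] at e
  refine ⟨t'.Γ _ (h.dual_mem V.mem) ≪≫ whiskerLeftIso _ ⟨g.hom.f, g.inv.f,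
    congrArg RelCenter.Hom.f g.hom_inv_id, congrArg RelCenter.Hom.f g.inv_hom_id⟩, ?_⟩
  change _ = (α_ _ _ _).hom ≫ ((Transfer.ofHalfBraiding A).Γ _ _).hom ≫ (α_ _ _ _).hom
  rw [reassoc_of% e]
  simp

theorem Transfer.reverse_ev' (h : IsPivotalGGraded P 𝒞) {α : G} {A E : GCenter 𝒞}
    (t : Transfer α A E) {V : C} (hV : 𝒞 α V) {b : E.X ⊗ P.dual V ≅ P.dual V ⊗ A.X}
    (hb : (t.Γ V hV).hom ▷ P.dual V ≫ (α_ _ _ _).hom ≫ V ◁ b.hom =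
        (α_ _ _ _).hom ≫ (A.hb.β _ (h.mem_one hV hV)).hom ≫ (α_ _ _ _).hom) :
    (t.Γ V hV).hom ▷ P.dual V ⊗≫ V ◁ b.hom ⊗≫ P.ev' V ▷ A.X ⊗≫ 𝟙 A.X =
      𝟙 _ ⊗≫ A.X ◁ P.ev' V ⊗≫ 𝟙 A.X := by
  have e := A.hb.naturality (h.mem_one hV hV) h.unit_mem (P.ev' V)
  rw [A.hb.unit h.unit_mem (h.one_mem_tensor h.unit_mem h.unit_mem)] at e
  calc
    _ = ((t.Γ V hV).hom ▷ P.dual V ≫ (α_ _ _ _).hom ≫ V ◁ b.hom) ⊗≫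
      P.ev' V ▷ A.X ⊗≫ 𝟙 A.X := by monoidal
    _ = 𝟙 _ ⊗≫ ((A.hb.β _ (h.mem_one hV hV)).hom ≫ P.ev' V ▷ A.X) ⊗≫ 𝟙 A.X := by
      rw [hb]; monoidal
    _ = _ := by rw [← e]; monoidal

/-- After tensoring with $V$, the reverse and $\Gamma_V$ combine to the transfer at $(V\otimes
V^*)\otimes V$, and naturality along $\mathrm{id}_V\otimes\mathrm{ev}_V$ finishes. -/
theorem Transfer.reverse_ev (h : IsPivotalGGraded P 𝒞) {α : G} {A E : GCenter 𝒞}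
    (t : Transfer α A E) (V : InvObj P 𝒞 α) {b : E.X ⊗ P.dual V.obj ≅ P.dual V.obj ⊗ A.X}
    (hb : (t.Γ V.obj V.mem).hom ▷ P.dual V.obj ≫ (α_ _ _ _).hom ≫ V.obj ◁ b.hom =
        (α_ _ _ _).hom ≫ (A.hb.β _ (h.mem_one V.mem V.mem)).hom ≫ (α_ _ _ _).hom) :
    b.hom ▷ V.obj ⊗≫ P.dual V.obj ◁ (t.Γ V.obj V.mem).hom ⊗≫ P.ev V.obj ▷ E.X ⊗≫ 𝟙 E.X =
      𝟙 _ ⊗≫ E.X ◁ P.ev V.obj ⊗≫ 𝟙 E.X := by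
  have hVV := h.mem_one V.mem V.mem
  have e₁ := t.tensor_left _ V.obj hVV V.mem (h.one_mul_mem hVV V.mem)
  have e₂ := t.naturality (h.one_mul_mem hVV V.mem) V.mem
    (𝟙 _ ⊗≫ V.obj ◁ P.ev V.obj ⊗≫ 𝟙 V.obj)
  apply V.whiskerLeft_injective
  rw [← cancel_epi ((t.Γ V.obj V.mem).hom ▷ ((P.dual V.obj) ⊗ V.obj) ≫ (α_ _ _ _).hom ≫
    V.obj ◁ (α_ _ _ _).inv)]
  calc
    _ = 𝟙 _ ⊗≫ ((t.Γ V.obj V.mem).hom ▷ P.dual V.obj ≫ (α_ _ _ _).hom ≫ V.obj ◁ b.hom) ▷ V.obj ⊗≫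
      V.obj ◁ P.dual V.obj ◁ (t.Γ V.obj V.mem).hom ⊗≫ V.obj ◁ P.ev V.obj ▷ E.X ⊗≫ 𝟙 _ := by monoidal
    _ = 𝟙 _ ⊗≫ (t.Γ _ (h.one_mul_mem hVV V.mem)).hom ≫
        (𝟙 _ ⊗≫ V.obj ◁ P.ev V.obj ⊗≫ 𝟙 V.obj) ▷ E.X := by
      rw [hb, e₁]; monoidal
    _ = 𝟙 _ ⊗≫ ((A.X ⊗ V.obj) ◁ P.ev V.obj ≫ (t.Γ V.obj V.mem).hom ▷ 𝟙_ C) ⊗≫ 𝟙 _ := by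
      rw [← e₂]; monoidal
    _ = _ := by rw [whisker_exchange]; monoidal

namespace TransportSystem

variable (S : TransportSystem 𝒞)

theorem isPivotalFunctor (h : IsPivotalGGraded P 𝒞) (hns : IsNonsingular P 𝒞) (α : G) :
    IsPivotalFunctor (centerPivotal h).pivotal (S.F α) := fun A => RelCenter.hom_ext _ _ <| by
  let L := (centerPivotal h).pivotal
  obtain ⟨V⟩ := hns.nonempty_invObj α
  let t := (S.transport α).transfer A
  let t' := (S.transport α).transfer (L.dual A)
  obtain ⟨b, hb⟩ := t.exists_reverse h hns ((S.transport α⁻¹).transfer ((S.F α).obj A)) V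
  have hs := t.reverse_ev' h V.mem hb
  have ht := t.reverse_ev h V hb
  let m := (μ (S.F α) (L.dual A) A ≫ (S.F α).map (L.ev A) ≫ η (S.F α)).f
  let m' := (μ (S.F α) A (L.dual A) ≫ (S.F α).map (L.ev' A) ≫ η (S.F α)).f
  have hl : (dualCompLeft L (S.F α) A).f ▷ ((S.F α).obj A).X ≫ P.ev ((S.F α).obj A).X = m :=
    P.transpose_comp_ev m
  have hr : ((S.F α).obj A).X ◁ (dualCompRight L (S.F α) A).f ≫ P.ev' ((S.F α).obj A).X = m' :=
    P.transpose_comp_ev' m'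
  have e₁ := PivotalStructure.comp_whiskerLeft_eq_mateLeft (t.Γ V.obj V.mem)
    (t'.Γ V.obj V.mem).hom hl
    ((congrArg (fun z => z ≫ V.obj ◁ m) (t'.tensorΓ_hom t V.obj V.mem).symm).trans
      ((S.transport α).tensor_unit_intertwines (L.ev A) V.obj V.mem))
  have e₂ := PivotalStructure.comp_whiskerLeft_comp_mateRight (t.Γ V.obj V.mem)
    (t'.Γ V.obj V.mem).hom hr
    ((congrArg (fun z => z ≫ V.obj ◁ m') (t.tensorΓ_hom t' V.obj V.mem).symm).trans
      ((S.transport α).tensor_unit_intertwines (L.ev' A) V.obj V.mem))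
  -- Multiplying `e₂` by the left mate shows that the comparison from right duality also turns the
  -- transfer of $A^*$ into the left mate; the transfer and $V$ then cancel.
  have e₃ := PivotalStructure.mateRight_mateLeft hs ht
  apply V.whiskerLeft_injective
  refine (cancel_epi (t'.Γ V.obj V.mem).hom).1 ?_
  refine e₁.trans ?_
  have e₄ := congrArg (fun z => z ≫ P.mateLeft (t.Γ V.obj V.mem)) e₂
  simp only [Category.assoc, e₃, Category.comp_id, Category.id_comp] at e₄
  exact e₄.symm

end TransportSystem

end PivotalCrossing

/-! ### The grading of the center -/

section CenterGrading

variable {C : Type u} [Category.{v} C] [MonoidalCategory C] [Preadditive C]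
  [MonoidalPreadditive C]

namespace RelCenter

variable {D : ObjectProperty C}

theorem sum_f {J : Type*} (s : Finset J) {A B : RelCenter D} (f : J → (A ⟶ B)) :
    (∑ j ∈ s, f j).f = ∑ j ∈ s, (f j).f :=
  map_sum (⟨⟨fun g : A ⟶ B => g.f, rfl⟩, fun _ _ => rfl⟩ : (A ⟶ B) →+ (A.X ⟶ B.X)) f s

/-- A bicone of the relative center from a bicone of underlying objects. -/
def biconeMk {J : Type*} {f : J → RelCenter D} (b : Bicone fun j => (f j).X)
    (s : RelHalfBraiding D b.pt)
    (hπ : ∀ j, IsHom ⟨b.pt, s⟩ (f j) (b.π j)) (hι : ∀ j, IsHom (f j) ⟨b.pt, s⟩ (b.ι j)) :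
    Bicone f where
  pt := ⟨b.pt, s⟩
  π j := ⟨b.π j, hπ j⟩
  ι j := ⟨b.ι j, hι j⟩
  ι_π j j' := by
    split_ifs with hj
    · subst hj
      exact hom_ext _ _ (bicone_ι_π_self b j)
    · exact hom_ext _ _ (bicone_ι_π_ne b hj)

theorem biconeMk_isBilimit {J : Type*} [Fintype J] {f : J → RelCenter D}
    (b : Bicone fun j => (f j).X) (hb : b.IsBilimit) (s : RelHalfBraiding D b.pt)
    (hπ : ∀ j, IsHom ⟨b.pt, s⟩ (f j) (b.π j)) (hι : ∀ j, IsHom (f j) ⟨b.pt, s⟩ (b.ι j)) :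
    Nonempty (biconeMk b s hπ hι).IsBilimit :=
  ⟨isBilimitOfTotal _ (hom_ext _ _ ((sum_f _ _).trans (IsBilimit.total hb)))⟩

section Biproduct

variable {J : Type*} [Fintype J] {f : J → RelCenter D} {b : Bicone fun j => (f j).X}

theorem whiskerRight_bicone_hom_ext (hb : b.IsBilimit) {U Z : C} {g g' : b.pt ⊗ U ⟶ Z}
    (H : ∀ j, b.ι j ▷ U ≫ g = b.ι j ▷ U ≫ g') : g = g' := by
  have e : ∑ j, b.π j ▷ U ≫ b.ι j ▷ U = 𝟙 (b.pt ⊗ U) := by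
    rw [← id_whiskerRight, ← IsBilimit.total hb, sum_whiskerRight]
    simp
  rw [← Category.id_comp g, ← Category.id_comp g', ← e, Preadditive.sum_comp, Preadditive.sum_comp]
  simp [H]

variable (b) in
/-- The sum of the half braidings on the summands of a biproduct. -/
def sumβ (U : C) (hU : D U) : b.pt ⊗ U ⟶ U ⊗ b.pt :=
  ∑ j, b.π j ▷ U ≫ ((f j).hb.β U hU).hom ≫ U ◁ b.ι j

theorem ι_sumβ [DecidableEq J] (U : C) (hU : D U) (j : J) :
    b.ι j ▷ U ≫ sumβ b U hU = ((f j).hb.β U hU).hom ≫ U ◁ b.ι j := by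
  rw [sumβ, Preadditive.comp_sum, Finset.sum_eq_single j]
  · rw [← comp_whiskerRight_assoc, bicone_ι_π_self, id_whiskerRight, Category.id_comp]
  · intro i _ hi
    rw [← comp_whiskerRight_assoc, bicone_ι_π_ne b hi.symm, MonoidalPreadditive.zero_whiskerRight,
      zero_comp]
  · simp

theorem sumβ_π [DecidableEq J] (U : C) (hU : D U) (j : J) :
    sumβ b U hU ≫ U ◁ b.π j = b.π j ▷ U ≫ ((f j).hb.β U hU).hom := by
  rw [sumβ, Preadditive.sum_comp, Finset.sum_eq_single j]
  · rw [Category.assoc, Category.assoc, ← MonoidalCategory.whiskerLeft_comp, bicone_ι_π_self,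
      MonoidalCategory.whiskerLeft_id, Category.comp_id]
  · intro i _ hi
    rw [Category.assoc, Category.assoc, ← MonoidalCategory.whiskerLeft_comp,
      bicone_ι_π_ne b hi, MonoidalPreadditive.whiskerLeft_zero, comp_zero, comp_zero]
  · simp

variable (b) in
/-- The inverse of the sum of half braidings. -/
def sumβInv (U : C) (hU : D U) : U ⊗ b.pt ⟶ b.pt ⊗ U :=
  ∑ j, U ◁ b.π j ≫ ((f j).hb.β U hU).inv ≫ b.ι j ▷ U

variable (b) in
/-- The half braiding on a biproduct. -/
def sumHalfBraiding [DecidableEq J] (hb : b.IsBilimit) : RelHalfBraiding D b.pt where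
  β U hU :=
    { hom := sumβ b U hU
      inv := sumβInv b U hU
      hom_inv_id := by
        rw [sumβInv, Preadditive.comp_sum]
        simp only [reassoc_of% (sumβ_π (b := b) U hU), Iso.hom_inv_id_assoc, ← comp_whiskerRight]
        rw [← sum_whiskerRight, IsBilimit.total hb, id_whiskerRight]
      inv_hom_id := by
        rw [sumβInv, Preadditive.sum_comp]
        simp only [Category.assoc, ι_sumβ (b := b) U hU, Iso.inv_hom_id_assoc,
          ← MonoidalCategory.whiskerLeft_comp]
        rw [← whiskerLeft_sum, IsBilimit.total hb, MonoidalCategory.whiskerLeft_id] }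
  monoidal U U' hU hU' h := whiskerRight_bicone_hom_ext hb fun j => by
    change b.ι j ▷ (U ⊗ U') ≫ sumβ b (U ⊗ U') h = b.ι j ▷ (U ⊗ U') ≫ (α_ _ _ _).inv ≫
      sumβ b U hU ▷ U' ≫ (α_ _ _ _).hom ≫ U ◁ sumβ b U' hU' ≫ (α_ _ _ _).inv
    rw [ι_sumβ, (f j).hb.monoidal U U' hU hU' h]
    symm
    calc
      _ = 𝟙 _ ⊗≫ (b.ι j ▷ U ≫ sumβ b U hU) ▷ U' ⊗≫ U ◁ sumβ b U' hU' ⊗≫ 𝟙 _ := by monoidal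
      _ = 𝟙 _ ⊗≫ ((f j).hb.β U hU).hom ▷ U' ⊗≫ U ◁ (b.ι j ▷ U' ≫ sumβ b U' hU') ⊗≫ 𝟙 _ := by
        rw [ι_sumβ]; monoidal
      _ = _ := by rw [ι_sumβ]; monoidal
  naturality {U U'} hU hU' g := whiskerRight_bicone_hom_ext hb fun j => by
    change b.ι j ▷ U ≫ b.pt ◁ g ≫ sumβ b U' hU' = b.ι j ▷ U ≫ sumβ b U hU ≫ g ▷ b.pt
    rw [← whisker_exchange_assoc, ι_sumβ, reassoc_of% (ι_sumβ (b := b) U hU j),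
      ← Category.assoc, (f j).hb.naturality hU hU', Category.assoc, whisker_exchange]

/-- The underlying object is kept on the nose: the classes $\mathcal C_\alpha$ need not be closed
under isomorphism, so an equality is what transports the degree. -/
theorem exists_bicone (b : Bicone fun j => (f j).X) (hb : b.IsBilimit) :
    ∃ b' : Bicone f, b'.pt.X = b.pt ∧ Nonempty b'.IsBilimit := by
  classical
  exact ⟨biconeMk b (sumHalfBraiding b hb) (fun j U hU => (sumβ_π U hU j).symm)
    (fun j U hU => ι_sumβ U hU j), rfl, biconeMk_isBilimit b hb _ _ _⟩

end Biproduct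

/-- The half braiding on a retract compatible with the half braiding of the ambient object. -/
def retractHalfBraiding (A : RelCenter D) {E : C} (i : E ⟶ A.X) (p : A.X ⟶ E) (hip : i ≫ p = 𝟙 E)
    (hi : ∀ (U : C) (hU : D U),
      i ▷ U ≫ (A.hb.β U hU).hom = (i ▷ U ≫ (A.hb.β U hU).hom ≫ U ◁ p) ≫ U ◁ i)
    (hp : ∀ (U : C) (hU : D U),
      (A.hb.β U hU).hom ≫ U ◁ p = p ▷ U ≫ (i ▷ U ≫ (A.hb.β U hU).hom ≫ U ◁ p)) :
    RelHalfBraiding D E where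
  β U hU :=
    { hom := i ▷ U ≫ (A.hb.β U hU).hom ≫ U ◁ p
      inv := U ◁ i ≫ (A.hb.β U hU).inv ≫ p ▷ U
      hom_inv_id := by
        rw [← Category.assoc, ← hi, Category.assoc, Iso.hom_inv_id_assoc, ← comp_whiskerRight, hip,
          id_whiskerRight]
      inv_hom_id := by
        rw [Category.assoc, Category.assoc, ← hp, Iso.inv_hom_id_assoc,
          ← MonoidalCategory.whiskerLeft_comp, hip, MonoidalCategory.whiskerLeft_id] }
  monoidal U U' hU hU' h := by
    change i ▷ (U ⊗ U') ≫ (A.hb.β (U ⊗ U') h).hom ≫ (U ⊗ U') ◁ p = (α_ _ _ _).inv ≫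
      (i ▷ U ≫ (A.hb.β U hU).hom ≫ U ◁ p) ▷ U' ≫ (α_ _ _ _).hom ≫
      U ◁ (i ▷ U' ≫ (A.hb.β U' hU').hom ≫ U' ◁ p) ≫ (α_ _ _ _).inv
    rw [A.hb.monoidal U U' hU hU' h]
    symm
    calc
      _ = 𝟙 _ ⊗≫ ((i ▷ U ≫ (A.hb.β U hU).hom ≫ U ◁ p) ≫ U ◁ i) ▷ U' ⊗≫
        U ◁ (A.hb.β U' hU').hom ⊗≫ U ◁ U' ◁ p ⊗≫ 𝟙 _ := by monoidal
      _ = _ := by rw [← hi]; monoidal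
  naturality {U U'} hU hU' g := by
    change E ◁ g ≫ i ▷ U' ≫ (A.hb.β U' hU').hom ≫ U' ◁ p =
      (i ▷ U ≫ (A.hb.β U hU).hom ≫ U ◁ p) ≫ g ▷ E
    rw [whisker_exchange_assoc, ← Category.assoc (A.X ◁ g), A.hb.naturality hU hU',
      Category.assoc, Category.assoc, Category.assoc, whisker_exchange]

end RelCenter

variable {P : PivotalStructure C} {G : Type w} [Group G] {𝒞 : G → ObjectProperty C}

namespace GCenter

theorem exists_additive (h : IsPivotalGGraded P 𝒞) (α : G) {n : ℕ} (f : Fin n → GCenter 𝒞)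
    (hf : ∀ i, GCenter.grading 𝒞 α (f i)) :
    ∃ b : Bicone f, GCenter.grading 𝒞 α b.pt ∧ Nonempty b.IsBilimit := by
  obtain ⟨b, hα, ⟨hb⟩⟩ := h.additive α (fun i => (f i).X) hf
  obtain ⟨b', e, hb'⟩ := RelCenter.exists_bicone b hb
  exact ⟨b', show 𝒞 α b'.pt.X from e ▸ hα, hb'⟩

theorem hasFiniteBiproducts (h : IsPivotalGGraded P 𝒞) : HasFiniteBiproducts (GCenter 𝒞) where
  out n :=
    { has_biproduct := fun f => by
        have := h.hasFiniteBiproducts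
        obtain ⟨b', _, ⟨hb'⟩⟩ := RelCenter.exists_bicone (f := f)
          (biproduct.bicone fun j => (f j).X) (biproduct.isBilimit _)
        exact ⟨⟨⟨b', hb'⟩⟩⟩ }

/-- A half braiding over $\mathcal C_1$ preserves degrees, so it is block diagonal for the
homogeneous decomposition of the underlying object and restricts to each summand. -/
theorem decomposition (h : IsPivotalGGraded P 𝒞) (A : GCenter 𝒞) :
    ∃ (s : Finset G) (f : s → GCenter 𝒞) (b : Bicone f),
      (∀ a : s, GCenter.grading 𝒞 a (f a)) ∧ Nonempty b.IsBilimit ∧ Nonempty (b.pt ≅ A) := by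
  classical
  obtain ⟨s, f, b, hf, ⟨hb⟩, ⟨e⟩⟩ := h.decomposition A.X
  let i (a : s) : f a ⟶ A.X := b.ι a ≫ e.hom
  let p (a : s) : A.X ⟶ f a := e.inv ≫ b.π a
  have hip (a : s) : i a ≫ p a = 𝟙 _ := by simp [i, p]
  have hip' {a a' : s} (ha : a ≠ a') : i a ≫ p a' = 0 := by simp [i, p, bicone_ι_π_ne b ha]
  have htot : ∑ a, p a ≫ i a = 𝟙 A.X := by
    have := congrArg (fun z => e.inv ≫ z ≫ e.hom) (IsBilimit.total hb)
    simpa [Preadditive.sum_comp, Preadditive.comp_sum, i, p] using this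
  -- The off-diagonal block goes from degree $a$ to degree $a'\ne a$.
  have h0 {a a' : s} (ha : a ≠ a') (U : C) (hU : 𝒞 1 U) :
      i a ▷ U ≫ (A.hb.β U hU).hom ≫ U ◁ p a' = 0 :=
    h.hom_eq_zero (h.mem_mul_one (hf a) hU) (h.one_mul_mem hU (hf a'))
      (fun z => ha (Subtype.ext z)) _
  have hi (a : s) (U : C) (hU : 𝒞 1 U) : i a ▷ U ≫ (A.hb.β U hU).hom =
      (i a ▷ U ≫ (A.hb.β U hU).hom ≫ U ◁ p a) ≫ U ◁ i a := by
    conv_lhs => rw [← Category.comp_id (A.hb.β U hU).hom, ← MonoidalCategory.whiskerLeft_id,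
      ← htot, whiskerLeft_sum, Preadditive.comp_sum, Preadditive.comp_sum]
    rw [Finset.sum_eq_single a]
    · simp
    · intro a' _ ha
      have := congrArg (fun z => z ≫ U ◁ i a') (h0 ha.symm U hU)
      simpa using this
    · simp
  have hp (a : s) (U : C) (hU : 𝒞 1 U) : (A.hb.β U hU).hom ≫ U ◁ p a =
      p a ▷ U ≫ (i a ▷ U ≫ (A.hb.β U hU).hom ≫ U ◁ p a) := by
    conv_lhs => rw [← Category.id_comp ((A.hb.β U hU).hom ≫ _), ← id_whiskerRight,
      ← htot, sum_whiskerRight, Preadditive.sum_comp]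
    rw [Finset.sum_eq_single a]
    · simp
    · intro a' _ ha
      have := congrArg (fun z => p a' ▷ U ≫ z) (h0 ha U hU)
      simpa using this
    · simp
  let F (a : s) : GCenter 𝒞 := ⟨f a, A.retractHalfBraiding (i a) (p a) (hip a) (hi a) (hp a)⟩
  let B : Bicone F :=
    { pt := A
      π := fun a => ⟨p a, fun U hU => (hp a U hU).symm⟩
      ι := fun a => ⟨i a, fun U hU => hi a U hU⟩
      ι_π := fun a a' => by
        split_ifs with ha
        · subst ha
          exact RelCenter.hom_ext _ _ (hip a)
        · exact RelCenter.hom_ext _ _ (hip' ha) }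
  exact ⟨s, F, B, hf, ⟨isBilimitOfTotal B
    (RelCenter.hom_ext _ _ ((RelCenter.sum_f _ _).trans htot))⟩, ⟨Iso.refl _⟩⟩

theorem isPivotalGGraded (h : IsPivotalGGraded P 𝒞) :
    IsPivotalGGraded (centerPivotal h).pivotal (GCenter.grading 𝒞) where
  hasFiniteBiproducts := hasFiniteBiproducts h
  additive α _ f hf := exists_additive h α f hf
  disjoint hX hX' := h.disjoint hX hX'
  decomposition := decomposition h
  tensor_mem hX hY := h.tensor_mem hX hY
  hom_eq_zero hX hY hne f := RelCenter.hom_ext _ _ (h.hom_eq_zero hX hY hne f.f)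
  unit_mem := h.unit_mem
  dual_mem hX := h.dual_mem hX

end GCenter

end CenterGrading

/-! ### Splittings in the prescribed degree -/

section Splittings

variable {C : Type u} [Category.{v} C] [MonoidalCategory C] [Preadditive C]
  {P : PivotalStructure C} {G : Type w} [Group G] {𝒞 : G → ObjectProperty C}

/-- A retract of a homogeneous object is isomorphic to an object of the same degree. -/
theorem IsGGraded.exists_iso_of_retract (h : IsGGraded 𝒞) {γ : G} {X E : C} (hX : 𝒞 γ X)
    (i : E ⟶ X) (p : X ⟶ E) (hip : i ≫ p = 𝟙 E) : ∃ E' : C, 𝒞 γ E' ∧ Nonempty (E ≅ E') := by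
  obtain ⟨s, f, b, hf, ⟨hb⟩, ⟨e⟩⟩ := h.decomposition E
  -- A summand of degree other than $\gamma$ has no nonzero morphism to $X$, and $E\to X$ is a split
  -- monomorphism.
  have h0 (a : s) (ha : (a : G) ≠ γ) : b.ι a = 0 := by
    have := h.hom_eq_zero (hf a) hX ha (b.ι a ≫ e.hom ≫ i)
    have := congrArg (· ≫ p) this
    simp only [Category.assoc, hip, Category.comp_id, zero_comp] at this
    rw [← cancel_mono e.hom, this, zero_comp]
  have htot := IsBilimit.total hb
  by_cases hγ : γ ∈ s
  · rw [Finset.sum_eq_single (⟨γ, hγ⟩ : s) (fun a _ ha => by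
      rw [h0 a (fun z => ha (Subtype.ext z)), comp_zero]) (by simp)] at htot
    exact ⟨f ⟨γ, hγ⟩, hf ⟨γ, hγ⟩, ⟨e.symm ≪≫ ⟨b.π _, b.ι _, htot, bicone_ι_π_self b _⟩⟩⟩
  · rw [Finset.sum_eq_zero (fun a _ => by
      rw [h0 a (fun z => hγ (z ▸ a.2)), comp_zero])] at htot
    -- Here $E$ is zero, and the empty biproduct supplies a zero object in degree $\gamma$.
    obtain ⟨b₀, hb₀, ⟨hb₀'⟩⟩ := h.additive γ (n := 0) (fun i => i.elim0) (fun i => i.elim0)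
    have htot₀ := IsBilimit.total hb₀'
    exact ⟨b₀.pt, hb₀, ⟨e.symm ≪≫ ⟨0, 0, by simpa using htot, by simpa using htot₀⟩⟩⟩

theorem exists_splitting (h : IsPivotalGGraded P 𝒞) (hns : IsNonsingular P 𝒞) {α : G}
    (V : InvObj P 𝒞 α) (A : GCenter 𝒞) :
    ∃ (E : C) (p : P.conj V.obj A.X ⟶ E) (q : E ⟶ P.conj V.obj A.X), p ≫ q = idem h V A ∧
      q ≫ p = 𝟙 E ∧ ∀ β, 𝒞 β A.X → 𝒞 (α⁻¹ * β * α) E := by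
  obtain ⟨E, q, p, hqp, hpq⟩ := hns.splitIdempotents.idempotents_split _ _
    (idem_comp_idem hns.pure V A)
  -- For non-homogeneous $A$ the degree condition is vacuous; otherwise the degree of $A$ is unique
  -- by disjointness, and the splitting object is replaced by an isomorphic one of the right degree.
  by_cases hA : ∃ β, 𝒞 β A.X
  · obtain ⟨β, hβ⟩ := hA
    obtain ⟨E', hE', ⟨e⟩⟩ := h.exists_iso_of_retract
      (h.tensor_mem (h.tensor_mem (h.dual_mem V.mem) hβ) V.mem) q p hqp
    refine ⟨E', p ≫ e.hom, e.inv ≫ q, by simpa using hpq, ?_, fun β' hβ' => ?_⟩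
    · rw [Category.assoc, reassoc_of% hqp, e.inv_hom_id]
    · rwa [h.disjoint hβ' hβ]
  · exact ⟨E, p, q, hpq, hqp, fun β hβ => absurd ⟨β, hβ⟩ hA⟩

theorem nonempty_splittingChoice (h : IsPivotalGGraded P 𝒞) (hns : IsNonsingular P 𝒞) {α : G}
    (V : InvObj P 𝒞 α) : Nonempty (SplittingChoice h V) := by
  choose E p q hpq hqp hmem using exists_splitting h hns V
  exact ⟨⟨E, p, q, hpq, hqp, fun hA => hmem _ _ hA⟩⟩

end Splittings

/-- If `C` is a non-singular pivotal `G`-graded category over `k`, then its `G`-center, with the duality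
lifted from `C`, is a pivotal `G`-graded category, and it carries a canonical `G`-braided structure
with pivotal crossing: the idempotents `π^V` split, every choice of splittings gives functors `φ_V`,
their limits along `δ` form a pivotal crossing with structure morphisms induced by `ζ` and `η`, and
`Γ` induces a `G`-braiding; the structures obtained from two choices are isomorphic, by a unique
isomorphism over the objects `V* ⊗ A ⊗ V`. -/
theorem theorem3p1 {k : Type*} [CommRing k] {G : Type w} [Group G]
    {C : Type u} [Category.{v} C] [Preadditive C] [Linear k C]
    [MonoidalCategory C] [MonoidalPreadditive C] [MonoidalLinear k C]
    (P : PivotalStructure C) (𝒞 : G → ObjectProperty C)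
    (h : IsPivotalGGraded P 𝒞) (hns : IsNonsingular P 𝒞) :
    ∃ L : CenterPivotal (𝒞 1) P,
      IsPivotalGGraded L.pivotal (GCenter.grading 𝒞) ∧
      (∀ (α : G) (V : InvObj P 𝒞 α), Nonempty (SplittingChoice h V) ∧
        ∀ S : SplittingChoice h V, ∃ F : SplittingFunctor h V, F.choice = S) ∧
      (∀ Φ : SplittingSystem h, ∃ B : CanonicalGBraiding k Φ,
        ∀ α : G, IsPivotalFunctor L.pivotal (B.crossing.φ α)) ∧
      (∀ (Φ Φ' : SplittingSystem h) (B : CanonicalGBraiding k Φ) (B' : CanonicalGBraiding k Φ'),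
        ∃ θ : ∀ α : G, B.crossing.φ α ≅ B'.crossing.φ α,
          IsGBraidedIso B.braiding B'.braiding θ ∧
          (∀ (α : G) (V : InvObj P 𝒞 α) (A : GCenter 𝒞),
            ((θ α).hom.app A).f ≫ ((B'.ι α V).hom.app A).f ≫ (Φ' α V).q A =
              ((B.ι α V).hom.app A).f ≫ (Φ α V).q A) ∧
          ∀ θ' : ∀ α : G, B.crossing.φ α ≅ B'.crossing.φ α,
            (∀ (α : G) (V : InvObj P 𝒞 α) (A : GCenter 𝒞),
              ((θ' α).hom.app A).f ≫ ((B'.ι α V).hom.app A).f ≫ (Φ' α V).q A =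
                ((B.ι α V).hom.app A).f ≫ (Φ α V).q A) → θ' = θ) := by
  refine ⟨centerPivotal h, GCenter.isPivotalGGraded h, fun α V => ⟨nonempty_splittingChoice h hns V,
    fun S => S.exists_splittingFunctor hns⟩, fun Φ => ⟨canonicalGBraiding hns k Φ, fun α =>
    (SplittingSystem.transportSystem hns Φ).isPivotalFunctor h hns α⟩, fun Φ Φ' B B' =>
    ⟨CanonicalGBraiding.comparison hns B B', CanonicalGBraiding.comparison_isGBraidedIso hns B B',
      CanonicalGBraiding.comparison_q hns B B', fun θ' H => ?_⟩⟩
  exact CanonicalGBraiding.eq_of_comp_q B B' hns fun α V A =>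
    (H α V A).trans (CanonicalGBraiding.comparison_q hns B B' α V A).symm
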